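/- Let $n\ge 3$. For $d\ge 1$ let $Q_{1,d-1}(z)=z_1^2-z_2^2-\dots-z_d^2$ on $\mathbb C^d$, let $\Omega(d)=\{\eta\in\mathbb R^d: Q_{1,d-1}(\eta)>0,\ \eta_1>0\}$ be the time-like cone and $T_{\Omega(d)}=\mathbb R^d+i\,\Omega(d)\subset\mathbb C^d$ the tube domain. For real $\lambda$ let $\mathcal H^2(T_{\Omega(d)})_\lambda$ be the weighted Bergman space of holomorphic functions on $T_{\Omega(d)}$ that are square integrable for the measure $Q_{1,d-1}(\eta)^{\lambda-d}\,d\xi\,d\eta$, where $\zeta=\xi+i\eta$ and $d\xi\,d\eta$ is Lebesgue measure on $\mathbb R^{2d}$, with the corresponding $L^2$ inner product. Put $$d\mu_\nu(\tau')=Q_{1,n-2}(\mathrm{Im}\,\tau')^{\nu-n+1}\,d\,\mathrm{Re}\,\tau'\,d\,\mathrm{Im}\,\tau'\qquad\text{on } T_{\Omega(n-1)}.$$ Let $\lambda>n-1$ and $\nu=\lambda+\ell$ with $\ell\in\mathbb N=\{0,1,2,\dots\}$, and set $\alpha=\lambda-\frac{n-1}2$. Write $\zeta=(\zeta',\zeta_n)$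 for the coordinates on $\mathbb C^n$. The holomorphic Juhl operator is $$D_{\lambda\to\nu}=\mathrm{Rest}_{\zeta_n=0}\circ\sum_{k=0}^{[\ell/2]}\frac{(-1)^k2^{\ell-2k}\,\Gamma(\alpha+\ell-k)}{\Gamma(\alpha)\,k!\,(\ell-2k)!}\Big(\frac{\partial}{\partial\zeta_n}\Big)^{\ell-2k}\Big(\frac{\partial^2}{\partial\zeta_1^2}-\frac{\partial^2}{\partial\zeta_2^2}-\dots-\frac{\partial^2}{\partial\zeta_{n-1}^2}\Big)^{k}.$$ The relative reproducing kernel is $$K_{\lambda,\nu}(\zeta,\tau')=Q_{1,n-1}(\zeta'-\overline{\tau'},\zeta_n)^{-\nu}\,\zeta_n^{\,\nu-\lambda},\qquad \zeta\in T_{\Omega(n)},\ \tau'\in T_{\Omega(n-1)},$$ where $Q_{1,n-1}(w)^{-\nu}$ is the holomorphic branch on $T_{\Omega(n)}$ with value $e^{i\pi\nu}Q_{1,n-1}(\eta)^{-\nu}$ at $w=i\eta$, $\eta\in\Omega(n)$. Let $G=SO_o(2,n)$, let $G'=SO_o(2,n-1)$ be embedded in $G$ by $g\mapsto\mathrm{diag}(g,1)$,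 let $\widetilde G$ be the universal covering group of $G$ and $\widetilde G'\subset\widetilde G$ the connected subgroup corresponding to $G'$. The group $\widetilde G$ acts on $\mathcal H^2(T_{\Omega(n)})_\lambda$ by $$(\pi^{(n)}_\lambda(g)f)(\zeta)=j(g^{-1},\zeta)^{-\lambda}f(g^{-1}\cdot\zeta),$$ where $g\cdot\zeta$ is the conformal action on $T_{\Omega(n)}$ and $j$ is its automorphy factor. Explicitly, $g\,v(\zeta)=j(g,\zeta)\,v(g\cdot\zeta)$ for the null vector $v(\zeta)=\big(\tfrac{1-Q(\zeta)}2,\zeta_1,\tfrac{1+Q(\zeta)}2,\zeta_2,\dots,\zeta_n\big)$, $Q=Q_{1,n-1}$; the power is continued from the value $1$ at the identity of $\widetilde G$. In the same way (with $n-1$, $\nu$ in place of $n$, $\lambda$) $\widetilde G'$ acts on $\mathcal H^2(T_{\Omega(n-1)})_\nu$ by $\pi^{(n-1)}_\nu$. Then: 1. The integral $\int_{T_{\Omega(n-1)}}K_{\lambda,\nu}(\zeta,\tau')\,g(\tau')\,d\mu_\nu(\tau')$ converges absolutely for all $g\in\mathcal H^2(T_{\Omega(n-1)})_\nu$ and $\zeta\in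 T_{\Omega(n)}$. 2. $D_{\lambda\to\nu}$ is a continuous linear map $\mathcal H^2(T_{\Omega(n)})_\lambda\to\mathcal H^2(T_{\Omega(n-1)})_\nu$, and its adjoint $D^*_{\lambda\to\nu}$ is given by $$(D^*_{\lambda\to\nu}g)(\zeta)=C\int_{T_{\Omega(n-1)}}K_{\lambda,\nu}(\zeta,\tau')\,g(\tau')\,d\mu_\nu(\tau'),\qquad C=\frac{2^{2\lambda-n+\ell-1}\,(\lambda-n+1)_{n+\ell-1}\,(2\lambda-n)_{\ell+1}}{i^{2\lambda+2\ell}\,\pi^n\,\ell!},$$ where $(x)_k=x(x+1)\cdots(x+k-1)$ and $i^{s}=e^{i\pi s/2}$. 3. In particular, the integral operator $D^*_{\lambda\to\nu}$ is an injective continuous $\widetilde G'$-intertwining operator $\mathcal H^2(T_{\Omega(n-1)})_\nu\hookrightarrow\mathcal H^2(T_{\Omega(n)})_\lambda$, where $\widetilde G'$ acts by $\pi^{(n-1)}_\nu$ on the first space and by the restriction of $\pi^{(n)}_\lambda$ on the second. -/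

import Mathlib

open MeasureTheory Complex
open scoped ComplexConjugate InnerProductSpace

noncomputable section

/-! ### Quadratic forms, time-like cones, tube domains -/

/-- The standard quadratic form of signature `(p, d - p)` in `d` variables, over any commutative
ring: `z_1 ^ 2 + ... + z_p ^ 2 - z_{p+1} ^ 2 - ... - z_d ^ 2`. -/
def stdForm {R : Type*} [CommRing R] (p : ℕ) {d : ℕ} (z : Fin d → R) : R :=
  ∑ i : Fin d, if i.val < p then z i ^ 2 else -(z i ^ 2)

/-- The time-like cone `Ω(d)` in the Minkowski space `ℝ^{1,d-1}`; the time coordinate is the first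
one, which has index `0`. -/
def cone (d : ℕ) : Set (Fin d → ℝ) :=
  {η | 0 < stdForm 1 η ∧ ∀ i : Fin d, (i : ℕ) = 0 → 0 < η i}

/-- Coordinatewise imaginary part. -/
def imPart {d : ℕ} (ζ : Fin d → ℂ) : Fin d → ℝ := fun i => (ζ i).im

/-- Coordinatewise complex conjugate. -/
def conjVec {d : ℕ} (ζ : Fin d → ℂ) : Fin d → ℂ := fun i => conj (ζ i)

/-- The tube domain `T_{Ω(d)} = ℝ^d + i Ω(d)`. -/
def tube (d : ℕ) : Set (Fin d → ℂ) := {ζ | imPart ζ ∈ cone d}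

/-! ### Weighted Bergman spaces -/

/-- The measure `Q_{1,d-1}(η) ^ (lam - d) dξ dη` on the tube domain, where `ζ = ξ + i η` and
`dξ dη` is Lebesgue measure on `ℂ^d = ℝ^{2d}`. -/
def bergmanMeasure (d : ℕ) (lam : ℝ) : Measure (Fin d → ℂ) :=
  (volume.restrict (tube d)).withDensity
    fun ζ => ENNReal.ofReal (stdForm 1 (imPart ζ) ^ (lam - (d : ℝ)))

/-- Holomorphic functions on the tube domain which are square integrable for the weighted measure.
A function on the tube domain is represented by its extension by zero to `ℂ^d`. -/
def bergmanSubmodule (d : ℕ) (lam : ℝ) : Submodule ℂ ((Fin d → ℂ) → ℂ) where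
  carrier := {f | DifferentiableOn ℂ f (tube d) ∧ (∀ ζ, ζ ∉ tube d → f ζ = 0) ∧
    MemLp f 2 (bergmanMeasure d lam)}
  add_mem' := fun ha hb => ⟨ha.1.add hb.1,
    fun ζ hζ => by simp [ha.2.1 ζ hζ, hb.2.1 ζ hζ], ha.2.2.add hb.2.2⟩
  zero_mem' := ⟨differentiableOn_const (0 : ℂ), fun _ _ => rfl, MemLp.zero⟩
  smul_mem' := fun c f hf => ⟨hf.1.const_smul c, fun ζ hζ => by simp [hf.2.1 ζ hζ],
    hf.2.2.const_smul c⟩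

/-- The weighted Bergman space `H²(T_{Ω(d)})_lam`. -/
def Bergman (d : ℕ) (lam : ℝ) : Type := bergmanSubmodule d lam

namespace Bergman

variable {d : ℕ} {lam : ℝ}

instance : AddCommGroup (Bergman d lam) := inferInstanceAs (AddCommGroup (bergmanSubmodule d lam))

instance : Module ℂ (Bergman d lam) := inferInstanceAs (Module ℂ (bergmanSubmodule d lam))

/-- The function on `ℂ^d` underlying an element of the weighted Bergman space. -/
def toFun (f : Bergman d lam) : (Fin d → ℂ) → ℂ := Subtype.val (p := (· ∈ bergmanSubmodule d lam)) f

instance : CoeFun (Bergman d lam) (fun _ => (Fin d → ℂ) → ℂ) := ⟨toFun⟩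

theorem differentiableOn (f : Bergman d lam) : DifferentiableOn ℂ f (tube d) := f.2.1

theorem eq_zero_of_notMem (f : Bergman d lam) {ζ : Fin d → ℂ} (h : ζ ∉ tube d) : f ζ = 0 :=
  f.2.2.1 ζ h

theorem memLp (f : Bergman d lam) : MemLp f 2 (bergmanMeasure d lam) := f.2.2.2

theorem add_apply (f g : Bergman d lam) (ζ : Fin d → ℂ) : (f + g) ζ = f ζ + g ζ := rfl

theorem smul_apply (c : ℂ) (f : Bergman d lam) (ζ : Fin d → ℂ) : (c • f) ζ = c * f ζ := rfl

end Bergman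

theorem continuous_imPart {d : ℕ} : Continuous (imPart : (Fin d → ℂ) → Fin d → ℝ) := by
  unfold imPart; fun_prop

theorem continuous_stdForm {d : ℕ} (p : ℕ) :
    Continuous (stdForm p : (Fin d → ℝ) → ℝ) := by
  unfold stdForm
  refine continuous_finsetSum _ fun i _ => ?_
  split_ifs <;> fun_prop

theorem isOpen_tube (d : ℕ) : IsOpen (tube d) := by
  have h1 : IsOpen (cone d) := by
    have : cone d = {η | 0 < stdForm 1 η} ∩ ⋂ i : Fin d, {η | (i : ℕ) = 0 → 0 < η i} := by
      ext η; simp [cone]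
    rw [this]
    refine (isOpen_lt continuous_const (continuous_stdForm 1)).inter
      (isOpen_iInter_of_finite fun i => ?_)
    by_cases hi : (i : ℕ) = 0
    · simpa [hi] using isOpen_lt continuous_const (continuous_apply i)
    · simp [hi]
  exact h1.preimage continuous_imPart

namespace Bergman

variable {d : ℕ} {lam : ℝ}

theorem integrable_inner (f g : Bergman d lam) :
    Integrable (fun ζ => conj (f ζ) * g ζ) (bergmanMeasure d lam) :=
  f.memLp.star.integrable_mul g.memLp

/-- If the weighted square norm vanishes then so does the function. -/
theorem eq_zero_of_integral (f : Bergman d lam)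
    (h : ∫ ζ, conj (f ζ) * f ζ ∂(bergmanMeasure d lam) = 0) : f = 0 := by
  have e : ∀ ζ, conj (f ζ) * f ζ = ((‖f ζ‖ ^ 2 : ℝ) : ℂ) := fun ζ => by
    rw [Complex.conj_mul']; norm_cast
  have hi := f.memLp.integrable_norm_pow (by norm_num)
  simp only [e] at h
  rw [integral_complex_ofReal, Complex.ofReal_eq_zero,
    integral_eq_zero_iff_of_nonneg (fun ζ => by positivity) (by simpa using hi)] at h
  have hm : Measurable fun ζ : Fin d → ℂ =>
      ENNReal.ofReal (stdForm 1 (imPart ζ) ^ (lam - (d : ℝ))) :=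
    (((continuous_stdForm 1).comp continuous_imPart).measurable.pow_const _).ennreal_ofReal
  have h2 : (fun ζ => f ζ) =ᵐ[volume.restrict (tube d)] fun _ => (0 : ℂ) := by
    have h1 := (ae_withDensity_iff hm).1 h
    filter_upwards [h1, ae_restrict_mem (isOpen_tube d).measurableSet] with ζ hζ hmem
    have hpos : 0 < stdForm 1 (imPart ζ) ^ (lam - (d : ℝ)) := Real.rpow_pos_of_pos hmem.1 _
    have := hζ (by simpa using hpos)
    simpa using this
  have h3 := Measure.eqOn_open_of_ae_eq h2 (isOpen_tube d) f.differentiableOn.continuousOn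
    continuousOn_const
  apply Subtype.ext
  funext ζ
  by_cases hζ : ζ ∈ tube d
  · exact h3 hζ
  · exact f.eq_zero_of_notMem hζ

/-- The inner product `⟪f, g⟫ = ∫ conj f * g`, conjugate linear in the first variable. -/
@[reducible]
def innerCore (d : ℕ) (lam : ℝ) : InnerProductSpace.Core ℂ (Bergman d lam) where
  inner f g := ∫ ζ, conj (f ζ) * g ζ ∂(bergmanMeasure d lam)
  conj_inner_symm f g := by
    rw [← integral_conj]
    refine integral_congr_ae (.of_forall fun ζ => ?_)
    simp [mul_comm]
  re_inner_nonneg f := by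
    have : ∀ ζ, conj (f ζ) * f ζ = ((‖f ζ‖ ^ 2 : ℝ) : ℂ) := fun ζ => by
      rw [Complex.conj_mul']; norm_cast
    simp only [this]
    rw [integral_complex_ofReal]
    exact integral_nonneg (fun ζ => by positivity)
  add_left f g h := by
    simp only [add_apply, map_add, add_mul]
    exact integral_add (integrable_inner f h) (integrable_inner g h)
  smul_left f g r := by
    simp only [smul_apply, map_mul, mul_assoc]
    exact integral_const_mul _ _
  definite f hf := eq_zero_of_integral f hf

instance : NormedAddCommGroup (Bergman d lam) :=
  @InnerProductSpace.Core.toNormedAddCommGroup ℂ (Bergman d lam) _ _ _ (innerCore d lam)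

instance : InnerProductSpace ℂ (Bergman d lam) :=
  InnerProductSpace.ofCore (innerCore d lam).toCore

theorem inner_def (f g : Bergman d lam) :
    ⟪f, g⟫_ℂ = ∫ ζ, conj (f ζ) * g ζ ∂(bergmanMeasure d lam) := rfl

end Bergman

/-! ### Holomorphic Juhl operators

In this part `n = m + 1`; the coordinates of `ℂ^n` are `ζ = (ζ', ζ_n)` with `ζ'` in `ℂ^{n-1}`. -/

/-- The holomorphic partial derivative `∂/∂ζ_i`. -/
def partialDeriv {d : ℕ} (i : Fin d) (f : (Fin d → ℂ) → ℂ) : (Fin d → ℂ) → ℂ :=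
  fun ζ => fderiv ℂ f ζ (Pi.single i 1)

/-- The holomorphic Laplacian `∂²/∂ζ_1² - ∂²/∂ζ_2² - ... - ∂²/∂ζ_{n-1}²` of `ℂ^{1,n-2}`, acting on
functions on `ℂ^n`, `n = m + 1`. -/
def lorentzLaplacian {m : ℕ} (f : (Fin (m + 1) → ℂ) → ℂ) : (Fin (m + 1) → ℂ) → ℂ :=
  fun ζ => ∑ i : Fin m, if (i : ℕ) = 0
    then partialDeriv i.castSucc (partialDeriv i.castSucc f) ζ
    else -partialDeriv i.castSucc (partialDeriv i.castSucc f) ζ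

/-- The coefficient `a_k(ℓ, α)` of the Gegenbauer polynomial. -/
def gegenbauerCoeff (k l : ℕ) (α : ℝ) : ℝ :=
  (-1) ^ k * 2 ^ (l - 2 * k) * Real.Gamma (α + l - k) /
    (Real.Gamma α * k.factorial * (l - 2 * k).factorial)

/-- The differential operator
`∑_{k ≤ ℓ/2} a_k(ℓ, α) (∂/∂ζ_n)^(ℓ - 2k) Δ^k` on `ℂ^n`, `n = m + 1`. -/
def juhlDiffOp {m : ℕ} (l : ℕ) (α : ℝ) (f : (Fin (m + 1) → ℂ) → ℂ) : (Fin (m + 1) → ℂ) → ℂ :=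
  fun ζ => ∑ k ∈ Finset.range (l / 2 + 1), (gegenbauerCoeff k l α : ℂ) *
    (partialDeriv (Fin.last m))^[l - 2 * k] (lorentzLaplacian^[k] f) ζ

/-- The holomorphic Juhl operator `D_{lam → lam + ℓ}` from functions on `T_{Ω(n)}` to functions on
`T_{Ω(n-1)}`, `n = m + 1`: the differential operator with `α = lam - (n - 1) / 2`, followed by
restriction to `ζ_n = 0`. -/
def juhlOp {m : ℕ} (lam : ℝ) (l : ℕ) (f : (Fin (m + 1) → ℂ) → ℂ) : (Fin m → ℂ) → ℂ :=
  fun τ => juhlDiffOp l (lam - (m : ℝ) / 2) f (Fin.snoc τ 0)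

/-! ### The relative reproducing kernel -/

/-- The power `Q(w) ^ (-ν)` on the tube domain, `Q = Q_{1,d-1}`: the holomorphic branch which takes
the value `exp(iπν) Q(η) ^ (-ν)` at `w = iη`, `η ∈ Ω(d)`. (For `w` in the tube domain `-Q(w)` never
lies in `(-∞, 0]`, so the principal power of `-Q(w)` is holomorphic there.) -/
def formPow (nu : ℝ) {d : ℕ} (w : Fin d → ℂ) : ℂ :=
  exp (I * Real.pi * nu) * (-(stdForm 1 w)) ^ (-(nu : ℂ))

/-- The relative reproducing kernel `K_{lam,ν}(ζ, τ') = Q(ζ' - conj τ', ζ_n) ^ (-ν) ζ_n ^ ℓ`,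
`ℓ = ν - lam`. -/
def relKernel {m : ℕ} (nu : ℝ) (l : ℕ) (ζ : Fin (m + 1) → ℂ) (τ : Fin m → ℂ) : ℂ :=
  formPow nu (ζ - Fin.snoc (conjVec τ) 0 : Fin (m + 1) → ℂ) * ζ (Fin.last m) ^ l

/-- The Pochhammer symbol `(x)_k = x (x + 1) ... (x + k - 1)`. -/
def poch (x : ℝ) (k : ℕ) : ℝ := (ascPochhammer ℝ k).eval x

/-- The constant of the integral formula, for `n ≥ 1`. The complex power of `i` is the principal
one. -/
def holoConst (n l : ℕ) (lam : ℝ) : ℂ :=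
  (((2 : ℝ) ^ (2 * lam - n + l - 1) * poch (lam - n + 1) (n + l - 1) * poch (2 * lam - n) (l + 1) :
    ℝ) : ℂ) / (I ^ (2 * (lam : ℂ) + 2 * l) * (Real.pi : ℂ) ^ n * (l.factorial : ℂ))

/-! ### The groups `SO_o(2, d)` and the representations `π_lam^{(d)}` of the universal covering -/

/-- The indefinite orthogonal group `O(2, d)`. -/
def indefOrth (d : ℕ) : Subgroup (GL (Fin (d + 2)) ℝ) where
  carrier := {g | ∀ x, stdForm 2 ((g : Matrix (Fin (d + 2)) (Fin (d + 2)) ℝ).mulVec x) =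
    stdForm 2 x}
  mul_mem' := fun {a b} ha hb x => by
    rw [Units.val_mul, ← Matrix.mulVec_mulVec, ha, hb]
  one_mem' := fun x => by simp
  inv_mem' := fun {a} ha x => by
    rw [← ha, Matrix.mulVec_mulVec, ← Units.val_mul, mul_inv_cancel, Units.val_one,
      Matrix.one_mulVec]

/-- `SO_o(2, d)`, the identity component of `O(2, d)`. -/
abbrev SOo (d : ℕ) : Subgroup (indefOrth d) := Subgroup.connectedComponentOfOne (indefOrth d)

/-- The underlying matrix group element. -/
def toGL {d : ℕ} (g : SOo d) : GL (Fin (d + 2)) ℝ := ((g : indefOrth d) : GL _ ℝ)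

/-- The block embedding `g ↦ diag(g, 1)`, which realizes `O(2, m)` as the subgroup of `O(2, m + 1)`
that fixes the last coordinate. -/
def blockEmb (m : ℕ) : GL (Fin (m + 2)) ℝ →* GL (Fin (m + 1 + 2)) ℝ :=
  Units.map
    { toFun := fun A => Matrix.reindex (finSumFinEquiv (m := m + 2) (n := 1))
        (finSumFinEquiv (m := m + 2) (n := 1)) (Matrix.fromBlocks A 0 0 1)
      map_one' := by simp
      map_mul' := fun A B => by
        simp [Matrix.submatrix_mul_equiv, Matrix.fromBlocks_multiply] }

/-- The embedding of `ℂ^d` (`d ≥ 1`) into the null cone of the quadratic form of signature `(2, d)`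
on `ℂ^{d+2}`: `ζ ↦ ((1 - Q(ζ)) / 2, ζ_1, (1 + Q(ζ)) / 2, ζ_2, ..., ζ_d)`, `Q = Q_{1,d-1}`. Composed
with the projection to the projective space it is the open embedding of `ℂ^d` into the compact dual
of the Hermitian symmetric space of `SO_o(2, d)`. -/
def nullVec {d : ℕ} (ζ : Fin d → ℂ) : Fin (d + 2) → ℂ := fun k =>
  if h0 : (k : ℕ) = 0 then (1 - stdForm 1 ζ) / 2
  else if h1 : (k : ℕ) = 1 then (if h : 0 < d then ζ ⟨0, h⟩ else 0)
  else if h2 : (k : ℕ) = 2 then (1 + stdForm 1 ζ) / 2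
  else ζ ⟨(k : ℕ) - 2, by omega⟩

/-- The vector `g · nullVec ζ`. -/
def actNull {d : ℕ} (g : GL (Fin (d + 2)) ℝ) (ζ : Fin d → ℂ) : Fin (d + 2) → ℂ :=
  ((g : Matrix (Fin (d + 2)) (Fin (d + 2)) ℝ).map (fun x : ℝ => (x : ℂ))).mulVec (nullVec ζ)

/-- The automorphy factor `j(g, ζ)`, the scalar with `g · nullVec ζ = j(g, ζ) • nullVec (g . ζ)`
(the sum of the first and the third coordinate of `nullVec` is `1`). -/
def autFactor {d : ℕ} (g : GL (Fin (d + 2)) ℝ) (ζ : Fin d → ℂ) : ℂ :=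
  actNull g ζ 0 + actNull g ζ 2

/-- The conformal (linear fractional) action `g . ζ` of `SO_o(2, d)` on the tube domain. -/
def confAct {d : ℕ} (g : GL (Fin (d + 2)) ℝ) (ζ : Fin d → ℂ) : Fin d → ℂ := fun i =>
  (if (i : ℕ) = 0 then actNull g ζ 1 else actNull g ζ (i.addNat 2)) / autFactor g ζ

/-- For a continuous nowhere vanishing `c : [0,1] → ℂ` with `c 0 = 1`: the value at `1` of the
continuous logarithm `L` of `c` with `L 0 = 0`. -/
def pathLog (c : unitInterval → ℂ) : ℂ :=
  open Classical in
  if h : ∃ L : C(unitInterval, ℂ), L 0 = 0 ∧ ∀ t, exp (L t) = c t then h.choose 1 else 0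

/-- The value `pathLog c` is the one it should be. -/
theorem exists_lift_and_pathLog_eq (c : C(unitInterval, ℂ)) (h0 : c 0 = 1) (hc : ∀ t, c t ≠ 0) :
    ∃ L : C(unitInterval, ℂ), L 0 = 0 ∧ (∀ t, exp (L t) = c t) ∧ pathLog c = L 1 := by
  have cov := isCoveringMap_exp
  let c' : C(unitInterval, {z : ℂ // z ≠ 0}) := ⟨fun t => ⟨c t, hc t⟩, by fun_prop⟩
  obtain ⟨L, hL, hL0⟩ := cov.exists_path_lifts c' 0 (Subtype.ext (by simp [c', h0]))
  have h : ∃ L : C(unitInterval, ℂ), L 0 = 0 ∧ ∀ t, exp (L t) = c t :=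
    ⟨L, hL0, fun t => congrArg Subtype.val (congrFun hL t)⟩
  refine ⟨L, hL0, fun t => congrArg Subtype.val (congrFun hL t), ?_⟩
  have e : ⇑h.choose = L := cov.eq_of_comp_eq h.choose.continuous L.continuous
    (by rw [hL]; exact funext fun t => Subtype.ext (h.choose_spec.2 t)) 0
    (by rw [h.choose_spec.1, hL0])
  rw [pathLog, dif_pos h, e]

/-- An element of the universal covering group of `SO_o(2, d)` is the homotopy class (with fixed end
points) of a continuous path `γ` in `SO_o(2, d)` which starts at the identity. This is its action in
the representation `π_lam^{(d)}` on functions on the tube domain,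
`f ↦ (ζ ↦ j(g⁻¹, ζ) ^ (-lam) f(g⁻¹ . ζ))`, where `g = γ 1` and where `j(g⁻¹, ζ) ^ (-lam)` is obtained
from `1` by continuation of `j((γ t)⁻¹, ζ) ^ (-lam)` along `γ`. -/
def tubeRep {d : ℕ} (lam : ℝ) (γ : unitInterval → GL (Fin (d + 2)) ℝ) (f : (Fin d → ℂ) → ℂ) :
    (Fin d → ℂ) → ℂ := fun ζ =>
  exp (-(lam : ℂ) * pathLog fun t => autFactor (γ t)⁻¹ ζ) * f (confAct (γ 1)⁻¹ ζ)

end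

noncomputable section

/-! ### Holomorphic functions on open subsets of normed spaces -/

section Holomorphic

variable {E F : Type*} [NormedAddCommGroup E] [NormedSpace ℂ E] [NormedAddCommGroup F]
  [NormedSpace ℂ F]

theorem norm_fderiv_le_of_bounded_on_ball {f : E → F} {c : E} {R C : ℝ} (hR : 0 < R)
    (hd : DifferentiableOn ℂ f (Metric.ball c R)) (hC : ∀ x ∈ Metric.ball c R, ‖f x‖ ≤ C) :
    ‖fderiv ℂ f c‖ ≤ 2 * C / R := by
  refine norm_fderiv_le_div_of_mapsTo_ball hd (fun x hx => ?_) hR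
  rw [mem_closedBall_iff_norm]
  have := norm_sub_le (f x) (f c)
  have := hC x hx
  have := hC c (Metric.mem_ball_self hR)
  linarith

theorem norm_taylor_remainder_le {f : E → F} {c x : E} {R C : ℝ} (hR : 0 < R)
    (hd : DifferentiableOn ℂ f (Metric.ball c R)) (hC : ∀ x ∈ Metric.ball c R, ‖f x‖ ≤ C)
    (hx : x ∈ Metric.ball c R) :
    ‖f x - f c - fderiv ℂ f c (x - c)‖ ≤ 4 * C / R ^ 2 * ‖x - c‖ ^ 2 := by
  have hfc : HasFDerivAt f (fderiv ℂ f c) c :=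
    (hd.differentiableAt (Metric.ball_mem_nhds c hR)).hasFDerivAt
  set g : E → F := fun y => f y - fderiv ℂ f c (y - c) with hg
  have hgc : g c = f c := by simp [hg]
  have hC0 : 0 ≤ C := (norm_nonneg _).trans (hC c (Metric.mem_ball_self hR))
  have hb := norm_fderiv_le_of_bounded_on_ball hR hd hC
  have h := dist_le_mul_div_pow_of_mapsTo_ball_of_isLittleO (f := g) (c := c) (z := x) (R₁ := R)
    (R₂ := 4 * C) (n := 1) ?_ ?_ ?_ hx
  · rw [dist_eq_norm_sub, hgc] at h
    have e : g x - f c = f x - f c - fderiv ℂ f c (x - c) := by simp only [hg]; abel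
    rw [e, dist_eq_norm_sub] at h
    convert h using 1
    ring
  · exact hd.sub (by fun_prop)
  · intro y hy
    rw [mem_closedBall_iff_norm, hgc]
    have h1 : ‖fderiv ℂ f c (y - c)‖ ≤ 2 * C / R * R := by
      refine (ContinuousLinearMap.le_of_opNorm_le _ hb _).trans ?_
      have : ‖y - c‖ ≤ R := (mem_ball_iff_norm.1 hy).le
      gcongr
    rw [div_mul_cancel₀ _ hR.ne'] at h1
    have e : g y - f c = f y - f c - fderiv ℂ f c (y - c) := by simp only [hg]; abel
    rw [e]
    have h2 := norm_sub_le (f y - f c) (fderiv ℂ f c (y - c))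
    have h3 := norm_sub_le (f y) (f c)
    have := hC y hy
    have := hC c (Metric.mem_ball_self hR)
    linarith
  · simp only [pow_one]
    refine (hfc.isLittleO.congr' (.of_forall fun y => ?_) .rfl).norm_right
    simp only [hg]
    simp
    try abel

theorem hasFDerivAt_of_norm_sub_le_sq {f : E → F} {c : E} {A : E →L[ℂ] F} {R M : ℝ} (hR : 0 < R)
    (h : ∀ x ∈ Metric.ball c R, ‖f x - f c - A (x - c)‖ ≤ M * ‖x - c‖ ^ 2) :
    HasFDerivAt f A c := by
  rw [hasFDerivAt_iff_isLittleO]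
  have h1 : (fun x => f x - f c - A (x - c)) =O[nhds c] fun x => ‖x - c‖ ^ 2 :=
    Asymptotics.IsBigO.of_bound M (by
      filter_upwards [Metric.ball_mem_nhds c hR] with x hx
      simpa using h x hx)
  refine h1.trans_isLittleO ?_
  have h2 : Filter.Tendsto (fun x : E => ‖x - c‖) (nhds c) (nhds 0) := by
    have : Continuous fun x : E => ‖x - c‖ := by fun_prop
    simpa using this.tendsto c
  have h3 := ((Asymptotics.isLittleO_one_iff ℝ).2 h2).mul_isBigO
    (Asymptotics.isBigO_refl (fun x : E => ‖x - c‖) (nhds c))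
  simpa [pow_two] using h3.norm_right

/-- A uniform limit of holomorphic functions is holomorphic. -/
theorem differentiableAt_of_tendstoUniformlyOn_ball [CompleteSpace F] {u : ℕ → E → F} {f : E → F}
    {c : E} {R : ℝ} (hR : 0 < R) (hu : ∀ n, DifferentiableOn ℂ (u n) (Metric.ball c R))
    {C : ℝ} (hC : ∀ n, ∀ x ∈ Metric.ball c R, ‖u n x‖ ≤ C) {b : ℕ → ℝ}
    (hb : Filter.Tendsto b Filter.atTop (nhds 0))
    (h : ∀ n, ∀ x ∈ Metric.ball c R, ‖u n x - f x‖ ≤ b n) : DifferentiableAt ℂ f c := by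
  have hdn : ∀ n, DifferentiableAt ℂ (u n) c := fun n =>
    (hu n).differentiableAt (Metric.ball_mem_nhds c hR)
  have hb0 : ∀ n, 0 ≤ b n := fun n => (norm_nonneg _).trans (h n c (Metric.mem_ball_self hR))
  have hcau : CauchySeq fun n => fderiv ℂ (u n) c := by
    rw [Metric.cauchySeq_iff]
    intro ε hε
    have hev := hb.eventually (gt_mem_nhds (show 0 < ε * R / 8 by positivity))
    obtain ⟨N, hN⟩ := Filter.eventually_atTop.1 hev
    refine ⟨N, fun n hn k hk => ?_⟩
    rw [dist_eq_norm_sub, ← fderiv_sub (hdn n) (hdn k)]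
    have := norm_fderiv_le_of_bounded_on_ball (C := b n + b k) hR ((hu n).sub (hu k)) (fun x hx => by
      have h1 := h n x hx
      have h2 := h k x hx
      have : (u n - u k) x = (u n x - f x) - (u k x - f x) := by simp
      rw [this]
      exact (norm_sub_le _ _).trans (add_le_add h1 h2))
    refine this.trans_lt ?_
    rw [div_lt_iff₀ hR]
    have := hN n hn
    have := hN k hk
    nlinarith
  obtain ⟨A, hA⟩ := cauchySeq_tendsto_of_complete hcau
  have hlim : ∀ x ∈ Metric.ball c R, Filter.Tendsto (fun n => u n x) Filter.atTop (nhds (f x)) :=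
    fun x hx => tendsto_iff_norm_sub_tendsto_zero.2
      (squeeze_zero (fun _ => norm_nonneg _) (fun n => h n x hx) hb)
  have hmain : ∀ x ∈ Metric.ball c R, ‖f x - f c - A (x - c)‖ ≤ 4 * C / R ^ 2 * ‖x - c‖ ^ 2 := by
    intro x hx
    have ht : Filter.Tendsto (fun n => ‖u n x - u n c - fderiv ℂ (u n) c (x - c)‖) Filter.atTop
        (nhds ‖f x - f c - A (x - c)‖) :=
      (((hlim x hx).sub (hlim c (Metric.mem_ball_self hR))).sub
        (((ContinuousLinearMap.apply ℂ F (x - c)).continuous.tendsto A).comp hA)).norm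
    exact le_of_tendsto' ht fun n => norm_taylor_remainder_le hR (hu n) (hC n) hx
  exact (hasFDerivAt_of_norm_sub_le_sq hR hmain).differentiableAt

/-- The directional derivatives of a holomorphic function are holomorphic. -/
theorem DifferentiableOn.fderiv_apply_of_isOpen [CompleteSpace F] {f : E → F} {U : Set E}
    (hU : IsOpen U) (hf : DifferentiableOn ℂ f U) (v : E) :
    DifferentiableOn ℂ (fun z => fderiv ℂ f z v) U := by
  intro c hc
  apply DifferentiableAt.differentiableWithinAt
  have hcont := (hf.differentiableAt (hU.mem_nhds hc)).continuousAt
  obtain ⟨R, hR, hRU⟩ : ∃ R > 0, Metric.ball c R ⊆ U ∩ {z | ‖f z‖ < ‖f c‖ + 1} :=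
    Metric.mem_nhds_iff.1 (Filter.inter_mem (hU.mem_nhds hc)
      (hcont.norm.eventually (gt_mem_nhds (lt_add_one _))))
  set C := ‖f c‖ + 1
  have hC0 : 0 ≤ C := by positivity
  have hd : DifferentiableOn ℂ f (Metric.ball c R) := hf.mono fun x hx => (hRU hx).1
  have hC : ∀ x ∈ Metric.ball c R, ‖f x‖ ≤ C := fun x hx => (hRU hx).2.le
  obtain ⟨r, hr, rfl⟩ : ∃ r > 0, R = 2 * r := ⟨R / 2, by positivity, by ring⟩
  have hsub : ∀ z ∈ Metric.ball c r, Metric.ball z r ⊆ Metric.ball c (2 * r) := fun z hz =>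
    Metric.ball_subset_ball' (by have := Metric.mem_ball.1 hz; linarith)
  set t : ℕ → ℝ := fun n => r / ((n + 1) * (‖v‖ + 1)) with ht
  have ht0 : ∀ n, 0 < t n := fun n => by positivity
  have htv : ∀ n, ‖(t n : ℂ) • v‖ < r := fun n => by
    rw [norm_smul, Complex.norm_real, Real.norm_of_nonneg (ht0 n).le, ht, div_mul_eq_mul_div,
      div_lt_iff₀ (by positivity)]
    have : (0 : ℝ) ≤ n := Nat.cast_nonneg n
    nlinarith [norm_nonneg v, mul_nonneg this (norm_nonneg v)]
  have hzt : ∀ n, ∀ z ∈ Metric.ball c r, z + (t n : ℂ) • v ∈ Metric.ball z r := fun n z _ => by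
    rw [mem_ball_iff_norm, add_sub_cancel_left]; exact htv n
  set b : ℕ → ℝ := fun n => 4 * C / r ^ 2 * ‖v‖ ^ 2 * t n with hbdef
  have hest : ∀ n, ∀ z ∈ Metric.ball c r,
      ‖(t n : ℂ)⁻¹ • (f (z + (t n : ℂ) • v) - f z) - fderiv ℂ f z v‖ ≤ b n := by
    intro n z hz
    have h1 := norm_taylor_remainder_le hr (hd.mono (hsub z hz)) (fun x hx => hC x (hsub z hz hx))
      (hzt n z hz)
    have hne : (t n : ℂ) ≠ 0 := by exact_mod_cast (ht0 n).ne'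
    have e : (t n : ℂ)⁻¹ • (f (z + (t n : ℂ) • v) - f z) - fderiv ℂ f z v
        = (t n : ℂ)⁻¹ • (f (z + (t n : ℂ) • v) - f z
          - fderiv ℂ f z (z + (t n : ℂ) • v - z)) := by
      rw [add_sub_cancel_left, map_smul, smul_sub (t n : ℂ)⁻¹ (f _ - f z), smul_smul,
        inv_mul_cancel₀ hne, one_smul]
    rw [e, norm_smul, norm_inv, Complex.norm_real, Real.norm_of_nonneg (ht0 n).le,
      inv_mul_le_iff₀ (ht0 n)]
    refine h1.trans (le_of_eq ?_)
    rw [add_sub_cancel_left, norm_smul, Complex.norm_real, Real.norm_of_nonneg (ht0 n).le, hbdef]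
    ring
  have htlim : Filter.Tendsto t Filter.atTop (nhds 0) := by
    have : t = fun n : ℕ => r / (‖v‖ + 1) * (1 / ((n : ℝ) + 1)) := by
      funext n; simp only [ht]; field_simp
    rw [this]
    simpa using tendsto_one_div_add_atTop_nhds_zero_nat.const_mul (r / (‖v‖ + 1))
  have hblim : Filter.Tendsto b Filter.atTop (nhds 0) := by
    simpa [hbdef] using htlim.const_mul (4 * C / r ^ 2 * ‖v‖ ^ 2)
  have htle : ∀ n, t n ≤ t 0 := fun n => by
    simp only [ht]; gcongr; simp
  refine differentiableAt_of_tendstoUniformlyOn_ball hr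
    (u := fun n z => (t n : ℂ)⁻¹ • (f (z + (t n : ℂ) • v) - f z))
    (C := 2 * C / r * ‖v‖ + b 0) (fun n => ?_) (fun n z hz => ?_) hblim hest
  · refine DifferentiableOn.const_smul (DifferentiableOn.sub ?_ (hd.mono ?_)) _
    · exact hd.comp (by fun_prop) fun z hz => hsub z hz (hzt n z hz)
    · exact Metric.ball_subset_ball (by linarith)
  · have h1 := hest n z hz
    have h2 := ContinuousLinearMap.le_of_opNorm_le _ (norm_fderiv_le_of_bounded_on_ball hr
      (hd.mono (hsub z hz)) (fun x hx => hC x (hsub z hz hx))) v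
    have h3 : b n ≤ b 0 := by simp only [hbdef]; exact mul_le_mul_of_nonneg_left (htle n) (by positivity)
    have h4 := norm_le_norm_sub_add ((t n : ℂ)⁻¹ • (f (z + (t n : ℂ) • v) - f z)) (fderiv ℂ f z v)
    linarith

end Holomorphic

/-! ### Geometry of the time-like cone -/

section Geometry

variable {k : ℕ}

/-- The bilinear form of signature `(1, k)` with quadratic form `stdForm 1`. -/
def lorentz {R : Type*} [CommRing R] (x y : Fin (k + 1) → R) : R :=
  x 0 * y 0 - ∑ i : Fin k, x i.succ * y i.succ

theorem stdForm_one_eq {R : Type*} [CommRing R] (x : Fin (k + 1) → R) :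
    stdForm 1 x = x 0 ^ 2 - ∑ i : Fin k, x i.succ ^ 2 := by
  simp [stdForm, Fin.sum_univ_succ, sub_eq_add_neg]

theorem lorentz_self {R : Type*} [CommRing R] (x : Fin (k + 1) → R) :
    lorentz x x = stdForm 1 x := by
  simp [stdForm_one_eq, lorentz, pow_two]

theorem lorentz_comm {R : Type*} [CommRing R] (x y : Fin (k + 1) → R) :
    lorentz x y = lorentz y x := by
  simp [lorentz, mul_comm]

theorem lorentz_add_left {R : Type*} [CommRing R] (x y z : Fin (k + 1) → R) :
    lorentz (x + y) z = lorentz x z + lorentz y z := by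
  simp only [lorentz, Pi.add_apply, add_mul, Finset.sum_add_distrib]; ring

theorem lorentz_smul_left {R : Type*} [CommRing R] (r : R) (x z : Fin (k + 1) → R) :
    lorentz (r • x) z = r * lorentz x z := by
  simp only [lorentz, Pi.smul_apply, smul_eq_mul, mul_sub, Finset.mul_sum, mul_assoc]

theorem stdForm_one_add {R : Type*} [CommRing R] (x y : Fin (k + 1) → R) :
    stdForm 1 (x + y) = stdForm 1 x + 2 * lorentz x y + stdForm 1 y := by
  rw [← lorentz_self, lorentz_add_left, lorentz_comm x, lorentz_comm y, lorentz_add_left,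
    lorentz_add_left, lorentz_self, lorentz_self, lorentz_comm y x]; ring

theorem stdForm_smul {R : Type*} [CommRing R] {d : ℕ} (p : ℕ) (r : R) (x : Fin d → R) :
    stdForm p (r • x) = r ^ 2 * stdForm p x := by
  simp only [stdForm, Finset.mul_sum, Pi.smul_apply, smul_eq_mul]
  refine Finset.sum_congr rfl fun i _ => ?_
  split_ifs <;> ring

theorem mem_cone_iff {η : Fin (k + 1) → ℝ} : η ∈ cone (k + 1) ↔ 0 < stdForm 1 η ∧ 0 < η 0 := by
  refine and_congr_right fun _ => ⟨fun h => h 0 rfl, fun h i hi => ?_⟩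
  rwa [show i = 0 from Fin.ext hi]

theorem sum_mul_sq_lt_of_mem_cone {η x : Fin (k + 1) → ℝ} (hη : 0 < stdForm 1 η)
    (hx : 0 < stdForm 1 x) : (∑ i : Fin k, η i.succ * x i.succ) ^ 2 < (η 0 * x 0) ^ 2 := by
  rw [stdForm_one_eq] at hη hx
  have h := Finset.sum_mul_sq_le_sq_mul_sq Finset.univ (fun i : Fin k => η i.succ)
    fun i => x i.succ
  have h1 : (0 : ℝ) ≤ ∑ i : Fin k, η i.succ ^ 2 := by positivity
  have h2 : (0 : ℝ) ≤ ∑ i : Fin k, x i.succ ^ 2 := by positivity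
  nlinarith

theorem lorentz_pos_of_mem_cone {η x : Fin (k + 1) → ℝ} (hη : η ∈ cone (k + 1))
    (hx : x ∈ cone (k + 1)) : 0 < lorentz η x := by
  rw [mem_cone_iff] at hη hx
  have h := sum_mul_sq_lt_of_mem_cone hη.1 hx.1
  have := abs_lt_of_sq_lt_sq h (mul_pos hη.2 hx.2).le
  rw [lorentz]
  linarith [(abs_lt.1 (abs_lt_of_sq_lt_sq h (mul_pos hη.2 hx.2).le)).2]

theorem mem_cone_of_lorentz_pos {η x : Fin (k + 1) → ℝ} (hη : η ∈ cone (k + 1))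
    (hx : 0 < stdForm 1 x) (h : 0 < lorentz η x) : x ∈ cone (k + 1) := by
  rw [mem_cone_iff] at hη ⊢
  refine ⟨hx, ?_⟩
  have h1 := sum_mul_sq_lt_of_mem_cone hη.1 hx
  by_contra hneg
  have h3 : η 0 * x 0 ≤ 0 := mul_nonpos_of_nonneg_of_nonpos hη.2.le (not_lt.1 hneg)
  rw [lorentz] at h
  nlinarith

theorem add_mem_cone {η x : Fin (k + 1) → ℝ} (hη : η ∈ cone (k + 1)) (hx : x ∈ cone (k + 1)) :
    η + x ∈ cone (k + 1) := by
  have h := lorentz_pos_of_mem_cone hη hx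
  rw [mem_cone_iff] at *
  refine ⟨?_, add_pos hη.2 hx.2⟩
  rw [stdForm_one_add]
  linarith

theorem smul_mem_cone {η : Fin (k + 1) → ℝ} (hη : η ∈ cone (k + 1)) {r : ℝ} (hr : 0 < r) :
    r • η ∈ cone (k + 1) := by
  rw [mem_cone_iff] at *
  refine ⟨?_, mul_pos hr hη.2⟩
  rw [stdForm_smul]
  exact mul_pos (by positivity) hη.1

theorem convex_cone : Convex ℝ (cone (k + 1)) := by
  intro x hx y hy a b ha hb hab
  rcases ha.eq_or_lt with rfl | ha
  · obtain rfl : b = 1 := by linarith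
    simpa using hy
  rcases hb.eq_or_lt with rfl | hb
  · obtain rfl : a = 1 := by linarith
    simpa using hx
  exact add_mem_cone (smul_mem_cone hx ha) (smul_mem_cone hy hb)

theorem convex_tube : Convex ℝ (tube (k + 1)) := by
  intro x hx y hy a b ha hb hab
  have : imPart (a • x + b • y) = a • imPart x + b • imPart y := by
    ext i; simp [imPart]
  rw [tube, Set.mem_ofPred_eq, this]
  exact convex_cone hx hy ha hb hab

theorem single_mem_cone : (Pi.single 0 1 : Fin (k + 1) → ℝ) ∈ cone (k + 1) := by
  rw [mem_cone_iff]
  simp [stdForm_one_eq]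

theorem imPart_sub_conjVec {d : ℕ} (z w : Fin d → ℂ) :
    imPart (z - conjVec w) = imPart z + imPart w := by
  ext i; simp [imPart, conjVec]

theorem sub_conjVec_mem_tube {z w : Fin (k + 1) → ℂ} (hz : z ∈ tube (k + 1))
    (hw : w ∈ tube (k + 1)) : z - conjVec w ∈ tube (k + 1) := by
  rw [tube, Set.mem_ofPred_eq, imPart_sub_conjVec]
  exact add_mem_cone hz hw

/-- Coordinatewise real part. -/
def rePart {d : ℕ} (ζ : Fin d → ℂ) : Fin d → ℝ := fun i => (ζ i).re

theorem stdForm_re_im (z : Fin (k + 1) → ℂ) :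
    stdForm 1 z = ((stdForm 1 (rePart z) - stdForm 1 (imPart z) : ℝ) : ℂ)
      + ((2 * lorentz (rePart z) (imPart z) : ℝ) : ℂ) * I := by
  simp only [stdForm_one_eq, lorentz, rePart, imPart]
  apply Complex.ext
  · simp [pow_two]
    ring
  · simp [pow_two, mul_sub, Finset.mul_sum]
    have : ∀ i : Fin k, (z i.succ).re * (z i.succ).im + (z i.succ).im * (z i.succ).re
        = 2 * ((z i.succ).re * (z i.succ).im) := fun i => by ring
    simp only [this]; ring

theorem stdForm_nonpos_of_lorentz_eq_zero {η x : Fin (k + 1) → ℝ} (hη : 0 < stdForm 1 η)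
    (h : lorentz x η = 0) : stdForm 1 x ≤ 0 := by
  by_contra hx
  have h1 := sum_mul_sq_lt_of_mem_cone (not_le.1 hx) hη
  rw [lorentz, sub_eq_zero] at h
  rw [h] at h1
  exact lt_irrefl _ h1

theorem neg_stdForm_mem_slitPlane {z : Fin (k + 1) → ℂ} (hz : z ∈ tube (k + 1)) :
    -stdForm 1 z ∈ slitPlane := by
  rw [mem_slitPlane_iff]
  have hη : 0 < stdForm 1 (imPart z) := hz.1
  rw [stdForm_re_im]
  by_cases h : lorentz (rePart z) (imPart z) = 0
  · left
    have := stdForm_nonpos_of_lorentz_eq_zero hη h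
    simp
    linarith
  · right
    simpa using h

theorem sub_conjVec_self {d : ℕ} (z : Fin d → ℂ) :
    z - conjVec z = fun i => (2 * I) * ((imPart z i : ℝ) : ℂ) := by
  ext i
  simp [imPart, conjVec, Complex.sub_conj]
  ring

theorem stdForm_ofReal {d : ℕ} (p : ℕ) (x : Fin d → ℝ) :
    stdForm p (fun i => (x i : ℂ)) = ((stdForm p x : ℝ) : ℂ) := by
  simp only [stdForm, ofReal_sum]
  refine Finset.sum_congr rfl fun i _ => ?_
  split_ifs <;> simp

theorem neg_stdForm_sub_conjVec_self {d : ℕ} (z : Fin d → ℂ) :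
    -stdForm 1 (z - conjVec z) = ((4 * stdForm 1 (imPart z) : ℝ) : ℂ) := by
  have : z - conjVec z = (2 * I) • fun i => ((imPart z i : ℝ) : ℂ) := sub_conjVec_self z
  rw [this, stdForm_smul, stdForm_ofReal, mul_pow, I_sq]
  push_cast
  ring

end Geometry

/-! ### Point evaluations on weighted Bergman spaces -/

section MeanValue

variable {d : ℕ}

theorem measurePreserving_circle_smul (c : Circle) :
    MeasurePreserving (fun w : Fin d → ℂ => (c : ℂ) • w) :=
  volume_preserving_pi (fun _ : Fin d => (rotation c).measurePreserving)

theorem setIntegral_ball_eq {f : (Fin d → ℂ) → ℂ} {c : Fin d → ℂ} {R : ℝ} (hR : 0 < R)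
    (hf : DifferentiableOn ℂ f (Metric.closedBall c R)) :
    ∫ w in Metric.ball 0 R, f (c + w) =
      (volume : Measure (Fin d → ℂ)).real (Metric.ball 0 R) • f c := by
  have hrot : ∀ θ : ℝ, ∫ w in Metric.ball 0 R, f (c + circleMap 0 1 θ • w)
      = ∫ w in Metric.ball 0 R, f (c + w) := by
    intro θ
    have hm := measurePreserving_circle_smul (d := d) (Circle.exp θ)
    have hemb : MeasurableEmbedding (fun w : Fin d → ℂ => ((Circle.exp θ : Circle) : ℂ) • w) :=
      (Homeomorph.smulOfNeZero (α := Fin d → ℂ) ((Circle.exp θ : Circle) : ℂ)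
        (Circle.coe_ne_zero _)).measurableEmbedding
    have h := hm.setIntegral_preimage_emb hemb (fun w => f (c + w)) (Metric.ball 0 R)
    have hpre : (fun w : Fin d → ℂ => ((Circle.exp θ : Circle) : ℂ) • w) ⁻¹' Metric.ball 0 R
        = Metric.ball 0 R := by
      ext w; simp [norm_smul]
    rw [hpre] at h
    rw [← h]
    simp [circleMap]
  have hmaps : ∀ θ : ℝ, ∀ w ∈ Metric.closedBall (0 : Fin d → ℂ) R,
      c + circleMap 0 1 θ • w ∈ Metric.closedBall c R := by
    intro θ w hw
    simpa [norm_smul] using hw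
  have hcirc : ∀ w ∈ Metric.ball (0 : Fin d → ℂ) R,
      ∫ θ in (0 : ℝ)..2 * Real.pi, f (c + circleMap 0 1 θ • w) = (2 * Real.pi : ℝ) • f c := by
    intro w hw
    have hw' : ‖w‖ < R := by simpa using hw
    have hd : DiffContOnCl ℂ (fun t : ℂ => f (c + t • w)) (Metric.ball 0 |1|) := by
      apply DifferentiableOn.diffContOnCl
      refine hf.comp (by fun_prop) fun t ht => ?_
      rw [abs_one, closure_ball _ one_ne_zero] at ht
      have : ‖t‖ ≤ 1 := by simpa using ht
      rw [mem_closedBall_iff_norm, add_sub_cancel_left, norm_smul]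
      nlinarith [norm_nonneg w, norm_nonneg t]
    have h := hd.circleAverage
    rw [Real.circleAverage_def] at h
    simp only [zero_smul, add_zero] at h
    rw [← h, smul_smul, mul_inv_cancel₀ (by positivity), one_smul]
  have hcont : ContinuousOn (fun p : ℝ × (Fin d → ℂ) => f (c + circleMap 0 1 p.1 • p.2))
      (Set.Icc 0 (2 * Real.pi) ×ˢ Metric.closedBall 0 R) := by
    refine hf.continuousOn.comp ?_ fun p hp => hmaps _ _ hp.2
    exact Continuous.continuousOn
      (continuous_const.add (((continuous_circleMap 0 1).comp continuous_fst).smul continuous_snd))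
  have hint := (hcont.integrableOn_compact
    (isCompact_Icc.prod (isCompact_closedBall _ _)) (μ := volume)).mono_set
    (Set.prod_mono Set.Ioc_subset_Icc_self Metric.ball_subset_closedBall)
  have hswap := intervalIntegral_integral_swap (μ := volume.restrict (Metric.ball (0 : Fin d → ℂ) R))
    (a := 0) (b := 2 * Real.pi) (f := fun θ w => f (c + circleMap 0 1 θ • w)) (by
      rw [Set.uIoc_of_le (by positivity), Measure.prod_restrict]
      exact hint)
  simp only [hrot] at hswap
  rw [setIntegral_congr_fun measurableSet_ball hcirc] at hswap
  simp only [intervalIntegral.integral_const, integral_const, sub_zero] at hswap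
  rw [smul_comm] at hswap
  have h2 : (2 * Real.pi : ℝ) ≠ 0 := by positivity
  have := smul_right_injective ℂ h2 hswap
  simpa using this

end MeanValue

namespace Bergman

variable {d : ℕ} {lam : ℝ}

theorem norm_sq_eq (f : Bergman d lam) : ‖f‖ ^ 2 = ∫ ζ, ‖f ζ‖ ^ 2 ∂(bergmanMeasure d lam) := by
  have h := inner_self_eq_norm_sq_to_K (𝕜 := ℂ) f
  rw [inner_def] at h
  have e : ∀ ζ, conj (f ζ) * f ζ = ((‖f ζ‖ ^ 2 : ℝ) : ℂ) := fun ζ => by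
    rw [Complex.conj_mul']; norm_cast
  simp only [e] at h
  rw [integral_complex_ofReal] at h
  exact Complex.ofReal_injective (by rw [h]; simp)

theorem integrable_norm_sq (f : Bergman d lam) :
    Integrable (fun ζ => ‖f ζ‖ ^ 2) (bergmanMeasure d lam) := by
  simpa using f.memLp.integrable_norm_pow (by norm_num)

theorem measurable_weight : Measurable fun ζ : Fin d → ℂ =>
    ENNReal.ofReal (stdForm 1 (imPart ζ) ^ (lam - (d : ℝ))) :=
  (((continuous_stdForm 1).comp continuous_imPart).measurable.pow_const _).ennreal_ofReal

theorem setIntegral_norm_sq_le (f : Bergman d lam) {s : Set (Fin d → ℂ)}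
    (hsub : s ⊆ tube d) {δ : ℝ} (hδ : 0 < δ)
    (hw : ∀ ζ ∈ s, δ ≤ stdForm 1 (imPart ζ) ^ (lam - (d : ℝ))) :
    IntegrableOn (fun ζ => ‖f ζ‖ ^ 2) s ∧ δ * ∫ ζ in s, ‖f ζ‖ ^ 2 ≤ ‖f‖ ^ 2 := by
  have h1 : ENNReal.ofReal δ • volume.restrict s ≤ bergmanMeasure d lam := by
    refine Measure.le_iff.2 fun t ht => ?_
    rw [bergmanMeasure, withDensity_apply _ ht, Measure.smul_apply, smul_eq_mul,
      Measure.restrict_restrict ht, Measure.restrict_apply ht, ← setLIntegral_const]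
    calc ∫⁻ _ in t ∩ s, ENNReal.ofReal δ ≤ ∫⁻ ζ in t ∩ s,
          ENNReal.ofReal (stdForm 1 (imPart ζ) ^ (lam - (d : ℝ))) :=
        setLIntegral_mono measurable_weight fun ζ hζ => ENNReal.ofReal_le_ofReal (hw ζ hζ.2)
      _ ≤ _ := lintegral_mono_set (Set.inter_subset_inter_right _ hsub)
  have h2 := f.integrable_norm_sq.mono_measure h1
  have h3 : IntegrableOn (fun ζ => ‖f ζ‖ ^ 2) s := by
    rwa [integrable_smul_measure (by simpa using hδ) (by simp)] at h2
  refine ⟨h3, ?_⟩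
  rw [norm_sq_eq]
  have h4 := integral_mono_measure h1 (.of_forall fun ζ => by positivity) f.integrable_norm_sq
  rwa [integral_smul_measure, ENNReal.toReal_ofReal hδ.le, smul_eq_mul] at h4

/-- Point evaluations are bounded, locally uniformly. -/
theorem exists_norm_apply_le {ζ₀ : Fin d → ℂ} (h₀ : ζ₀ ∈ tube d) (lam : ℝ) :
    ∃ R > 0, ∃ C, 0 ≤ C ∧ Metric.ball ζ₀ R ⊆ tube d ∧
      ∀ ζ ∈ Metric.ball ζ₀ R, ∀ f : Bergman d lam, ‖f ζ‖ ≤ C * ‖f‖ := by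
  obtain ⟨ε, hε, hsub⟩ := Metric.isOpen_iff.1 (isOpen_tube d) ζ₀ h₀
  obtain ⟨R, hR, hRε⟩ : ∃ R > 0, 2 * R < ε := ⟨ε / 3, by positivity, by linarith⟩
  have hK : Metric.closedBall ζ₀ (2 * R) ⊆ tube d :=
    (Metric.closedBall_subset_ball hRε).trans hsub
  have hcomp : IsCompact (Metric.closedBall ζ₀ (2 * R)) := isCompact_closedBall _ _
  have hcont : ContinuousOn (fun ζ : Fin d → ℂ => stdForm 1 (imPart ζ) ^ (lam - (d : ℝ)))
      (Metric.closedBall ζ₀ (2 * R)) :=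
    ((continuous_stdForm 1).comp continuous_imPart).continuousOn.rpow_const
      fun ζ hζ => Or.inl (hK hζ).1.ne'
  obtain ⟨x, hx, hmin⟩ := hcomp.exists_isMinOn ⟨ζ₀, Metric.mem_closedBall_self (by positivity)⟩ hcont
  set δ := stdForm 1 (imPart x) ^ (lam - (d : ℝ)) with hδ
  have hδ0 : 0 < δ := Real.rpow_pos_of_pos (hK hx).1 _
  set V := (volume : Measure (Fin d → ℂ)).real (Metric.ball 0 R) with hV
  have hV0 : 0 < V := by
    rw [hV, Measure.real, ENNReal.toReal_pos_iff]
    exact ⟨Metric.measure_ball_pos _ _ hR, measure_ball_lt_top⟩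
  refine ⟨R, hR, Real.sqrt (1 / (V * δ)), Real.sqrt_nonneg _,
    (Metric.ball_subset_closedBall.trans (Metric.closedBall_subset_closedBall (by linarith))).trans hK,
    fun ζ hζ f => ?_⟩
  have hsub2 : Metric.closedBall ζ R ⊆ Metric.closedBall ζ₀ (2 * R) :=
    Metric.closedBall_subset_closedBall' (by have := Metric.mem_ball.1 hζ; linarith)
  have hdiff : DifferentiableOn ℂ (fun w => f w ^ 2) (Metric.closedBall ζ R) :=
    (f.differentiableOn.mono (hsub2.trans hK)).pow 2
  have hmv := setIntegral_ball_eq hR hdiff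
  have htrans : ∫ w in Metric.ball 0 R, ‖f (ζ + w)‖ ^ 2 = ∫ w in Metric.ball ζ R, ‖f w‖ ^ 2 := by
    have h := (measurePreserving_add_left volume ζ).setIntegral_preimage_emb
      (measurableEmbedding_addLeft ζ) (fun w => ‖f w‖ ^ 2) (Metric.ball ζ R)
    rw [← h]
    congr 2
    ext w; simp
  have h1 : V * ‖f ζ‖ ^ 2 ≤ ∫ w in Metric.ball ζ R, ‖f w‖ ^ 2 := by
    rw [← htrans]
    have := norm_integral_le_integral_norm (μ := volume.restrict (Metric.ball 0 R))
      fun w => f (ζ + w) ^ 2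
    rw [hmv, norm_smul, norm_pow, Real.norm_of_nonneg hV0.le] at this
    simpa using this
  have h2 := (f.setIntegral_norm_sq_le (s := Metric.ball ζ R)
    ((Metric.ball_subset_closedBall.trans hsub2).trans hK) hδ0
    fun w hw => hmin (hsub2 (Metric.ball_subset_closedBall hw))).2
  have h3 : ‖f ζ‖ ^ 2 ≤ 1 / (V * δ) * ‖f‖ ^ 2 := by
    rw [div_mul_eq_mul_div, one_mul, le_div_iff₀ (by positivity)]
    nlinarith
  rw [← Real.sqrt_sq (norm_nonneg (f ζ)), ← Real.sqrt_sq (norm_nonneg f), ← Real.sqrt_mul (by positivity)]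
  exact Real.sqrt_le_sqrt h3

end Bergman

/-! ### Total families in Hilbert spaces -/

section Total

variable {X H₁ H₂ : Type*} [NormedAddCommGroup H₁] [InnerProductSpace ℂ H₁] [CompleteSpace H₁]
  [NormedAddCommGroup H₂] [InnerProductSpace ℂ H₂] [CompleteSpace H₂]

/-- A family of vectors is total if only zero is orthogonal to all its members. -/
def IsTotalFamily (u : X → H₁) : Prop := ∀ f : H₁, (∀ x, ⟪u x, f⟫_ℂ = 0) → f = 0

theorem IsTotalFamily.denseRange {u : X → H₁} (hu : IsTotalFamily u) :
    DenseRange (Finsupp.linearCombination ℂ u) := by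
  have h : (Submodule.span ℂ (Set.range u)).topologicalClosure = ⊤ := by
    rw [Submodule.topologicalClosure_eq_top_iff, Submodule.eq_bot_iff]
    intro f hf
    exact hu f fun x => (Submodule.mem_orthogonal _ _).1 hf _
      (Submodule.subset_span (Set.mem_range_self x))
  rw [← Finsupp.range_linearCombination] at h
  rw [DenseRange, dense_iff_closure_eq, ← LinearMap.coe_range]
  exact congrArg (fun S : Submodule ℂ H₁ => (S : Set H₁)) h

theorem IsTotalFamily.ext {u : X → H₁} (hu : IsTotalFamily u) {F : Type*} [NormedAddCommGroup F]
    [NormedSpace ℂ F] {S T : H₁ →L[ℂ] F} (h : ∀ x, S (u x) = T (u x)) : S = T := by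
  have : Set.EqOn S T (Set.range (Finsupp.linearCombination ℂ u)) := by
    rintro _ ⟨a, rfl⟩
    simp [Finsupp.linearCombination_apply, Finsupp.sum, h]
  exact ContinuousLinearMap.coeFn_injective (S.continuous.ext_on hu.denseRange T.continuous this)

/-- Two families with proportional Gram matrices are related by a multiple of an isometry. -/
theorem IsTotalFamily.exists_clm {u : X → H₁} (hu : IsTotalFamily u) (v : X → H₂) {c : ℝ} (hc : 0 ≤ c)
    (h : ∀ x y, ⟪v x, v y⟫_ℂ = c * ⟪u x, u y⟫_ℂ) :
    ∃ T : H₁ →L[ℂ] H₂, (∀ x, T (u x) = v x) ∧ ∀ f, T.adjoint (T f) = (c : ℂ) • f := by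
  have hnorm : ∀ a, ‖Finsupp.linearCombination ℂ v a‖ ≤
      Real.sqrt c * ‖Finsupp.linearCombination ℂ u a‖ := by
    intro a
    have h1 : ⟪Finsupp.linearCombination ℂ v a, Finsupp.linearCombination ℂ v a⟫_ℂ
        = c * ⟪Finsupp.linearCombination ℂ u a, Finsupp.linearCombination ℂ u a⟫_ℂ := by
      simp only [Finsupp.linearCombination_apply, Finsupp.sum, sum_inner, inner_sum,
        inner_smul_left, inner_smul_right, h, Finset.mul_sum]
      refine Finset.sum_congr rfl fun x _ => Finset.sum_congr rfl fun y _ => ?_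
      ring
    rw [inner_self_eq_norm_sq_to_K, inner_self_eq_norm_sq_to_K] at h1
    have h2 : ‖Finsupp.linearCombination ℂ v a‖ ^ 2 = c * ‖Finsupp.linearCombination ℂ u a‖ ^ 2 :=
      Complex.ofReal_injective (by push_cast; exact h1)
    rw [← Real.sqrt_sq (norm_nonneg (Finsupp.linearCombination ℂ v a)), h2, Real.sqrt_mul hc,
      Real.sqrt_sq (norm_nonneg _)]
  refine ⟨(Finsupp.linearCombination ℂ v).extendOfNorm (Finsupp.linearCombination ℂ u), ?_, ?_⟩
  · intro x
    have := LinearMap.extendOfNorm_eq hu.denseRange ⟨_, hnorm⟩ (Finsupp.single x 1)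
    simpa using this
  · set T := (Finsupp.linearCombination ℂ v).extendOfNorm (Finsupp.linearCombination ℂ u) with hT
    have hTu : ∀ x, T (u x) = v x := fun x => by
      have := LinearMap.extendOfNorm_eq hu.denseRange ⟨_, hnorm⟩ (Finsupp.single x 1)
      simpa using this
    have : T.adjoint.comp T = (c : ℂ) • ContinuousLinearMap.id ℂ H₁ := by
      refine hu.ext fun y => sub_eq_zero.1 (hu _ fun x => ?_)
      rw [inner_sub_right]
      simp only [ContinuousLinearMap.comp_apply, ContinuousLinearMap.adjoint_inner_right, hTu,
        smul_apply, ContinuousLinearMap.id_apply, inner_smul_right, h, sub_self]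
    intro f
    simpa using congrArg (fun S : H₁ →L[ℂ] H₁ => S f) this

end Total

namespace Bergman

variable {d : ℕ} {lam : ℝ}

/-! ### Completeness and the reproducing kernel -/

theorem sub_apply (f g : Bergman d lam) (ζ : Fin d → ℂ) : (f - g) ζ = f ζ - g ζ := rfl

theorem ext_on {f g : Bergman d lam} (h : ∀ ζ ∈ tube d, f ζ = g ζ) : f = g := by
  apply Subtype.ext
  funext ζ
  by_cases hζ : ζ ∈ tube d
  · exact h ζ hζ
  · exact (f.eq_zero_of_notMem hζ).trans (g.eq_zero_of_notMem hζ).symm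

/-- Point evaluation as a continuous linear functional. -/
def evalCLM (lam : ℝ) (ζ : Fin d → ℂ) : Bergman d lam →L[ℂ] ℂ :=
  LinearMap.mkContinuousOfExistsBound
    { toFun := fun f => f ζ, map_add' := fun _ _ => rfl, map_smul' := fun _ _ => rfl } (by
      by_cases h : ζ ∈ tube d
      · obtain ⟨R, hR, C, -, -, hC⟩ := exists_norm_apply_le h lam
        exact ⟨C, hC ζ (Metric.mem_ball_self hR)⟩
      · exact ⟨0, fun f => (norm_le_zero_iff.2 (f.eq_zero_of_notMem h)).trans (by simp)⟩)

theorem evalCLM_apply (ζ : Fin d → ℂ) (f : Bergman d lam) : evalCLM lam ζ f = f ζ := rfl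

theorem eLpNorm_eq (f : Bergman d lam) :
    eLpNorm f 2 (bergmanMeasure d lam) = ENNReal.ofReal ‖f‖ := by
  rw [f.memLp.eLpNorm_eq_integral_rpow_norm (by norm_num) (by norm_num)]
  congr 1
  have : ∫ ζ, ‖f ζ‖ ^ (2 : ENNReal).toReal ∂(bergmanMeasure d lam) = ‖f‖ ^ 2 := by
    rw [norm_sq_eq]; simp
  rw [this]
  rw [ENNReal.toReal_ofNat, ← one_div, ← Real.sqrt_eq_rpow, Real.sqrt_sq (norm_nonneg f)]

instance : CompleteSpace (Bergman d lam) := by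
  refine Metric.complete_of_cauchySeq_tendsto fun u hu => ?_
  obtain ⟨b, hb0, hb, hblim⟩ := cauchySeq_iff_le_tendsto_0.1 hu
  have hpt : ∀ ζ, ∃ y, Filter.Tendsto (fun n => u n ζ) Filter.atTop (nhds y) := fun ζ =>
    cauchySeq_tendsto_of_complete (hu.map (evalCLM lam ζ).uniformContinuous)
  choose F hF using hpt
  have hFdiff : DifferentiableOn ℂ F (tube d) := by
    intro ζ₀ h₀
    obtain ⟨R, hR, C, hC0, hsub, hC⟩ := exists_norm_apply_le h₀ lam
    refine (differentiableAt_of_tendstoUniformlyOn_ball hR (u := fun n => u n)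
      (C := C * (‖u 0‖ + b 0)) (b := fun n => C * b n) (fun n => (u n).differentiableOn.mono hsub)
      (fun n x hx => (hC x hx (u n)).trans ?_) ?_ fun n x hx => ?_).differentiableWithinAt
    · have h1 := hb 0 n 0 le_rfl n.zero_le
      rw [dist_comm, dist_eq_norm_sub] at h1
      have h2 := norm_le_norm_sub_add (u n) (u 0)
      gcongr
      linarith
    · simpa using hblim.const_mul C
    · have ht : Filter.Tendsto (fun k => ‖u n x - u k x‖) Filter.atTop (nhds ‖u n x - F x‖) :=
        (tendsto_const_nhds.sub (hF x)).norm
      refine le_of_tendsto ht ?_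
      filter_upwards [Filter.eventually_ge_atTop n] with k hk
      rw [← sub_apply]
      refine (hC x hx _).trans ?_
      gcongr
      rw [← dist_eq_norm_sub]
      exact hb n k n le_rfl hk
  have hFzero : ∀ ζ, ζ ∉ tube d → F ζ = 0 := fun ζ hζ =>
    tendsto_nhds_unique (hF ζ) (by simp [eq_zero_of_notMem _ hζ])
  have hmeas : AEStronglyMeasurable F (bergmanMeasure d lam) :=
    aestronglyMeasurable_of_tendsto_ae Filter.atTop (fun n => (u n).memLp.1)
      (.of_forall fun ζ => hF ζ)
  have hest : ∀ n, eLpNorm (fun ζ => u n ζ - F ζ) 2 (bergmanMeasure d lam) ≤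
      ENNReal.ofReal (b n) := by
    intro n
    have h1 := Lp.eLpNorm_lim_le_liminf_eLpNorm (p := 2) (μ := bergmanMeasure d lam)
      (f := fun k ζ => u n ζ - u k ζ) (fun k => ((u n).memLp.1.sub (u k).memLp.1))
      (fun ζ => u n ζ - F ζ) (.of_forall fun ζ => tendsto_const_nhds.sub (hF ζ))
    refine h1.trans ?_
    refine Filter.liminf_le_of_frequently_le' (Filter.Eventually.frequently ?_)
    filter_upwards [Filter.eventually_ge_atTop n] with k hk
    have h2 := eLpNorm_eq (u n - u k)
    refine (le_of_eq h2).trans (ENNReal.ofReal_le_ofReal ?_)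
    rw [← dist_eq_norm_sub]
    exact hb n k n le_rfl hk
  have hmem : MemLp F 2 (bergmanMeasure d lam) := by
    have h1 : MemLp (fun ζ => u 0 ζ - F ζ) 2 (bergmanMeasure d lam) :=
      ⟨(u 0).memLp.1.sub hmeas, (hest 0).trans_lt ENNReal.ofReal_lt_top⟩
    have h2 := (u 0).memLp.sub h1
    refine h2.ae_eq (.of_forall fun ζ => ?_)
    simp
  let f : Bergman d lam := ⟨F, hFdiff, hFzero, hmem⟩
  refine ⟨f, tendsto_iff_dist_tendsto_zero.2 (squeeze_zero (fun _ => dist_nonneg) (fun n => ?_) hblim)⟩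
  rw [dist_eq_norm_sub]
  have h1 := eLpNorm_eq (u n - f)
  have h2 : ENNReal.ofReal ‖u n - f‖ ≤ ENNReal.ofReal (b n) := h1 ▸ hest n
  exact (ENNReal.ofReal_le_ofReal_iff (hb0 n)).1 h2

/-- The vector which represents a continuous linear functional. -/
def rieszVec (φ : Bergman d lam →L[ℂ] ℂ) : Bergman d lam := (InnerProductSpace.toDual ℂ _).symm φ

theorem inner_rieszVec (φ : Bergman d lam →L[ℂ] ℂ) (f : Bergman d lam) :
    ⟪rieszVec φ, f⟫_ℂ = φ f :=
  InnerProductSpace.toDual_symm_apply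

/-- The reproducing kernel as a family of vectors. -/
def kernelVec (lam : ℝ) (ζ : Fin d → ℂ) : Bergman d lam := rieszVec (evalCLM lam ζ)

theorem inner_kernelVec (ζ : Fin d → ℂ) (f : Bergman d lam) : ⟪kernelVec lam ζ, f⟫_ℂ = f ζ :=
  inner_rieszVec _ _

theorem isTotalFamily_kernelVec : IsTotalFamily fun ζ : tube d => kernelVec lam (ζ : Fin d → ℂ) := by
  intro f hf
  refine ext_on fun ζ hζ => ?_
  rw [← inner_kernelVec, hf ⟨ζ, hζ⟩]
  rfl

/-! ### Operators with values in holomorphic functions -/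

/-- A linear operator from the Bergman space to holomorphic functions on the tube domain, bounded
locally uniformly. -/
structure IsTubeOp (P : Bergman d lam → (Fin d → ℂ) → ℂ) : Prop where
  differentiableOn : ∀ f, DifferentiableOn ℂ (P f) (tube d)
  map_add : ∀ f g, ∀ ζ ∈ tube d, P (f + g) ζ = P f ζ + P g ζ
  map_smul : ∀ (c : ℂ) f, ∀ ζ ∈ tube d, P (c • f) ζ = c * P f ζ
  bounded : ∀ ζ₀ ∈ tube d, ∃ R > 0, ∃ C, 0 ≤ C ∧ Metric.ball ζ₀ R ⊆ tube d ∧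
      ∀ ζ ∈ Metric.ball ζ₀ R, ∀ f : Bergman d lam, ‖P f ζ‖ ≤ C * ‖f‖

theorem isTubeOp_toFun : IsTubeOp (fun f : Bergman d lam => (f : (Fin d → ℂ) → ℂ)) :=
  ⟨fun f => f.differentiableOn, fun _ _ _ _ => rfl, fun _ _ _ _ => rfl,
    fun _ h => exists_norm_apply_le h lam⟩

theorem IsTubeOp.zero : IsTubeOp (fun (_ : Bergman d lam) (_ : Fin d → ℂ) => (0 : ℂ)) :=
  ⟨fun _ => differentiableOn_const _, by simp, by simp, fun ζ₀ h => by
    obtain ⟨R, hR, C, hC0, hsub, -⟩ := exists_norm_apply_le h lam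
    exact ⟨R, hR, C, hC0, hsub, fun ζ _ f => by simpa using by positivity⟩⟩

theorem IsTubeOp.add {P Q : Bergman d lam → (Fin d → ℂ) → ℂ} (hP : IsTubeOp P) (hQ : IsTubeOp Q) :
    IsTubeOp (fun f ζ => P f ζ + Q f ζ) where
  differentiableOn f := (hP.differentiableOn f).add (hQ.differentiableOn f)
  map_add f g ζ hζ := by rw [hP.map_add f g ζ hζ, hQ.map_add f g ζ hζ]; ring
  map_smul c f ζ hζ := by rw [hP.map_smul c f ζ hζ, hQ.map_smul c f ζ hζ]; ring
  bounded ζ₀ h := by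
    obtain ⟨R, hR, C, hC0, hsub, hC⟩ := hP.bounded ζ₀ h
    obtain ⟨R', hR', C', hC0', hsub', hC'⟩ := hQ.bounded ζ₀ h
    refine ⟨min R R', lt_min hR hR', C + C', add_nonneg hC0 hC0',
      (Metric.ball_subset_ball (min_le_left _ _)).trans hsub, fun ζ hζ f => ?_⟩
    have h1 := hC ζ (Metric.ball_subset_ball (min_le_left _ _) hζ) f
    have h2 := hC' ζ (Metric.ball_subset_ball (min_le_right _ _) hζ) f
    refine (norm_add_le _ _).trans ?_
    rw [add_mul]
    exact add_le_add h1 h2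

theorem IsTubeOp.const_mul {P : Bergman d lam → (Fin d → ℂ) → ℂ} (hP : IsTubeOp P) (c : ℂ) :
    IsTubeOp (fun f ζ => c * P f ζ) where
  differentiableOn f := (hP.differentiableOn f).const_mul c
  map_add f g ζ hζ := by rw [hP.map_add f g ζ hζ]; ring
  map_smul a f ζ hζ := by rw [hP.map_smul a f ζ hζ]; ring
  bounded ζ₀ h := by
    obtain ⟨R, hR, C, hC0, hsub, hC⟩ := hP.bounded ζ₀ h
    refine ⟨R, hR, ‖c‖ * C, by positivity, hsub, fun ζ hζ f => ?_⟩
    rw [norm_mul, mul_assoc]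
    exact mul_le_mul_of_nonneg_left (hC ζ hζ f) (norm_nonneg c)

theorem IsTubeOp.neg {P : Bergman d lam → (Fin d → ℂ) → ℂ} (hP : IsTubeOp P) :
    IsTubeOp (fun f ζ => -P f ζ) := by
  simpa using hP.const_mul (-1)

theorem IsTubeOp.sum {ι : Type*} (s : Finset ι) {P : ι → Bergman d lam → (Fin d → ℂ) → ℂ}
    (hP : ∀ i ∈ s, IsTubeOp (P i)) : IsTubeOp (fun f ζ => ∑ i ∈ s, P i f ζ) := by
  classical
  induction s using Finset.induction_on with
  | empty => simpa using IsTubeOp.zero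
  | insert i s hi ih =>
    simp only [Finset.sum_insert hi]
    exact (hP i (Finset.mem_insert_self i s)).add
      (ih fun j hj => hP j (Finset.mem_insert_of_mem hj))

theorem IsTubeOp.partialDeriv {P : Bergman d lam → (Fin d → ℂ) → ℂ} (hP : IsTubeOp P) (i : Fin d) :
    IsTubeOp (fun f => partialDeriv i (P f)) where
  differentiableOn f := (hP.differentiableOn f).fderiv_apply_of_isOpen (isOpen_tube d) _
  map_add f g ζ hζ := by
    have e : P (f + g) =ᶠ[nhds ζ] fun x => P f x + P g x :=
      Filter.eventually_of_mem ((isOpen_tube d).mem_nhds hζ) (hP.map_add f g)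
    have hn := (isOpen_tube d).mem_nhds hζ
    simp only [_root_.partialDeriv]
    rw [e.fderiv_eq, fderiv_fun_add ((hP.differentiableOn f).differentiableAt hn)
      ((hP.differentiableOn g).differentiableAt hn)]
    rfl
  map_smul c f ζ hζ := by
    have e : P (c • f) =ᶠ[nhds ζ] fun x => c * P f x :=
      Filter.eventually_of_mem ((isOpen_tube d).mem_nhds hζ) (hP.map_smul c f)
    have hn := (isOpen_tube d).mem_nhds hζ
    simp only [_root_.partialDeriv]
    rw [e.fderiv_eq, fderiv_const_mul ((hP.differentiableOn f).differentiableAt hn)]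
    rfl
  bounded ζ₀ h := by
    obtain ⟨R, hR, C, hC0, hsub, hC⟩ := hP.bounded ζ₀ h
    have hsub2 : ∀ ζ ∈ Metric.ball ζ₀ (R / 2), Metric.ball ζ (R / 2) ⊆ Metric.ball ζ₀ R :=
      fun ζ hζ => Metric.ball_subset_ball' (by have := Metric.mem_ball.1 hζ; linarith)
    refine ⟨R / 2, by positivity, 2 * C / (R / 2), by positivity,
      (Metric.ball_subset_ball (by linarith)).trans hsub, fun ζ hζ f => ?_⟩
    have h1 := norm_fderiv_le_of_bounded_on_ball (by positivity)
      ((hP.differentiableOn f).mono ((hsub2 ζ hζ).trans hsub)) fun x hx => hC x (hsub2 ζ hζ hx) f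
    have h2 := ContinuousLinearMap.le_of_opNorm_le _ h1 (Pi.single i 1)
    have h3 : ‖(Pi.single i 1 : Fin d → ℂ)‖ = 1 := by rw [Pi.norm_single, norm_one]
    rw [h3, mul_one] at h2
    refine h2.trans (le_of_eq ?_)
    ring

theorem IsTubeOp.iterate {P : Bergman d lam → (Fin d → ℂ) → ℂ} (hP : IsTubeOp P)
    {D : ((Fin d → ℂ) → ℂ) → (Fin d → ℂ) → ℂ}
    (hD : ∀ {Q : Bergman d lam → (Fin d → ℂ) → ℂ}, IsTubeOp Q → IsTubeOp fun f => D (Q f)) (n : ℕ) :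
    IsTubeOp (fun f => D^[n] (P f)) := by
  induction n with
  | zero => simpa using hP
  | succ n ih =>
    have h := hD ih
    convert h using 2
    exact Function.iterate_succ_apply' _ _ _

/-- The value of an operator at a point of the tube domain as a continuous linear functional. -/
theorem IsTubeOp.exists_clm {P : Bergman d lam → (Fin d → ℂ) → ℂ} (hP : IsTubeOp P)
    {ζ : Fin d → ℂ} (hζ : ζ ∈ tube d) : ∃ φ : Bergman d lam →L[ℂ] ℂ, ∀ f, φ f = P f ζ := by
  obtain ⟨R, hR, C, -, -, hC⟩ := hP.bounded ζ hζ
  exact ⟨LinearMap.mkContinuous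
    { toFun := fun f => P f ζ, map_add' := fun f g => hP.map_add f g ζ hζ,
      map_smul' := fun c f => hP.map_smul c f ζ hζ } C (hC ζ (Metric.mem_ball_self hR)),
    fun f => rfl⟩

end Bergman

theorem isTubeOp_juhlDiffOp {m : ℕ} {lam : ℝ} (l : ℕ) (α : ℝ) :
    Bergman.IsTubeOp (fun f : Bergman (m + 1) lam => juhlDiffOp l α f) := by
  refine Bergman.IsTubeOp.sum _ fun k _ => Bergman.IsTubeOp.const_mul ?_ _
  refine Bergman.IsTubeOp.iterate (Bergman.IsTubeOp.iterate Bergman.isTubeOp_toFun ?_ k)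
    (fun h => h.partialDeriv _) _
  intro Q hQ
  refine Bergman.IsTubeOp.sum _ fun i _ => ?_
  have h := (hQ.partialDeriv i.castSucc).partialDeriv i.castSucc
  split_ifs
  · exact h
  · exact h.neg

namespace Bergman

variable {k : ℕ} {lam : ℝ}

/-! ### Holomorphic dependence of the kernel on its arguments -/

theorem exists_norm_kernelVec_sub_le {d : ℕ} {A B : Fin d → ℂ} {z : ℂ} (h : A + z • B ∈ tube d) :
    ∃ φ : Bergman d lam, ∃ R > 0, ∃ M, ∀ x ∈ Metric.ball z R,
      ‖kernelVec lam (A + x • B) - kernelVec lam (A + z • B) - conj (x - z) • φ‖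
        ≤ M * ‖x - z‖ ^ 2 := by
  obtain ⟨R, hR, C, hC0, hsub, hC⟩ := exists_norm_apply_le h lam
  have hd : ∀ f : Bergman d lam, DifferentiableOn ℂ f (Metric.ball (A + z • B) R) :=
    fun f => f.differentiableOn.mono hsub
  have hda : ∀ f : Bergman d lam, DifferentiableAt ℂ f (A + z • B) := fun f =>
    (hd f).differentiableAt (Metric.ball_mem_nhds _ hR)
  let φ : Bergman d lam →L[ℂ] ℂ := LinearMap.mkContinuous
    { toFun := fun f => fderiv ℂ f (A + z • B) B
      map_add' := fun f g => by
        have : (f + g : Bergman d lam).toFun = f.toFun + g.toFun := rfl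
        rw [this, fderiv_add (hda f) (hda g)]; rfl
      map_smul' := fun c f => by
        have : (c • f : Bergman d lam).toFun = c • f.toFun := rfl
        rw [this, fderiv_const_smul (hda f)]; rfl } (2 * C / R * ‖B‖) (fun f => by
      have h1 := ContinuousLinearMap.le_of_opNorm_le _
        (norm_fderiv_le_of_bounded_on_ball hR (hd f) fun x hx => hC x hx f) B
      refine h1.trans (le_of_eq ?_)
      ring)
  refine ⟨rieszVec φ, R / (‖B‖ + 1), by positivity, 4 * C / R ^ 2 * ‖B‖ ^ 2, fun x hx => ?_⟩
  set g := kernelVec lam (A + x • B) - kernelVec lam (A + z • B) - conj (x - z) • rieszVec φ with hg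
  have e : A + x • B - (A + z • B) = (x - z) • B := by rw [sub_smul]; abel
  have hin : ∀ f : Bergman d lam, ⟪g, f⟫_ℂ = f (A + x • B) - f (A + z • B)
      - fderiv ℂ f (A + z • B) (A + x • B - (A + z • B)) := by
    intro f
    rw [hg, inner_sub_left, inner_sub_left, inner_smul_left, inner_kernelVec, inner_kernelVec,
      inner_rieszVec, Complex.conj_conj, e, map_smul]
    rfl
  have hx' : A + x • B ∈ Metric.ball (A + z • B) R := by
    rw [mem_ball_iff_norm, e, norm_smul]
    have h1 := mem_ball_iff_norm.1 hx
    rw [lt_div_iff₀ (by positivity)] at h1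
    nlinarith [norm_nonneg B, norm_nonneg (x - z)]
  have h1 := norm_taylor_remainder_le hR (hd g) (fun y hy => hC y hy g) hx'
  rw [← hin, inner_self_eq_norm_sq_to_K, e, norm_smul] at h1
  have h2 : ‖((‖g‖ : ℝ) : ℂ) ^ 2‖ = ‖g‖ ^ 2 := by simp
  have h3 : ‖g‖ ^ 2 ≤ 4 * (C * ‖g‖) / R ^ 2 * (‖x - z‖ * ‖B‖) ^ 2 := by
    rw [← h2]; exact h1
  rcases (norm_nonneg g).eq_or_lt with h0 | h0
  · rw [← h0]; positivity
  · refine le_of_mul_le_mul_right (a := ‖g‖) ?_ h0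
    calc ‖g‖ * ‖g‖ = ‖g‖ ^ 2 := by ring
      _ ≤ _ := h3
      _ = _ := by ring

theorem differentiableAt_inner_of_norm_sub_le {H : Type*} [NormedAddCommGroup H]
    [InnerProductSpace ℂ H] {u v : ℂ → H} {z : ℂ} {φ ψ : H} {R M R' M' : ℝ} (hR : 0 < R)
    (hR' : 0 < R')
    (hu : ∀ x ∈ Metric.ball z R, ‖u x - u z - conj (x - z) • φ‖ ≤ M * ‖x - z‖ ^ 2)
    (hv : ∀ x ∈ Metric.ball z R', ‖v x - v z - (x - z) • ψ‖ ≤ M' * ‖x - z‖ ^ 2) :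
    DifferentiableAt ℂ (fun x => ⟪u x, v x⟫_ℂ) z := by
  have h1 : DifferentiableAt ℂ v z :=
    (hasFDerivAt_of_norm_sub_le_sq (A := ContinuousLinearMap.toSpanSingleton ℂ ψ) hR'
      fun x hx => by simpa using hv x hx).differentiableAt
  have h2 : DifferentiableAt ℂ (fun x => innerSL ℂ (u x)) z := by
    refine (hasFDerivAt_of_norm_sub_le_sq
      (A := ContinuousLinearMap.toSpanSingleton ℂ (innerSL ℂ φ)) hR
      (M := M) fun x hx => ?_).differentiableAt
    have e : innerSL ℂ (u x) - innerSL ℂ (u z)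
        - ContinuousLinearMap.toSpanSingleton ℂ (innerSL ℂ φ) (x - z)
        = innerSL ℂ (u x - u z - conj (x - z) • φ) := by
      simp only [map_sub, map_smulₛₗ, ContinuousLinearMap.toSpanSingleton_apply, Complex.conj_conj,
        sub_smul]
    rw [e, innerSL_apply_norm]
    exact hu x hx
  exact h2.clm_apply h1

/-- A function of two points of the tube domain, which is holomorphic in the first one and
antiholomorphic in the second one, is determined by its values on the diagonal. -/
theorem kernelVec_eq_of_diag (G : (Fin (k + 1) → ℂ) → (Fin (k + 1) → ℂ) → ℂ)
    (hG : ∀ A B : Fin (k + 1) → ℂ, ∀ z : ℂ, A + z • B ∈ tube (k + 1) →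
      A + conj z • B ∈ tube (k + 1) →
        DifferentiableAt ℂ (fun x : ℂ => G (A + x • B) (A + conj x • B)) z)
    (hdiag : ∀ ζ ∈ tube (k + 1), kernelVec lam ζ ζ = G ζ ζ)
    {ζ w : Fin (k + 1) → ℂ} (hζ : ζ ∈ tube (k + 1)) (hw : w ∈ tube (k + 1)) :
    kernelVec lam w ζ = G ζ w := by
  set A : Fin (k + 1) → ℂ := (1 / 2 : ℝ) • ζ + (1 / 2 : ℝ) • w with hA
  set B : Fin (k + 1) → ℂ := (1 / (2 * I)) • (ζ - w) with hB
  have hAI : A + I • B = ζ := by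
    ext i; simp [hA, hB]; field_simp; simp only [I_sq]; ring
  have hAI' : A + conj I • B = w := by
    ext i; simp [hA, hB]; field_simp; simp only [I_sq]; ring
  set D : Set ℂ := {z | A + z • B ∈ tube (k + 1) ∧ A + conj z • B ∈ tube (k + 1)} with hD
  have hDopen : IsOpen D := by
    refine IsOpen.inter ((isOpen_tube _).preimage (by fun_prop)) ((isOpen_tube _).preimage ?_)
    exact continuous_const.add (Complex.continuous_conj.smul continuous_const)
  have hDconv : Convex ℝ D := by
    intro x hx y hy a b ha hb hab
    have e1 : A + (a • x + b • y) • B = a • (A + x • B) + b • (A + y • B) := by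
      ext i
      have : (a : ℂ) + b = 1 := by exact_mod_cast hab
      simp
      linear_combination (-(A i)) * this
    have e2 : A + conj (a • x + b • y) • B = a • (A + conj x • B) + b • (A + conj y • B) := by
      ext i
      have : (a : ℂ) + b = 1 := by exact_mod_cast hab
      simp
      linear_combination (-(A i)) * this
    constructor
    · rw [e1]; exact convex_tube hx.1 hy.1 ha hb hab
    · rw [e2]; exact convex_tube hx.2 hy.2 ha hb hab
  have hI : I ∈ D := ⟨by rw [hAI]; exact hζ, by rw [hAI']; exact hw⟩
  have h0 : (0 : ℂ) ∈ D := by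
    have : A ∈ tube (k + 1) := convex_tube hζ hw (by norm_num) (by norm_num) (by norm_num)
    exact ⟨by simpa using this, by simpa using this⟩
  have h1 : DifferentiableOn ℂ (fun z : ℂ => kernelVec lam (A + conj z • B) (A + z • B)) D := by
    intro z hz
    obtain ⟨φ, R, hR, M, hφ⟩ := exists_norm_kernelVec_sub_le (lam := lam) hz.1
    obtain ⟨ψ, R', hR', M', hψ⟩ := exists_norm_kernelVec_sub_le (lam := lam) hz.2
    have := differentiableAt_inner_of_norm_sub_le (v := fun x => kernelVec lam (A + conj x • B))
      hR hR' hφ (ψ := ψ) (M' := M') fun x hx => by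
        have h := hψ (conj x) (by
          rw [mem_ball_iff_norm, ← map_sub, RCLike.norm_conj]; exact mem_ball_iff_norm.1 hx)
        rwa [← map_sub, Complex.conj_conj, RCLike.norm_conj] at h
    simp only [inner_kernelVec] at this
    exact this.differentiableWithinAt
  have h2 : DifferentiableOn ℂ (fun x : ℂ => G (A + x • B) (A + conj x • B)) D :=
    fun z hz => (hG A B z hz.1 hz.2).differentiableWithinAt
  have hfreq : ∃ᶠ z in nhdsWithin (0 : ℂ) {0}ᶜ,
      kernelVec lam (A + conj z • B) (A + z • B) = G (A + z • B) (A + conj z • B) := by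
    have ht : Filter.Tendsto (fun x : ℝ => (x : ℂ)) (nhdsWithin 0 {0}ᶜ) (nhdsWithin 0 {0}ᶜ) := by
      refine tendsto_nhdsWithin_iff.2 ⟨?_, ?_⟩
      · have := Complex.continuous_ofReal.tendsto 0
        exact (by simpa using this : Filter.Tendsto _ _ _).mono_left nhdsWithin_le_nhds
      · filter_upwards [self_mem_nhdsWithin] with x hx
        simpa using hx
    refine ht.frequently (Filter.Eventually.frequently ?_)
    have hmem : ∀ᶠ x : ℝ in nhds 0, (x : ℂ) ∈ D :=
      (Complex.continuous_ofReal.tendsto 0).eventually (by simpa using hDopen.mem_nhds h0)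
    filter_upwards [nhdsWithin_le_nhds hmem] with x hx
    rw [Complex.conj_ofReal]
    exact hdiag _ hx.1
  have := (h1.analyticOnNhd hDopen).eqOn_of_preconnected_of_frequently_eq
    (h2.analyticOnNhd hDopen) hDconv.isPreconnected h0 hfreq hI
  simpa only [hAI, hAI'] using this

end Bergman

/-! ### Affine automorphisms of the tube domain -/

section Reflection

variable {k : ℕ}

/-- The negative of the reflection in the hyperplane orthogonal to `u`. -/
def lorentzRefl {R : Type*} [Field R] (u x : Fin (k + 1) → R) : Fin (k + 1) → R :=
  (2 * lorentz x u / lorentz u u) • u - x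

theorem lorentz_sub_left {R : Type*} [CommRing R] (x y z : Fin (k + 1) → R) :
    lorentz (x - y) z = lorentz x z - lorentz y z := by
  simp only [lorentz, Pi.sub_apply, sub_mul, Finset.sum_sub_distrib]; ring

theorem stdForm_one_sub {R : Type*} [CommRing R] (x y : Fin (k + 1) → R) :
    stdForm 1 (x - y) = stdForm 1 x - 2 * lorentz x y + stdForm 1 y := by
  rw [← lorentz_self, lorentz_sub_left, lorentz_comm x, lorentz_comm y, lorentz_sub_left,
    lorentz_sub_left, lorentz_self, lorentz_self, lorentz_comm y x]; ring

theorem lorentz_lorentzRefl {R : Type*} [Field R] {u : Fin (k + 1) → R} (hu : lorentz u u ≠ 0)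
    (x : Fin (k + 1) → R) : lorentz (lorentzRefl u x) u = lorentz x u := by
  rw [lorentzRefl, lorentz_sub_left, lorentz_smul_left]
  field_simp
  ring

theorem lorentzRefl_lorentzRefl {R : Type*} [Field R] {u : Fin (k + 1) → R} (hu : lorentz u u ≠ 0)
    (x : Fin (k + 1) → R) : lorentzRefl u (lorentzRefl u x) = x := by
  rw [lorentzRefl, lorentz_lorentzRefl hu, lorentzRefl]
  abel

theorem stdForm_lorentzRefl {R : Type*} [Field R] {u : Fin (k + 1) → R} (hu : lorentz u u ≠ 0)
    (x : Fin (k + 1) → R) : stdForm 1 (lorentzRefl u x) = stdForm 1 x := by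
  rw [lorentzRefl, stdForm_one_sub, stdForm_smul, lorentz_smul_left, ← lorentz_self u,
    lorentz_comm u x]
  field_simp
  ring

theorem lorentzRefl_mem_cone {u x : Fin (k + 1) → ℝ} (hu : u ∈ cone (k + 1))
    (hx : x ∈ cone (k + 1)) : lorentzRefl u x ∈ cone (k + 1) := by
  have hu' : lorentz u u ≠ 0 := by rw [lorentz_self]; exact hu.1.ne'
  refine mem_cone_of_lorentz_pos hu ?_ ?_
  · rw [stdForm_lorentzRefl hu']; exact hx.1
  · rw [lorentz_comm, lorentz_lorentzRefl hu']; exact lorentz_pos_of_mem_cone hx hu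

theorem exists_lorentzRefl_eq {η : Fin (k + 1) → ℝ} (hη : η ∈ cone (k + 1))
    (h1 : stdForm 1 η = 1) : ∃ u ∈ cone (k + 1), lorentzRefl u (Pi.single 0 1) = η := by
  refine ⟨Pi.single 0 1 + η, add_mem_cone single_mem_cone hη, ?_⟩
  have hpos := (mem_cone_iff.1 hη).2
  have e : lorentz (Pi.single 0 1 : Fin (k + 1) → ℝ) η = η 0 := by simp [lorentz]
  have e1 : lorentz (Pi.single 0 1 : Fin (k + 1) → ℝ) (Pi.single 0 1) = 1 := by simp [lorentz]
  have e2 : lorentz (Pi.single 0 1 + η) (Pi.single 0 1 + η) = 2 * (1 + η 0) := by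
    rw [lorentz_self, stdForm_one_add, h1, ← lorentz_self, e1, e]; ring
  have e3 : lorentz (Pi.single 0 1) (Pi.single 0 1 + η) = 1 + η 0 := by
    rw [lorentz_comm, lorentz_add_left, e1, lorentz_comm, e]
  rw [lorentzRefl, e2, e3, div_self (by positivity), one_smul, add_sub_cancel_left]

/-- The complex linear map `ζ ↦ r • lorentzRefl u ζ`. -/
def tubeLin (u : Fin (k + 1) → ℝ) (r : ℝ) : (Fin (k + 1) → ℂ) →ₗ[ℂ] (Fin (k + 1) → ℂ) where
  toFun ζ := (r : ℂ) • lorentzRefl (fun i => (u i : ℂ)) ζ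
  map_add' x y := by
    rw [lorentzRefl, lorentz_add_left, mul_add, add_div, add_smul, ← smul_add, lorentzRefl,
      lorentzRefl]
    congr 1; abel
  map_smul' c x := by
    rw [lorentzRefl, lorentz_smul_left, lorentzRefl, RingHom.id_apply, smul_comm c]
    congr 1
    rw [smul_sub, smul_smul]
    congr 2; ring

theorem lorentz_ofReal (u v : Fin (k + 1) → ℝ) :
    lorentz (fun i => (u i : ℂ)) (fun i => (v i : ℂ)) = ((lorentz u v : ℝ) : ℂ) := by
  simp [lorentz]

theorem lorentz_im (ζ : Fin (k + 1) → ℂ) (v : Fin (k + 1) → ℝ) :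
    (lorentz ζ (fun i => (v i : ℂ))).im = lorentz (imPart ζ) v := by
  simp [lorentz, imPart]

theorem imPart_tubeLin (u : Fin (k + 1) → ℝ) (r : ℝ) (ζ : Fin (k + 1) → ℂ) :
    imPart (tubeLin u r ζ) = r • lorentzRefl u (imPart ζ) := by
  ext i
  have h : ((2 * lorentz ζ (fun i => (u i : ℂ)) / lorentz (fun i => (u i : ℂ)) (fun i => (u i : ℂ)))
      * (u i : ℂ)).im = 2 * lorentz (imPart ζ) u / lorentz u u * u i := by
    rw [lorentz_ofReal, Complex.im_mul_ofReal, Complex.div_ofReal_im]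
    congr 2
    have : (2 : ℂ) = ((2 : ℝ) : ℂ) := by norm_num
    rw [this, Complex.im_ofReal_mul, lorentz_im]
  simp only [tubeLin, lorentzRefl, imPart, LinearMap.coe_mk, AddHom.coe_mk, Pi.smul_apply,
    Pi.sub_apply, smul_eq_mul, Complex.im_ofReal_mul, Complex.sub_im, h]

theorem tubeLin_tubeLin {u : Fin (k + 1) → ℝ} (hu : u ∈ cone (k + 1)) (r s : ℝ)
    (ζ : Fin (k + 1) → ℂ) : tubeLin u r (tubeLin u s ζ) = ((r * s : ℝ) : ℂ) • ζ := by
  have hu' : lorentz (fun i => (u i : ℂ)) (fun i => (u i : ℂ)) ≠ 0 := by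
    rw [lorentz_ofReal, lorentz_self]; exact_mod_cast hu.1.ne'
  have h : tubeLin u s ζ = (s : ℂ) • lorentzRefl (fun i => (u i : ℂ)) ζ := rfl
  rw [h, map_smul, ofReal_mul, mul_comm, mul_smul]
  congr 1
  change (r : ℂ) • lorentzRefl _ (lorentzRefl _ ζ) = _
  rw [lorentzRefl_lorentzRefl hu']

/-- The affine map `ζ ↦ r • lorentzRefl u ζ + a`. -/
def tubeAff (u : Fin (k + 1) → ℝ) (r : ℝ) (a : Fin (k + 1) → ℝ) (ζ : Fin (k + 1) → ℂ) :
    Fin (k + 1) → ℂ := tubeLin u r ζ + fun i => (a i : ℂ)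

theorem imPart_tubeAff (u : Fin (k + 1) → ℝ) (r : ℝ) (a : Fin (k + 1) → ℝ)
    (ζ : Fin (k + 1) → ℂ) : imPart (tubeAff u r a ζ) = r • lorentzRefl u (imPart ζ) := by
  rw [← imPart_tubeLin]
  ext i; simp [imPart, tubeAff]

variable {u : Fin (k + 1) → ℝ} {r : ℝ}

theorem stdForm_imPart_tubeAff (hu : u ∈ cone (k + 1)) (a : Fin (k + 1) → ℝ)
    (ζ : Fin (k + 1) → ℂ) :
    stdForm 1 (imPart (tubeAff u r a ζ)) = r ^ 2 * stdForm 1 (imPart ζ) := by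
  rw [imPart_tubeAff, stdForm_smul, stdForm_lorentzRefl (by rw [lorentz_self]; exact hu.1.ne')]

theorem tubeAff_mem_tube_iff (hu : u ∈ cone (k + 1)) (hr : 0 < r) (a : Fin (k + 1) → ℝ)
    {ζ : Fin (k + 1) → ℂ} : tubeAff u r a ζ ∈ tube (k + 1) ↔ ζ ∈ tube (k + 1) := by
  have key : ∀ η : Fin (k + 1) → ℝ, η ∈ cone (k + 1) → r • lorentzRefl u η ∈ cone (k + 1) :=
    fun η hη => smul_mem_cone (lorentzRefl_mem_cone hu hη) hr
  simp only [tube, Set.mem_ofPred_eq, imPart_tubeAff]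
  refine ⟨fun h => ?_, key _⟩
  have h1 := lorentzRefl_mem_cone hu (smul_mem_cone h (inv_pos.2 hr))
  rwa [smul_smul, inv_mul_cancel₀ hr.ne', one_smul,
    lorentzRefl_lorentzRefl (by rw [lorentz_self]; exact hu.1.ne')] at h1

theorem continuous_tubeAff (a : Fin (k + 1) → ℝ) : Continuous (tubeAff u r a) :=
  (LinearMap.continuous_of_finiteDimensional _).add continuous_const

theorem map_tubeAff_volume (hu : u ∈ cone (k + 1)) (hr : 0 < r) (a : Fin (k + 1) → ℝ) :
    Measure.map (tubeAff u r a) volume =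
      ENNReal.ofReal (r ^ (-(2 * ((k + 1 : ℕ) : ℝ)))) • (volume : Measure (Fin (k + 1) → ℂ)) := by
  set L : (Fin (k + 1) → ℂ) →ₗ[ℝ] (Fin (k + 1) → ℂ) := (tubeLin u r).restrictScalars ℝ with hL
  have hLL : L ∘ₗ L = (r ^ 2) • LinearMap.id := by
    refine LinearMap.ext fun ζ => ?_
    have := tubeLin_tubeLin hu r r ζ
    simp only [hL, LinearMap.comp_apply, LinearMap.restrictScalars_apply, this, pow_two]
    rfl
  have hdet2 : LinearMap.det L ^ 2 = (r ^ (2 * (k + 1))) ^ 2 := by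
    rw [pow_two, ← LinearMap.det_comp, hLL, LinearMap.det_smul, LinearMap.det_id, mul_one,
      Module.finrank_pi_fintype]
    simp only [Complex.finrank_real_complex, Finset.sum_const, Finset.card_univ, Fintype.card_fin,
      smul_eq_mul]
    ring
  have habs : |LinearMap.det L| = r ^ (2 * (k + 1)) := by
    rw [← abs_of_pos (show 0 < r ^ (2 * (k + 1)) by positivity)]
    exact (sq_eq_sq_iff_abs_eq_abs _ _).1 hdet2
  have hne : LinearMap.det L ≠ 0 := by
    intro h
    rw [h, abs_zero] at habs
    exact absurd habs (by positivity)
  have h1 := Measure.map_linearMap_addHaar_eq_smul_addHaar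
    (volume : Measure (Fin (k + 1) → ℂ)) hne
  have hcomp : tubeAff u r a = (fun ζ => ζ + fun i => (a i : ℂ)) ∘ L := rfl
  rw [hcomp, ← Measure.map_map (by fun_prop) (LinearMap.continuous_of_finiteDimensional L).measurable,
    h1, Measure.map_smul, map_add_right_eq_self, abs_inv, habs]
  congr 2
  rw [Real.rpow_neg hr.le]
  congr 1
  rw [← Real.rpow_natCast]
  push_cast
  ring_nf

end Reflection

namespace Bergman

variable {k : ℕ} {lam : ℝ} {u : Fin (k + 1) → ℝ} {r : ℝ}

theorem map_tubeAff_bergmanMeasure (hu : u ∈ cone (k + 1)) (hr : 0 < r) (a : Fin (k + 1) → ℝ) :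
    Measure.map (tubeAff u r a) (bergmanMeasure (k + 1) lam) =
      ENNReal.ofReal (r ^ (-(2 * lam))) • bergmanMeasure (k + 1) lam := by
  set w : (Fin (k + 1) → ℂ) → ENNReal := fun ζ =>
    ENNReal.ofReal (stdForm 1 (imPart ζ) ^ (lam - ((k + 1 : ℕ) : ℝ))) with hw
  have hwm : Measurable w := measurable_weight
  have htube := (isOpen_tube (k + 1)).measurableSet
  have hμ : bergmanMeasure (k + 1) lam = volume.withDensity ((tube (k + 1)).indicator w) :=
    (withDensity_indicator htube w).symm
  have hT := (continuous_tubeAff (u := u) (r := r) a).measurable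
  have hW : ∀ ζ, (tube (k + 1)).indicator w ζ =
      ENNReal.ofReal (r ^ (-(2 * (lam - ((k + 1 : ℕ) : ℝ))))) *
        (tube (k + 1)).indicator w (tubeAff u r a ζ) := by
    intro ζ
    by_cases hζ : ζ ∈ tube (k + 1)
    · rw [Set.indicator_of_mem hζ, Set.indicator_of_mem ((tubeAff_mem_tube_iff hu hr a).2 hζ), hw]
      simp only
      rw [stdForm_imPart_tubeAff hu, ← ENNReal.ofReal_mul (by positivity),
        Real.mul_rpow (by positivity) hζ.1.le, ← mul_assoc, ← Real.rpow_natCast r 2,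
        ← Real.rpow_mul hr.le, ← Real.rpow_add hr]
      have : -(2 * (lam - ((k + 1 : ℕ) : ℝ))) + ((2 : ℕ) : ℝ) * (lam - ((k + 1 : ℕ) : ℝ)) = 0 := by
        push_cast; ring
      rw [this, Real.rpow_zero, one_mul]
    · rw [Set.indicator_of_notMem hζ,
        Set.indicator_of_notMem (mt (tubeAff_mem_tube_iff hu hr a).1 hζ), mul_zero]
  ext s hs
  rw [Measure.map_apply hT hs, hμ, withDensity_apply _ (hT hs), Measure.smul_apply,
    withDensity_apply _ hs, ← lintegral_indicator (hT hs), ← lintegral_indicator hs, smul_eq_mul]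
  have e : (tubeAff u r a ⁻¹' s).indicator ((tube (k + 1)).indicator w) = fun ζ =>
      ENNReal.ofReal (r ^ (-(2 * (lam - ((k + 1 : ℕ) : ℝ))))) *
        s.indicator ((tube (k + 1)).indicator w) (tubeAff u r a ζ) := by
    funext ζ
    by_cases h : tubeAff u r a ζ ∈ s
    · rw [Set.indicator_of_mem (by exact h), Set.indicator_of_mem h, hW]
    · rw [Set.indicator_of_notMem (by exact h), Set.indicator_of_notMem h, mul_zero]
  have hm : Measurable (s.indicator ((tube (k + 1)).indicator w)) :=
    (hwm.indicator htube).indicator hs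
  rw [e]
  beta_reduce
  rw [lintegral_const_mul _ (f := fun ζ => s.indicator ((tube (k + 1)).indicator w)
    (tubeAff u r a ζ)) (hm.comp hT), ← lintegral_map hm hT, map_tubeAff_volume hu hr,
    lintegral_smul_measure, smul_eq_mul, ← mul_assoc, ← ENNReal.ofReal_mul (by positivity),
    ← Real.rpow_add hr]
  congr 3
  ring

theorem exists_comp_tubeAff (hu : u ∈ cone (k + 1)) (hr : 0 < r) (a : Fin (k + 1) → ℝ)
    (f : Bergman (k + 1) lam) : ∃ g : Bergman (k + 1) lam,
      (∀ ζ, g ζ = f (tubeAff u r a ζ)) ∧ ‖g‖ = r ^ (-lam) * ‖f‖ := by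
  have hT := (continuous_tubeAff (u := u) (r := r) a).measurable
  have hmap := map_tubeAff_bergmanMeasure (lam := lam) hu hr a
  have hdiff : Differentiable ℂ (tubeAff u r a) :=
    (LinearMap.toContinuousLinearMap (tubeLin u r)).differentiable.add_const _
  have hmem' : MemLp f 2 (Measure.map (tubeAff u r a) (bergmanMeasure (k + 1) lam)) := by
    rw [hmap]; exact f.memLp.smul_measure ENNReal.ofReal_ne_top
  have hmem := (memLp_map_measure_iff hmem'.1 hT.aemeasurable).1 hmem'
  let g : Bergman (k + 1) lam := ⟨fun ζ => f (tubeAff u r a ζ),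
    f.differentiableOn.comp hdiff.differentiableOn
      fun ζ hζ => (tubeAff_mem_tube_iff hu hr a).2 hζ,
    fun ζ hζ => f.eq_zero_of_notMem (mt (tubeAff_mem_tube_iff hu hr a).1 hζ), hmem⟩
  refine ⟨g, fun _ => rfl, ?_⟩
  have h1 : ‖g‖ ^ 2 = (r ^ (-lam) * ‖f‖) ^ 2 := by
    rw [norm_sq_eq, mul_pow, norm_sq_eq f]
    have h2 := integral_map (φ := tubeAff u r a) hT.aemeasurable (μ := bergmanMeasure (k + 1) lam)
      (f := fun ζ => ‖f ζ‖ ^ 2) (hmem'.1.norm.pow 2)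
    rw [hmap, integral_smul_measure, ENNReal.toReal_ofReal (by positivity), smul_eq_mul] at h2
    refine h2.symm.trans ?_
    congr 1
    rw [← Real.rpow_natCast (r ^ (-lam)), ← Real.rpow_mul hr.le]
    congr 1; push_cast; ring
  exact (sq_eq_sq₀ (norm_nonneg _) (by positivity)).1 h1

/-- The base point `i e` of the tube domain. -/
def basePoint (k : ℕ) : Fin (k + 1) → ℂ := Pi.single 0 I

theorem imPart_basePoint : imPart (basePoint k) = Pi.single 0 1 := by
  ext i
  by_cases h : i = 0
  · subst h; simp [imPart, basePoint]
  · simp [imPart, basePoint, h]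

theorem basePoint_mem_tube : basePoint k ∈ tube (k + 1) := by
  rw [tube, Set.mem_ofPred_eq, imPart_basePoint]; exact single_mem_cone

theorem exists_tubeAff_basePoint {ζ : Fin (k + 1) → ℂ} (hζ : ζ ∈ tube (k + 1)) :
    ∃ u ∈ cone (k + 1), ∃ a, tubeAff u (Real.sqrt (stdForm 1 (imPart ζ))) a (basePoint k) = ζ := by
  set r := Real.sqrt (stdForm 1 (imPart ζ)) with hr
  have hr0 : 0 < r := Real.sqrt_pos.2 hζ.1
  obtain ⟨u, hu, hue⟩ := exists_lorentzRefl_eq (smul_mem_cone hζ (inv_pos.2 hr0)) (by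
    rw [stdForm_smul, inv_pow, hr, Real.sq_sqrt hζ.1.le, inv_mul_cancel₀ hζ.1.ne'])
  refine ⟨u, hu, fun i => (ζ i).re - (tubeLin u r (basePoint k) i).re, ?_⟩
  have him := imPart_tubeLin u r (basePoint k)
  rw [imPart_basePoint, hue, smul_smul, mul_inv_cancel₀ hr0.ne', one_smul] at him
  ext i
  apply Complex.ext
  · simp [tubeAff]
  · have := congrFun him i
    simpa [tubeAff, imPart] using this

theorem norm_evalCLM_tubeAff_le (hu : u ∈ cone (k + 1)) (hr : 0 < r) (a : Fin (k + 1) → ℝ)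
    (ζ : Fin (k + 1) → ℂ) :
    ‖kernelVec lam (tubeAff u r a ζ)‖ ≤ r ^ (-lam) * ‖kernelVec lam ζ‖ := by
  set f := kernelVec lam (tubeAff u r a ζ) with hf
  obtain ⟨g, hg, hgn⟩ := exists_comp_tubeAff hu hr a f
  have h1 : ⟪f, f⟫_ℂ = ⟪kernelVec lam ζ, g⟫_ℂ := by
    rw [inner_kernelVec, inner_kernelVec, hg]
  have h2 := norm_inner_le_norm (𝕜 := ℂ) (kernelVec lam ζ) g
  rw [← h1, hgn, inner_self_eq_norm_sq_to_K] at h2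
  have h3 : ‖((‖f‖ : ℝ) : ℂ) ^ 2‖ = ‖f‖ ^ 2 := by simp
  have h4 : ‖f‖ ^ 2 ≤ ‖kernelVec lam ζ‖ * (r ^ (-lam) * ‖f‖) := by rw [← h3]; exact h2
  rcases (norm_nonneg f).eq_or_lt with h0 | h0
  · rw [← h0]; positivity
  · refine le_of_mul_le_mul_right (a := ‖f‖) ?_ h0
    calc ‖f‖ * ‖f‖ = ‖f‖ ^ 2 := by ring
      _ ≤ _ := h4
      _ = _ := by ring

theorem norm_kernelVec_eq {ζ : Fin (k + 1) → ℂ} (hζ : ζ ∈ tube (k + 1)) :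
    ‖kernelVec lam ζ‖ ^ 2 =
      stdForm 1 (imPart ζ) ^ (-lam) * ‖kernelVec lam (basePoint k)‖ ^ 2 := by
  obtain ⟨u, hu, a, ha⟩ := exists_tubeAff_basePoint hζ
  set r := Real.sqrt (stdForm 1 (imPart ζ)) with hr
  have hr0 : 0 < r := Real.sqrt_pos.2 hζ.1
  have h1 := norm_evalCLM_tubeAff_le (lam := lam) hu hr0 a (basePoint k)
  rw [ha] at h1
  obtain ⟨b, hb⟩ : ∃ b, tubeAff u r⁻¹ b ζ = basePoint k := by
    refine ⟨fun i => -((tubeLin u r⁻¹ fun i => (a i : ℂ)) i).re, ?_⟩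
    have him := imPart_tubeLin u r⁻¹ (fun i => (a i : ℂ))
    have h0 : imPart (fun i => (a i : ℂ)) = 0 := by ext i; simp [imPart]
    have h00 : lorentzRefl u 0 = 0 := by simp [lorentzRefl, lorentz]
    rw [h0, h00, smul_zero] at him
    have hreal : (fun i => ((-((tubeLin u r⁻¹ fun i => (a i : ℂ)) i).re : ℝ) : ℂ))
        = -(tubeLin u r⁻¹ fun i => (a i : ℂ)) := by
      ext i
      have := congrFun him i
      apply Complex.ext
      · simp
      · simpa [imPart] using this
    rw [← ha, tubeAff, hreal, tubeAff, map_add, tubeLin_tubeLin hu, inv_mul_cancel₀ hr0.ne',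
      ofReal_one, one_smul, add_neg_cancel_right]
  have h2 := norm_evalCLM_tubeAff_le (lam := lam) hu (inv_pos.2 hr0) b ζ
  rw [hb, Real.inv_rpow hr0.le, ← Real.rpow_neg hr0.le, neg_neg] at h2
  have h3 : ‖kernelVec lam ζ‖ = r ^ (-lam) * ‖kernelVec lam (basePoint k)‖ := by
    refine le_antisymm h1 ?_
    calc r ^ (-lam) * ‖kernelVec lam (basePoint k)‖ ≤ r ^ (-lam) * (r ^ lam * ‖kernelVec lam ζ‖) := by
          gcongr
      _ = ‖kernelVec lam ζ‖ := by
          rw [← mul_assoc, ← Real.rpow_add hr0, neg_add_cancel, Real.rpow_zero, one_mul]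
  rw [h3, mul_pow, hr, Real.sqrt_eq_rpow, ← Real.rpow_mul hζ.1.le, ← Real.rpow_natCast,
    ← Real.rpow_mul hζ.1.le]
  congr 2
  push_cast; ring

/-- The reproducing kernel is a multiple of a power of the quadratic form. -/
theorem kernelVec_eq_cpow (lam : ℝ) {ζ w : Fin (k + 1) → ℂ} (hζ : ζ ∈ tube (k + 1))
    (hw : w ∈ tube (k + 1)) :
    kernelVec lam w ζ = ((4 ^ lam * ‖kernelVec lam (basePoint k)‖ ^ 2 : ℝ) : ℂ) *
      (-stdForm 1 (ζ - conjVec w)) ^ (-(lam : ℂ)) := by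
  refine kernelVec_eq_of_diag (fun ζ w => ((4 ^ lam * ‖kernelVec lam (basePoint k)‖ ^ 2 : ℝ) : ℂ) *
      (-stdForm 1 (ζ - conjVec w)) ^ (-(lam : ℂ))) ?_ ?_ hζ hw
  · intro A B z hA hB
    have e : ∀ x : ℂ, A + x • B - conjVec (A + conj x • B) = A - conjVec A + x • (B - conjVec B) := by
      intro x; ext i; simp [conjVec]; ring
    simp only [e]
    refine DifferentiableAt.const_mul (DifferentiableAt.cpow_const ?_ ?_) _
    · simp only [stdForm_one_eq, Pi.add_apply, Pi.smul_apply, smul_eq_mul]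
      fun_prop
    · rw [← e]; exact neg_stdForm_mem_slitPlane (sub_conjVec_mem_tube hA hB)
  · intro ζ hζ
    have h := norm_kernelVec_eq (lam := lam) hζ
    rw [← inner_kernelVec, inner_self_eq_norm_sq_to_K]
    have h2 : ((‖kernelVec lam ζ‖ : ℝ) : ℂ) ^ 2 = ((‖kernelVec lam ζ‖ ^ 2 : ℝ) : ℂ) := by simp
    refine h2.trans ?_
    rw [h, neg_stdForm_sub_conjVec_self, ← ofReal_neg,
      ← ofReal_cpow (mul_nonneg (by norm_num) hζ.1.le), ← ofReal_mul,
      Real.mul_rpow (by norm_num) hζ.1.le]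
    congr 1
    have : (4 : ℝ) ^ lam * 4 ^ (-lam) = 1 := by
      rw [← Real.rpow_add (by norm_num), add_neg_cancel, Real.rpow_zero]
    linear_combination (-(stdForm 1 (imPart ζ) ^ (-lam) * ‖kernelVec lam (basePoint k)‖ ^ 2)) * this

end Bergman

/-! ### Gamma and Gaussian integrals -/

section GammaIntegrals

theorem lintegral_rpow_mul_exp_neg {s r : ℝ} (hs : 0 < s) (hr : 0 < r) :
    ∫⁻ t in Set.Ioi (0 : ℝ), ENNReal.ofReal (t ^ (s - 1) * Real.exp (-(r * t))) =
      ENNReal.ofReal (r ^ (-s) * Real.Gamma s) := by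
  have h := Real.integral_rpow_mul_exp_neg_mul_Ioi hs hr
  have hpos : 0 < (1 / r) ^ s * Real.Gamma s :=
    mul_pos (Real.rpow_pos_of_pos (by positivity) _) (Real.Gamma_pos_of_pos hs)
  have hint : Integrable (fun t : ℝ => t ^ (s - 1) * Real.exp (-(r * t)))
      (volume.restrict (Set.Ioi 0)) := by
    by_contra hni
    rw [integral_undef hni] at h
    exact hpos.ne h
  rw [← ofReal_integral_eq_lintegral_ofReal hint, h, Real.rpow_neg hr.le, one_div,
    Real.inv_rpow hr.le]
  filter_upwards [ae_restrict_mem measurableSet_Ioi] with t ht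
  have : (0 : ℝ) < t := ht
  positivity

/-- Gamma subordination: from exponential integrals to integrals of powers. -/
theorem lintegral_add_rpow_neg {α : Type*} [MeasurableSpace α] {μ : Measure α} [SFinite μ]
    {φ : α → ℝ} (hφ : Measurable φ) (hφ0 : ∀ x, 0 ≤ φ x) {C κ : ℝ} (hC : 0 ≤ C)
    (h : ∀ t > 0, ∫⁻ x, ENNReal.ofReal (Real.exp (-(t * φ x))) ∂μ = ENNReal.ofReal (C * t ^ (-κ)))
    {B s : ℝ} (hB : 0 < B) (hs : 0 < s) (hsκ : κ < s) :
    ∫⁻ x, ENNReal.ofReal ((B + φ x) ^ (-s)) ∂μ =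
      ENNReal.ofReal (C * B ^ (κ - s) * Real.Gamma (s - κ) / Real.Gamma s) := by
  have hΓ := Real.Gamma_pos_of_pos hs
  have hpow : ∀ x, ENNReal.ofReal ((B + φ x) ^ (-s)) = ENNReal.ofReal (Real.Gamma s)⁻¹ *
      ∫⁻ t in Set.Ioi (0 : ℝ), ENNReal.ofReal (t ^ (s - 1) * Real.exp (-((B + φ x) * t))) := by
    intro x
    have hx : 0 < B + φ x := add_pos_of_pos_of_nonneg hB (hφ0 x)
    rw [lintegral_rpow_mul_exp_neg hs hx, ← ENNReal.ofReal_mul (by positivity)]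
    congr 1
    field_simp
  simp only [hpow]
  rw [lintegral_const_mul' _ _ ENNReal.ofReal_ne_top, lintegral_lintegral_swap]
  · have e : ∀ t ∈ Set.Ioi (0 : ℝ),
        ∫⁻ x, ENNReal.ofReal (t ^ (s - 1) * Real.exp (-((B + φ x) * t))) ∂μ =
          ENNReal.ofReal C * ENNReal.ofReal (t ^ (s - κ - 1) * Real.exp (-(B * t))) := by
      intro t ht
      have ht0 : (0 : ℝ) < t := ht
      have e1 : ∀ x, ENNReal.ofReal (t ^ (s - 1) * Real.exp (-((B + φ x) * t))) =
          ENNReal.ofReal (t ^ (s - 1) * Real.exp (-(B * t))) *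
            ENNReal.ofReal (Real.exp (-(t * φ x))) := by
        intro x
        rw [← ENNReal.ofReal_mul (by positivity), mul_assoc, ← Real.exp_add]
        congr 3; ring
      simp only [e1]
      rw [lintegral_const_mul' _ _ ENNReal.ofReal_ne_top, h t ht0,
        ← ENNReal.ofReal_mul (by positivity), ← ENNReal.ofReal_mul hC]
      congr 1
      have : t ^ (s - κ - 1) = t ^ (s - 1) * t ^ (-κ) := by
        rw [← Real.rpow_add ht0]; congr 1; ring
      rw [this]; ring
    rw [setLIntegral_congr_fun measurableSet_Ioi e, lintegral_const_mul' _ _ ENNReal.ofReal_ne_top,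
      lintegral_rpow_mul_exp_neg (by linarith) hB, ← ENNReal.ofReal_mul hC,
      ← ENNReal.ofReal_mul (by positivity)]
    congr 1
    rw [neg_sub]
    field_simp
  · refine Measurable.aemeasurable ?_
    simp only [Function.uncurry_def]
    have : Measurable fun p : α × ℝ => φ p.1 := hφ.comp measurable_fst
    fun_prop

theorem lintegral_gaussian_pi {k : ℕ} {b : ℝ} (hb : 0 < b) (c : Fin k → ℝ) :
    ∫⁻ y : Fin k → ℝ, ENNReal.ofReal (Real.exp (-b * ∑ i, y i ^ 2 + ∑ i, c i * y i)) =
      ENNReal.ofReal ((Real.pi / b) ^ ((k : ℝ) / 2) * Real.exp ((∑ i, c i ^ 2) / (4 * b))) := by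
  have hb' : 0 < (b : ℂ).re := hb
  have h := GaussianFourier.integral_cexp_neg_mul_sum_add hb' (fun i => (c i : ℂ))
  have hint := GaussianFourier.integrable_cexp_neg_mul_sum_add hb' (fun i => (c i : ℂ))
  have e : ∀ y : Fin k → ℝ, cexp (-(b : ℂ) * ∑ i, (y i : ℂ) ^ 2 + ∑ i, (c i : ℂ) * y i) =
      ((Real.exp (-b * ∑ i, y i ^ 2 + ∑ i, c i * y i) : ℝ) : ℂ) := fun y => by push_cast; rfl
  simp only [e] at h hint
  have hint' : Integrable fun y : Fin k → ℝ => Real.exp (-b * ∑ i, y i ^ 2 + ∑ i, c i * y i) := by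
    have h3 := hint.re
    simp only [RCLike.re_to_complex, ofReal_re] at h3
    exact h3
  rw [integral_complex_ofReal] at h
  rw [← ofReal_integral_eq_lintegral_ofReal hint' (.of_forall fun y => by positivity)]
  congr 1
  apply Complex.ofReal_injective
  rw [h, ofReal_mul, ofReal_cpow (by positivity)]
  push_cast
  simp

theorem lintegral_gaussian_pi_shift {k : ℕ} {b : ℝ} (hb : 0 < b) (x : Fin k → ℝ) :
    ∫⁻ y : Fin k → ℝ, ENNReal.ofReal (Real.exp (-(b * ∑ i, (y i - x i) ^ 2))) =
      ENNReal.ofReal ((Real.pi / b) ^ ((k : ℝ) / 2)) := by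
  have h := lintegral_sub_right_eq_self (μ := (volume : Measure (Fin k → ℝ)))
    (fun y => ENNReal.ofReal (Real.exp (-(b * ∑ i, (y i) ^ 2)))) x
  simp only [Pi.sub_apply] at h
  rw [h]
  simpa using lintegral_gaussian_pi hb (0 : Fin k → ℝ)

theorem lintegral_gaussian_shift {b : ℝ} (hb : 0 < b) (x : ℝ) :
    ∫⁻ y : ℝ, ENNReal.ofReal (Real.exp (-(b * (y - x) ^ 2))) =
      ENNReal.ofReal (Real.sqrt (Real.pi / b)) := by
  have h := lintegral_sub_right_eq_self (μ := (volume : Measure ℝ))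
    (fun y => ENNReal.ofReal (Real.exp (-(b * y ^ 2)))) x
  rw [h]
  have hint := integrable_exp_neg_mul_sq hb
  have h2 := integral_gaussian b
  simp only [neg_mul] at hint h2
  rw [← h2, ofReal_integral_eq_lintegral_ofReal hint (.of_forall fun y => by positivity)]

theorem lintegral_add_sq_rpow_neg {B s : ℝ} (hB : 0 < B) (hs : 1 / 2 < s) (x : ℝ) :
    ∫⁻ y : ℝ, ENNReal.ofReal ((B + (y - x) ^ 2) ^ (-s)) =
      ENNReal.ofReal (Real.sqrt Real.pi * B ^ (1 / 2 - s) * Real.Gamma (s - 1 / 2) /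
        Real.Gamma s) := by
  refine lintegral_add_rpow_neg (by fun_prop) (fun y => by positivity) (by positivity)
    (fun t ht => ?_) hB (by linarith) hs
  rw [lintegral_gaussian_shift ht, Real.sqrt_div' _ ht.le, Real.rpow_neg ht.le,
    ← Real.sqrt_eq_rpow, div_eq_mul_inv]

theorem lintegral_add_sum_sq_rpow_neg {k : ℕ} {A B s : ℝ} (hA : 0 < A) (hB : 0 < B) (hs0 : 0 < s)
    (hs : (k : ℝ) / 2 < s) (x : Fin k → ℝ) :
    ∫⁻ y : Fin k → ℝ, ENNReal.ofReal ((B + A * ∑ i, (y i - x i) ^ 2) ^ (-s)) =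
      ENNReal.ofReal ((Real.pi / A) ^ ((k : ℝ) / 2) * B ^ ((k : ℝ) / 2 - s) *
        Real.Gamma (s - (k : ℝ) / 2) / Real.Gamma s) := by
  refine lintegral_add_rpow_neg (by fun_prop) (fun y => by positivity) (by positivity)
    (fun t ht => ?_) hB hs0 hs
  have := lintegral_gaussian_pi_shift (mul_pos ht hA) x
  simp only [mul_assoc] at this
  rw [this, Real.rpow_neg ht.le, ← div_eq_mul_inv, ← Real.div_rpow (by positivity) ht.le, div_div,
    mul_comm A]

end GammaIntegrals

/-! ### Light-cone coordinates -/

section LightCone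

variable {k : ℕ}

/-- The vector with light-cone coordinates `p`, `q` and transversal part `y`. -/
def lightVec (p q : ℝ) (y : Fin k → ℝ) : Fin (k + 2) → ℝ :=
  Fin.cons ((p + q) / 2) (Fin.cons ((q - p) / 2) y)

theorem lintegral_mul_left_eq {g : ℝ → ENNReal} (hg : Measurable g) {a : ℝ} (ha : a ≠ 0) :
    ∫⁻ x, g (a * x) = ENNReal.ofReal |a⁻¹| * ∫⁻ x, g x := by
  rw [← lintegral_map hg (measurable_const_mul a), Real.map_volume_mul_left ha,
    lintegral_smul_measure, smul_eq_mul]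

theorem measurable_cons {n : ℕ} :
    Measurable fun z : ℝ × (Fin n → ℝ) => (Fin.cons z.1 z.2 : Fin (n + 1) → ℝ) := by
  refine measurable_pi_iff.2 fun i => ?_
  refine Fin.cases ?_ (fun j => ?_) i
  · simpa using measurable_fst
  · simp only [Fin.cons_succ]; fun_prop

theorem lintegral_cons {n : ℕ} {G : (Fin (n + 1) → ℝ) → ENNReal} (hG : Measurable G) :
    ∫⁻ x, G x = ∫⁻ a : ℝ, ∫⁻ v : Fin n → ℝ, G (Fin.cons a v) := by
  have h := ((volume_preserving_piFinSuccAbove (fun _ : Fin (n + 1) => ℝ) 0).symm _).lintegral_comp hG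
  have e : ∀ z, (MeasurableEquiv.piFinSuccAbove (fun _ : Fin (n + 1) => ℝ) 0).symm z =
      Fin.cons z.1 z.2 := fun z => by
    simp [MeasurableEquiv.piFinSuccAbove, Fin.insertNthEquiv]
  simp only [e] at h
  rw [← h]
  exact lintegral_prod (fun z : ℝ × (Fin n → ℝ) => G (Fin.cons z.1 z.2))
    (hG.comp measurable_cons).aemeasurable

theorem lintegral_lightVec {F : (Fin (k + 2) → ℝ) → ENNReal} (hF : Measurable F) :
    ∫⁻ x, F x = ENNReal.ofReal (1 / 2) * ∫⁻ p, ∫⁻ y, ∫⁻ q, F (lightVec p q y) := by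
  have hm : Measurable fun x : ℝ × ℝ × (Fin k → ℝ) =>
      (Fin.cons x.1 (Fin.cons x.2.1 x.2.2) : Fin (k + 2) → ℝ) :=
    measurable_cons.comp (measurable_fst.prodMk (measurable_cons.comp measurable_snd))
  have hFm : Measurable fun x : ℝ × ℝ × (Fin k → ℝ) => F (Fin.cons x.1 (Fin.cons x.2.1 x.2.2)) :=
    hF.comp hm
  have hplane : ∀ f : ℝ → ℝ → ENNReal, Measurable (Function.uncurry f) →
      ∫⁻ a, ∫⁻ b, f a b = ENNReal.ofReal (1 / 2) * ∫⁻ p, ∫⁻ q, f ((p + q) / 2) ((q - p) / 2) := by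
    intro f hf
    rw [lintegral_lintegral_swap hf.aemeasurable]
    have e1 : ∀ b, ∫⁻ a, f a b = ∫⁻ p, f (p + b) b := fun b =>
      (lintegral_add_right_eq_self (fun a => f a b) b).symm
    simp only [e1]
    have hf' : Measurable (Function.uncurry fun b p : ℝ => f (p + b) b) :=
      hf.comp ((measurable_snd.add measurable_fst).prodMk measurable_fst)
    rw [lintegral_lintegral_swap hf'.aemeasurable, ← lintegral_const_mul' _ _ ENNReal.ofReal_ne_top]
    refine lintegral_congr fun p => ?_
    have hg : Measurable fun b => f (p + b) b :=
      hf.comp ((measurable_const.add measurable_id).prodMk measurable_id)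
    have h2 := lintegral_mul_left_eq hg (a := 1 / 2) (by norm_num)
    have h3 := lintegral_sub_right_eq_self (μ := (volume : Measure ℝ))
      (fun x => f (p + 1 / 2 * x) (1 / 2 * x)) p
    have e2 : ∀ q, f ((p + q) / 2) ((q - p) / 2) = f (p + 1 / 2 * (q - p)) (1 / 2 * (q - p)) := by
      intro q; congr 1 <;> ring
    simp only [e2]
    rw [h3, h2, ← mul_assoc, ← ENNReal.ofReal_mul (by norm_num)]
    norm_num
  rw [lintegral_cons hF]
  have e1 : ∀ a, ∫⁻ v : Fin (k + 1) → ℝ, F (Fin.cons a v) =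
      ∫⁻ y : Fin k → ℝ, ∫⁻ b, F (Fin.cons a (Fin.cons b y)) := by
    intro a
    have hma : Measurable fun v : Fin (k + 1) → ℝ => F (Fin.cons a v) :=
      hF.comp (measurable_cons.comp (measurable_const.prodMk measurable_id))
    rw [lintegral_cons hma]
    refine lintegral_lintegral_swap ?_
    exact (hFm.comp (measurable_const.prodMk measurable_id)).aemeasurable
  simp only [e1]
  rw [lintegral_lintegral_swap]
  · have e2 : ∀ y : Fin k → ℝ, ∫⁻ a, ∫⁻ b, F (Fin.cons a (Fin.cons b y)) =
        ENNReal.ofReal (1 / 2) * ∫⁻ p, ∫⁻ q, F (lightVec p q y) := fun y =>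
      hplane (fun a b => F (Fin.cons a (Fin.cons b y)))
        (hFm.comp (measurable_fst.prodMk (measurable_snd.prodMk measurable_const)))
    simp only [e2]
    rw [lintegral_const_mul' _ _ ENNReal.ofReal_ne_top, lintegral_lintegral_swap]
    refine Measurable.aemeasurable ?_
    refine Measurable.lintegral_prod_right' (f := fun x : ((Fin k → ℝ) × ℝ) × ℝ =>
      F (lightVec x.1.2 x.2 x.1.1)) ?_
    exact hFm.comp (g := fun x : ℝ × ℝ × (Fin k → ℝ) => F (Fin.cons x.1 (Fin.cons x.2.1 x.2.2)))
      (f := fun x : ((Fin k → ℝ) × ℝ) × ℝ => ((x.1.2 + x.2) / 2, (x.2 - x.1.2) / 2, x.1.1))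
      (by fun_prop)
  · refine Measurable.aemeasurable ?_
    refine Measurable.lintegral_prod_right' (f := fun x : (ℝ × (Fin k → ℝ)) × ℝ =>
      F (Fin.cons x.1.1 (Fin.cons x.2 x.1.2))) ?_
    exact hFm.comp (g := fun x : ℝ × ℝ × (Fin k → ℝ) => F (Fin.cons x.1 (Fin.cons x.2.1 x.2.2)))
      (f := fun x : (ℝ × (Fin k → ℝ)) × ℝ => (x.1.1, x.2, x.1.2)) (by fun_prop)

theorem exists_lightVec_eq (x : Fin (k + 2) → ℝ) : ∃ p q y, lightVec p q y = x := by
  refine ⟨x 0 - x 1, x 0 + x 1, fun i => x i.succ.succ, ?_⟩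
  ext i
  refine Fin.cases ?_ (fun j => ?_) i
  · simp [lightVec]
  · refine Fin.cases ?_ (fun l => ?_) j
    · simp [lightVec]
    · simp [lightVec]

theorem lorentz_lightVec (a b p q : ℝ) (c y : Fin k → ℝ) :
    2 * lorentz (lightVec a b c) (lightVec p q y) = a * q + b * p - 2 * ∑ i, c i * y i := by
  simp only [lorentz, lightVec, Fin.sum_univ_succ, Fin.cons_zero, Fin.cons_succ]
  ring

theorem stdForm_lightVec (p q : ℝ) (y : Fin k → ℝ) :
    stdForm 1 (lightVec p q y) = p * q - ∑ i, y i ^ 2 := by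
  have h := lorentz_lightVec p q p q y y
  rw [lorentz_self] at h
  have : ∀ i, y i * y i = y i ^ 2 := fun i => by ring
  simp only [this] at h
  linarith

theorem lightVec_mem_cone_iff (p q : ℝ) (y : Fin k → ℝ) :
    lightVec p q y ∈ cone (k + 2) ↔ 0 < p ∧ (∑ i, y i ^ 2) / p < q := by
  rw [mem_cone_iff, stdForm_lightVec]
  have h0 : lightVec p q y 0 = (p + q) / 2 := by simp [lightVec]
  rw [h0]
  have hn : 0 ≤ ∑ i, y i ^ 2 := by positivity
  constructor
  · rintro ⟨h1, h2⟩
    have hp : 0 < p := by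
      by_contra hp
      have hq : 0 < q := by linarith [not_lt.1 hp]
      nlinarith [not_lt.1 hp]
    exact ⟨hp, by rw [div_lt_iff₀ hp]; linarith⟩
  · rintro ⟨hp, h⟩
    rw [div_lt_iff₀ hp] at h
    refine ⟨by linarith, ?_⟩
    have : 0 < q := by
      by_contra hq
      nlinarith [not_lt.1 hq]
    positivity

end LightCone

/-! ### Integrals over the cone and over the fibres of the tube domain -/

section ConeIntegrals

variable {k : ℕ}

/-- The Gamma factor of the Laplace transform of a power of the quadratic form on the cone. -/
def coneGamma (k : ℕ) (κ : ℝ) : ℝ :=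
  Real.pi ^ ((k : ℝ) / 2) * Real.Gamma (κ + 1) * Real.Gamma (κ + 1 + (k : ℝ) / 2)

/-- The constant in the integral of a power of `‖Q(ξ + i η)‖` over `ξ`. -/
def fibreConst (k : ℕ) (lam : ℝ) : ℝ :=
  Real.pi ^ (1 + (k : ℝ) / 2) * Real.Gamma (lam - 1 / 2) * Real.Gamma (2 * lam - 1 - (k : ℝ) / 2) *
    Real.Gamma (lam - (k : ℝ) / 2 - 1 / 2) /
    (Real.Gamma lam * Real.Gamma (2 * lam - 1) * Real.Gamma (lam - (k : ℝ) / 2))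

theorem isOpen_cone (d : ℕ) : IsOpen (cone d) := by
  have : cone d = (fun η : Fin d → ℝ => fun i => (η i : ℂ) * I) ⁻¹' tube d := by
    ext η
    have h : imPart (fun i => (η i : ℂ) * I) = η := by ext i; simp [imPart]
    simp [tube, h]
  rw [this]
  exact (isOpen_tube d).preimage (by fun_prop)

theorem lintegral_laplace_fibre {p a b S t κ : ℝ} (hp : 0 < p) (ha : 0 < a) (hκ : -1 < κ) :
    ∫⁻ q, (Set.Ioi (S / p)).indicator
        (fun q => ENNReal.ofReal ((p * q - S) ^ κ * Real.exp (-(a * q + b * p - 2 * t)))) q =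
      ENNReal.ofReal (p ^ κ * (a ^ (-(κ + 1)) * Real.Gamma (κ + 1)) *
        Real.exp (-(a * S / p) - b * p + 2 * t)) := by
  rw [← lintegral_add_right_eq_self _ (S / p)]
  have e : ∀ q, (Set.Ioi (S / p)).indicator
        (fun q => ENNReal.ofReal ((p * q - S) ^ κ * Real.exp (-(a * q + b * p - 2 * t)))) (q + S / p) =
      ENNReal.ofReal (p ^ κ * Real.exp (-(a * S / p) - b * p + 2 * t)) *
      (Set.Ioi (0 : ℝ)).indicator
        (fun q => ENNReal.ofReal (q ^ (κ + 1 - 1) * Real.exp (-(a * q)))) q := by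
    intro q
    by_cases hq : 0 < q
    · rw [Set.indicator_of_mem (by simpa using hq), Set.indicator_of_mem (by simpa using hq),
        ← ENNReal.ofReal_mul (by positivity)]
      congr 1
      have h1 : p * (q + S / p) - S = p * q := by field_simp; ring
      rw [h1, Real.mul_rpow hp.le hq.le, add_sub_cancel_right]
      have h2 : Real.exp (-(a * (q + S / p) + b * p - 2 * t)) =
          Real.exp (-(a * S / p) - b * p + 2 * t) * Real.exp (-(a * q)) := by
        rw [← Real.exp_add]; congr 1; ring
      rw [h2]; ring
    · rw [Set.indicator_of_notMem (by simpa using hq), Set.indicator_of_notMem (by simpa using hq),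
        mul_zero]
  simp only [e]
  rw [lintegral_const_mul' _ _ ENNReal.ofReal_ne_top, lintegral_indicator measurableSet_Ioi,
    lintegral_rpow_mul_exp_neg (by linarith) ha, ← ENNReal.ofReal_mul (by positivity)]
  congr 1; ring

theorem setLIntegral_cone_laplace {κ : ℝ} (hκ : -1 < κ) {η : Fin (k + 2) → ℝ}
    (hη : η ∈ cone (k + 2)) :
    ∫⁻ x in cone (k + 2), ENNReal.ofReal (stdForm 1 x ^ κ * Real.exp (-(2 * lorentz η x))) =
      ENNReal.ofReal (1 / 2 * coneGamma k κ * stdForm 1 η ^ (-(κ + 1 + (k : ℝ) / 2))) := by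
  obtain ⟨a, b, c, rfl⟩ := exists_lightVec_eq η
  obtain ⟨ha, hb⟩ := (lightVec_mem_cone_iff a b c).1 hη
  set B := b - (∑ i, c i ^ 2) / a with hB
  have hB0 : 0 < B := sub_pos.2 hb
  have hcont : Continuous fun x : Fin (k + 2) → ℝ => lorentz (lightVec a b c) x := by
    unfold lorentz; fun_prop
  have hmeas : Measurable fun x : Fin (k + 2) → ℝ =>
      ENNReal.ofReal (stdForm 1 x ^ κ * Real.exp (-(2 * lorentz (lightVec a b c) x))) := by
    have := (continuous_stdForm (d := k + 2) 1).measurable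
    have := hcont.measurable
    fun_prop
  rw [← lintegral_indicator (isOpen_cone _).measurableSet,
    lintegral_lightVec (hmeas.indicator (isOpen_cone _).measurableSet)]
  set A : ℝ := Real.Gamma (κ + 1) * a ^ (-(κ + 1)) * (Real.pi / a) ^ ((k : ℝ) / 2) with hA
  have hΓ : 0 < Real.Gamma (κ + 1) := Real.Gamma_pos_of_pos (by linarith)
  have hp : ∀ p : ℝ, ∫⁻ y : Fin k → ℝ, ∫⁻ q, (cone (k + 2)).indicator (fun x =>
      ENNReal.ofReal (stdForm 1 x ^ κ * Real.exp (-(2 * lorentz (lightVec a b c) x))))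
        (lightVec p q y) = (Set.Ioi (0 : ℝ)).indicator (fun p => ENNReal.ofReal A *
          ENNReal.ofReal (p ^ (κ + 1 + (k : ℝ) / 2 - 1) * Real.exp (-(B * p)))) p := by
    intro p
    by_cases hp : 0 < p
    · rw [Set.indicator_of_mem (by simpa using hp)]
      have e1 : ∀ (y : Fin k → ℝ) (q : ℝ), (cone (k + 2)).indicator (fun x =>
          ENNReal.ofReal (stdForm 1 x ^ κ * Real.exp (-(2 * lorentz (lightVec a b c) x))))
          (lightVec p q y) = (Set.Ioi ((∑ i, y i ^ 2) / p)).indicator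
            (fun q => ENNReal.ofReal ((p * q - ∑ i, y i ^ 2) ^ κ *
              Real.exp (-(a * q + b * p - 2 * ∑ i, c i * y i)))) q := by
        intro y q
        by_cases hq : (∑ i, y i ^ 2) / p < q
        · rw [Set.indicator_of_mem ((lightVec_mem_cone_iff p q y).2 ⟨hp, hq⟩),
            Set.indicator_of_mem (by exact hq), stdForm_lightVec, lorentz_lightVec]
        · rw [Set.indicator_of_notMem (by rw [lightVec_mem_cone_iff]; exact fun h => hq h.2),
            Set.indicator_of_notMem (by exact hq)]
      simp only [e1, lintegral_laplace_fibre hp ha hκ]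
      have e2 : ∀ y : Fin k → ℝ, ENNReal.ofReal (p ^ κ * (a ^ (-(κ + 1)) * Real.Gamma (κ + 1)) *
          Real.exp (-(a * (∑ i, y i ^ 2) / p) - b * p + 2 * ∑ i, c i * y i)) =
          ENNReal.ofReal (p ^ κ * (a ^ (-(κ + 1)) * Real.Gamma (κ + 1)) * Real.exp (-(b * p))) *
          ENNReal.ofReal (Real.exp (-(a / p) * ∑ i, y i ^ 2 + ∑ i, (2 * c i) * y i)) := by
        intro y
        rw [← ENNReal.ofReal_mul (by positivity), mul_assoc _ (Real.exp (-(b * p))),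
          ← Real.exp_add]
        congr 3
        simp only [mul_assoc, ← Finset.mul_sum]
        ring
      simp only [e2]
      rw [lintegral_const_mul' _ _ ENNReal.ofReal_ne_top,
        lintegral_gaussian_pi (div_pos ha hp) (fun i => 2 * c i),
        ← ENNReal.ofReal_mul (by positivity), ← ENNReal.ofReal_mul (by positivity)]
      congr 1
      have h1 : (Real.pi / (a / p)) ^ ((k : ℝ) / 2) =
          (Real.pi / a) ^ ((k : ℝ) / 2) * p ^ ((k : ℝ) / 2) := by
        rw [← Real.mul_rpow (by positivity) hp.le]; congr 1; field_simp
      have h2 : p ^ (κ + 1 + (k : ℝ) / 2 - 1) = p ^ κ * p ^ ((k : ℝ) / 2) := by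
        rw [← Real.rpow_add hp]; congr 1; ring
      have h3 : Real.exp (-(B * p)) = Real.exp (-(b * p)) *
          Real.exp ((∑ i, (2 * c i) ^ 2) / (4 * (a / p))) := by
        rw [← Real.exp_add]; congr 1
        simp only [mul_pow, ← Finset.mul_sum, hB]
        field_simp
        ring
      rw [h1, h2, h3, hA]
      ring
    · rw [Set.indicator_of_notMem (by simpa using hp)]
      have : ∀ (y : Fin k → ℝ) (q : ℝ), (cone (k + 2)).indicator (fun x =>
          ENNReal.ofReal (stdForm 1 x ^ κ * Real.exp (-(2 * lorentz (lightVec a b c) x))))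
          (lightVec p q y) = 0 := fun y q =>
        Set.indicator_of_notMem (by rw [lightVec_mem_cone_iff]; exact fun h => hp h.1) _
      simp [this]
  simp only [hp]
  have hk0 : (0 : ℝ) ≤ (k : ℝ) / 2 := by positivity
  have hΓ2 : 0 < Real.Gamma (κ + 1 + (k : ℝ) / 2) := Real.Gamma_pos_of_pos (by linarith)
  rw [lintegral_indicator measurableSet_Ioi, lintegral_const_mul' _ _ ENNReal.ofReal_ne_top,
    lintegral_rpow_mul_exp_neg (by linarith) hB0, ← ENNReal.ofReal_mul (by positivity),
    ← ENNReal.ofReal_mul (by norm_num)]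
  congr 1
  have hQ : stdForm 1 (lightVec a b c) = a * B := by
    rw [stdForm_lightVec, hB]; field_simp
  have h4 : a ^ (-(κ + 1 + (k : ℝ) / 2)) = a ^ (-(κ + 1)) * a ^ (-((k : ℝ) / 2)) := by
    rw [← Real.rpow_add ha]; congr 1; ring
  rw [hQ, Real.mul_rpow ha.le hB0.le, h4, hA, coneGamma, Real.div_rpow Real.pi_pos.le ha.le,
    Real.rpow_neg ha.le ((k : ℝ) / 2), div_eq_mul_inv]
  ring

/-- Completing squares in light-cone coordinates. -/
theorem normSq_stdForm_lightVec {a : ℝ} (ha : 0 < a) (b p : ℝ) (c y : Fin k → ℝ) :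
    ∃ x : ℝ, ∀ r : ℝ,
      normSq (stdForm 1 (fun i => (lightVec p r y i : ℂ) + (lightVec a b c i : ℂ) * I)) =
        (a ^ 2 + p ^ 2) * ((b - (∑ i, c i ^ 2) / a + a / (a ^ 2 + p ^ 2) *
          ∑ i, (y i - c i * p / a) ^ 2) ^ 2 + (r - x) ^ 2) := by
  set Y := ∑ i, y i ^ 2 with hY
  set Z := ∑ i, c i * y i with hZ
  set C := ∑ i, c i ^ 2 with hC
  have hP : a ^ 2 + p ^ 2 ≠ 0 := by positivity
  refine ⟨((Y - C) * p + 2 * Z * a) / (a ^ 2 + p ^ 2), fun r => ?_⟩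
  have e1 : ∑ i, (y i - c i * p / a) ^ 2 = Y - 2 * (p / a) * Z + (p / a) ^ 2 * C := by
    rw [hY, hZ, hC, Finset.mul_sum, Finset.mul_sum, ← Finset.sum_sub_distrib,
      ← Finset.sum_add_distrib]
    refine Finset.sum_congr rfl fun i _ => ?_
    ring
  have e2 : stdForm 1 (fun i => (lightVec p r y i : ℂ) + (lightVec a b c i : ℂ) * I) =
      ((p * r - a * b - (Y - C) : ℝ) : ℂ) + ((p * b + a * r - 2 * Z : ℝ) : ℂ) * I := by
    have h3 : ∑ i, ((y i : ℂ) + (c i : ℂ) * I) ^ 2 = ((Y - C : ℝ) : ℂ) + ((2 * Z : ℝ) : ℂ) * I := by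
      rw [hY, hZ, hC]
      push_cast
      rw [← Finset.sum_sub_distrib, Finset.mul_sum, Finset.sum_mul, ← Finset.sum_add_distrib]
      refine Finset.sum_congr rfl fun i _ => ?_
      linear_combination (c i : ℂ) ^ 2 * I_sq
    rw [stdForm_one_eq, Fin.sum_univ_succ]
    simp only [lightVec, Fin.cons_zero, Fin.cons_succ]
    rw [h3]
    push_cast
    linear_combination (a * b : ℂ) * I_sq
  rw [e2, e1, Complex.normSq_add_mul_I]
  field_simp
  ring

theorem lintegral_norm_stdForm_rpow {lam : ℝ} (hlam : (k : ℝ) + 1 < lam) {η : Fin (k + 2) → ℝ}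
    (hη : η ∈ cone (k + 2)) :
    ∫⁻ ξ : Fin (k + 2) → ℝ,
        ENNReal.ofReal (‖stdForm 1 (fun i => (ξ i : ℂ) + (η i : ℂ) * I)‖ ^ (-(2 * lam))) =
      ENNReal.ofReal (1 / 2 * fibreConst k lam * stdForm 1 η ^ (1 + (k : ℝ) / 2 - 2 * lam)) := by
  obtain ⟨a, b, c, rfl⟩ := exists_lightVec_eq η
  obtain ⟨ha, hb⟩ := (lightVec_mem_cone_iff a b c).1 hη
  set B := b - (∑ i, c i ^ 2) / a with hB
  have hB0 : 0 < B := sub_pos.2 hb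
  have hk0 : (0 : ℝ) ≤ k := Nat.cast_nonneg k
  have hmeas : Measurable fun ξ : Fin (k + 2) → ℝ =>
      ENNReal.ofReal (‖stdForm 1 (fun i => (ξ i : ℂ) + (lightVec a b c i : ℂ) * I)‖ ^ (-(2 * lam))) := by
    have h : Continuous fun ξ : Fin (k + 2) → ℝ =>
        stdForm 1 (fun i => (ξ i : ℂ) + (lightVec a b c i : ℂ) * I) := by
      simp only [stdForm_one_eq]; fun_prop
    have := h.norm.measurable
    fun_prop
  rw [lintegral_lightVec hmeas]
  have hnorm : ∀ z : ℂ, ‖z‖ ^ (-(2 * lam)) = normSq z ^ (-lam) := by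
    intro z
    rw [Complex.normSq_eq_norm_sq, ← Real.rpow_natCast, ← Real.rpow_mul (norm_nonneg z)]
    congr 1; push_cast; ring
  have hΓ : ∀ x : ℝ, 0 < x → 0 < Real.Gamma x := fun x hx => Real.Gamma_pos_of_pos hx
  have g1 := hΓ (lam - 1 / 2) (by linarith)
  have g2 := hΓ lam (by linarith)
  have g3 := hΓ (2 * lam - 1 - (k : ℝ) / 2) (by linarith)
  have g4 := hΓ (2 * lam - 1) (by linarith)
  set c1 := Real.sqrt Real.pi * Real.Gamma (lam - 1 / 2) / Real.Gamma lam with hc1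
  set c2 := B ^ ((k : ℝ) / 2 - (2 * lam - 1)) * Real.Gamma (2 * lam - 1 - (k : ℝ) / 2) /
    Real.Gamma (2 * lam - 1) with hc2
  have hc10 : 0 < c1 := by positivity
  have hc20 : 0 < c2 := by positivity
  have hpy : ∀ p : ℝ, ∫⁻ y : Fin k → ℝ, ∫⁻ r, ENNReal.ofReal
      (‖stdForm 1 (fun i => (lightVec p r y i : ℂ) + (lightVec a b c i : ℂ) * I)‖ ^ (-(2 * lam))) =
      ENNReal.ofReal (c1 * c2 * (Real.pi / a) ^ ((k : ℝ) / 2)) *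
        ENNReal.ofReal ((a ^ 2 + (p - 0) ^ 2) ^ (-(lam - (k : ℝ) / 2))) := by
    intro p
    have hP : 0 < a ^ 2 + p ^ 2 := by positivity
    have hr : ∀ y : Fin k → ℝ, ∫⁻ r, ENNReal.ofReal
        (‖stdForm 1 (fun i => (lightVec p r y i : ℂ) + (lightVec a b c i : ℂ) * I)‖ ^ (-(2 * lam))) =
        ENNReal.ofReal ((a ^ 2 + p ^ 2) ^ (-lam) * c1) * ENNReal.ofReal ((B + a / (a ^ 2 + p ^ 2) *
          ∑ i, (y i - c i * p / a) ^ 2) ^ (-(2 * lam - 1))) := by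
      intro y
      obtain ⟨x, hx⟩ := normSq_stdForm_lightVec ha b p c y
      set β := B + a / (a ^ 2 + p ^ 2) * ∑ i, (y i - c i * p / a) ^ 2 with hβ
      have hβ0 : 0 < β := by positivity
      have e : ∀ r, ENNReal.ofReal (‖stdForm 1 (fun i => (lightVec p r y i : ℂ) +
          (lightVec a b c i : ℂ) * I)‖ ^ (-(2 * lam))) = ENNReal.ofReal ((a ^ 2 + p ^ 2) ^ (-lam)) *
            ENNReal.ofReal ((β ^ 2 + (r - x) ^ 2) ^ (-lam)) := by
        intro r
        rw [hnorm, hx, Real.mul_rpow hP.le (by positivity), ENNReal.ofReal_mul (by positivity)]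
      simp only [e]
      rw [lintegral_const_mul' _ _ ENNReal.ofReal_ne_top,
        lintegral_add_sq_rpow_neg (by positivity) (by linarith) x,
        ← ENNReal.ofReal_mul (by positivity), ← ENNReal.ofReal_mul (by positivity)]
      congr 1
      have : (β ^ 2) ^ (1 / 2 - lam) = β ^ (-(2 * lam - 1)) := by
        rw [← Real.rpow_natCast, ← Real.rpow_mul hβ0.le]; congr 1; push_cast; ring
      rw [this, hc1]
      ring
    simp only [hr]
    rw [lintegral_const_mul' _ _ ENNReal.ofReal_ne_top,
      lintegral_add_sum_sq_rpow_neg (div_pos ha hP) hB0 (by linarith) (by linarith)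
        (fun i => c i * p / a),
      ← ENNReal.ofReal_mul (by positivity), ← ENNReal.ofReal_mul (by positivity)]
    congr 1
    have h1 : (Real.pi / (a / (a ^ 2 + p ^ 2))) ^ ((k : ℝ) / 2) =
        (Real.pi / a) ^ ((k : ℝ) / 2) * (a ^ 2 + p ^ 2) ^ ((k : ℝ) / 2) := by
      rw [← Real.mul_rpow (by positivity) hP.le]; congr 1; field_simp
    have h2 : (a ^ 2 + (p - 0) ^ 2) ^ (-(lam - (k : ℝ) / 2)) =
        (a ^ 2 + p ^ 2) ^ (-lam) * (a ^ 2 + p ^ 2) ^ ((k : ℝ) / 2) := by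
      rw [sub_zero, ← Real.rpow_add hP]; congr 1; ring
    rw [h1, h2, hc2]
    ring
  simp only [hpy]
  have g5 := hΓ (lam - (k : ℝ) / 2) (by linarith)
  have g6 := hΓ (lam - (k : ℝ) / 2 - 1 / 2) (by linarith)
  rw [lintegral_const_mul' _ _ ENNReal.ofReal_ne_top,
    lintegral_add_sq_rpow_neg (by positivity) (by linarith) 0,
    ← ENNReal.ofReal_mul (by positivity), ← ENNReal.ofReal_mul (by norm_num)]
  congr 1
  have hQ : stdForm 1 (lightVec a b c) = a * B := by
    rw [stdForm_lightVec, hB]; field_simp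
  have h1 : (a ^ 2) ^ (1 / 2 - (lam - (k : ℝ) / 2)) = a ^ (1 + (k : ℝ) / 2 - 2 * lam) *
      a ^ ((k : ℝ) / 2) := by
    rw [← Real.rpow_natCast, ← Real.rpow_mul ha.le, ← Real.rpow_add ha]; congr 1; push_cast; ring
  have h2 : Real.pi ^ (1 + (k : ℝ) / 2) = Real.sqrt Real.pi * Real.sqrt Real.pi *
      Real.pi ^ ((k : ℝ) / 2) := by
    rw [Real.mul_self_sqrt Real.pi_pos.le, Real.rpow_add Real.pi_pos, Real.rpow_one]
  have h3 : (k : ℝ) / 2 - (2 * lam - 1) = 1 + (k : ℝ) / 2 - 2 * lam := by ring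
  have h4 : (Real.pi / a) ^ ((k : ℝ) / 2) * a ^ ((k : ℝ) / 2) = Real.pi ^ ((k : ℝ) / 2) := by
    rw [← Real.mul_rpow (by positivity) ha.le]; congr 1; field_simp
  rw [hQ, Real.mul_rpow ha.le hB0.le, h1, fibreConst, hc1, hc2, h3, h2, ← h4]
  field_simp

end ConeIntegrals

/-! ### The normalization of the reproducing kernel -/

section KernelNorm

variable {k : ℕ}

theorem coneGamma_pos {κ : ℝ} (hκ : -1 < κ) : 0 < coneGamma k κ := by
  have hk0 : (0 : ℝ) ≤ k := Nat.cast_nonneg k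
  have h1 : 0 < Real.Gamma (κ + 1) := Real.Gamma_pos_of_pos (by linarith)
  have h2 : 0 < Real.Gamma (κ + 1 + (k : ℝ) / 2) := Real.Gamma_pos_of_pos (by linarith)
  rw [coneGamma]; positivity

theorem fibreConst_pos {lam : ℝ} (hlam : (k : ℝ) + 1 < lam) : 0 < fibreConst k lam := by
  have hk0 : (0 : ℝ) ≤ k := Nat.cast_nonneg k
  have h : ∀ x : ℝ, 0 < x → 0 < Real.Gamma x := fun x hx => Real.Gamma_pos_of_pos hx
  have := h (lam - 1 / 2) (by linarith)
  have := h lam (by linarith)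
  have := h (2 * lam - 1 - (k : ℝ) / 2) (by linarith)
  have := h (2 * lam - 1) (by linarith)
  have := h (lam - (k : ℝ) / 2) (by linarith)
  have := h (lam - (k : ℝ) / 2 - 1 / 2) (by linarith)
  rw [fibreConst]; positivity

theorem measurable_stdForm (p : ℕ) {d : ℕ} : Measurable (stdForm p : (Fin d → ℝ) → ℝ) :=
  (continuous_stdForm p).measurable

theorem setLIntegral_cone_beta {lam : ℝ} (hlam : (k : ℝ) + 1 < lam) :
    ∫⁻ η in cone (k + 2), ENNReal.ofReal (stdForm 1 η ^ (lam - ((k + 2 : ℕ) : ℝ))) *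
      ENNReal.ofReal (stdForm 1 (η + Pi.single 0 1) ^ (1 + (k : ℝ) / 2 - 2 * lam)) =
    ENNReal.ofReal (1 / 2 * coneGamma k (lam - ((k + 2 : ℕ) : ℝ)) *
      coneGamma k (lam - 1 - (k : ℝ) / 2) / coneGamma k (2 * lam - ((k + 2 : ℕ) : ℝ))) := by
  have hk0 : (0 : ℝ) ≤ k := Nat.cast_nonneg k
  set d : ℝ := ((k + 2 : ℕ) : ℝ) with hd
  have hd' : d = k + 2 := by rw [hd]; push_cast; ring
  set e : Fin (k + 2) → ℝ := Pi.single 0 1 with he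
  have hγ0 := coneGamma_pos (k := k) (κ := 2 * lam - d) (by linarith)
  have hγ1 := coneGamma_pos (k := k) (κ := lam - d) (by linarith)
  have hγ2 := coneGamma_pos (k := k) (κ := lam - 1 - (k : ℝ) / 2) (by linarith)
  have hcm := (isOpen_cone (k + 2)).measurableSet
  have hlm : Measurable fun z : (Fin (k + 2) → ℝ) × (Fin (k + 2) → ℝ) => lorentz z.1 z.2 := by
    have : Continuous fun z : (Fin (k + 2) → ℝ) × (Fin (k + 2) → ℝ) => lorentz z.1 z.2 := by
      unfold lorentz; fun_prop
    exact this.measurable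
  have hQm := measurable_stdForm 1 (d := k + 2)
  have h1 : ∀ η ∈ cone (k + 2), ENNReal.ofReal (stdForm 1 η ^ (lam - d)) *
      ENNReal.ofReal (stdForm 1 (η + e) ^ (1 + (k : ℝ) / 2 - 2 * lam)) =
      ENNReal.ofReal (1 / 2 * coneGamma k (2 * lam - d))⁻¹ * ∫⁻ x in cone (k + 2),
        ENNReal.ofReal (stdForm 1 η ^ (lam - d)) * ENNReal.ofReal (stdForm 1 x ^ (2 * lam - d) *
          Real.exp (-(2 * lorentz (η + e) x))) := by
    intro η hη
    rw [lintegral_const_mul' _ _ ENNReal.ofReal_ne_top,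
      setLIntegral_cone_laplace (by linarith) (add_mem_cone hη single_mem_cone),
      mul_left_comm]
    congr 1
    rw [← ENNReal.ofReal_mul (by positivity)]
    congr 1
    have : -(2 * lam - d + 1 + (k : ℝ) / 2) = 1 + (k : ℝ) / 2 - 2 * lam := by rw [hd']; ring
    rw [this, he]
    field_simp
  rw [setLIntegral_congr_fun hcm h1, lintegral_const_mul' _ _ ENNReal.ofReal_ne_top,
    lintegral_lintegral_swap]
  · have h2 : ∀ x ∈ cone (k + 2), ∫⁻ η in cone (k + 2), ENNReal.ofReal (stdForm 1 η ^ (lam - d)) *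
        ENNReal.ofReal (stdForm 1 x ^ (2 * lam - d) * Real.exp (-(2 * lorentz (η + e) x))) =
        ENNReal.ofReal (1 / 2 * coneGamma k (lam - d)) *
          ENNReal.ofReal (stdForm 1 x ^ (lam - 1 - (k : ℝ) / 2) *
            Real.exp (-(2 * lorentz e x))) := by
      intro x hx
      have hx0 : 0 < stdForm 1 x := hx.1
      have h3 : ∀ η ∈ cone (k + 2), ENNReal.ofReal (stdForm 1 η ^ (lam - d)) *
          ENNReal.ofReal (stdForm 1 x ^ (2 * lam - d) * Real.exp (-(2 * lorentz (η + e) x))) =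
          ENNReal.ofReal (stdForm 1 x ^ (2 * lam - d) * Real.exp (-(2 * lorentz e x))) *
          ENNReal.ofReal (stdForm 1 η ^ (lam - d) * Real.exp (-(2 * lorentz x η))) := by
        intro η hη
        have hη0 : 0 < stdForm 1 η := hη.1
        rw [← ENNReal.ofReal_mul (by positivity), ← ENNReal.ofReal_mul (by positivity)]
        congr 1
        have : Real.exp (-(2 * lorentz (η + e) x)) =
            Real.exp (-(2 * lorentz e x)) * Real.exp (-(2 * lorentz x η)) := by
          rw [← Real.exp_add, lorentz_add_left, lorentz_comm η x]; congr 1; ring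
        rw [this]; ring
      rw [setLIntegral_congr_fun hcm h3, lintegral_const_mul' _ _ ENNReal.ofReal_ne_top,
        setLIntegral_cone_laplace (by linarith) hx, ← ENNReal.ofReal_mul (by positivity),
        ← ENNReal.ofReal_mul (by positivity)]
      congr 1
      have : stdForm 1 x ^ (lam - 1 - (k : ℝ) / 2) = stdForm 1 x ^ (2 * lam - d) *
          stdForm 1 x ^ (-(lam - d + 1 + (k : ℝ) / 2)) := by
        rw [← Real.rpow_add hx0]; congr 1; rw [hd']; ring
      rw [this]; ring
    rw [setLIntegral_congr_fun hcm h2, lintegral_const_mul' _ _ ENNReal.ofReal_ne_top,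
      setLIntegral_cone_laplace (by linarith) single_mem_cone,
      ← ENNReal.ofReal_mul (by positivity), ← ENNReal.ofReal_mul (by positivity)]
    congr 1
    have : stdForm 1 (Pi.single 0 1 : Fin (k + 2) → ℝ) = 1 := by simp [stdForm_one_eq]
    rw [this, Real.one_rpow]
    field_simp
  · refine Measurable.aemeasurable ?_
    have hlm' : Measurable fun z : (Fin (k + 2) → ℝ) × (Fin (k + 2) → ℝ) =>
        lorentz (z.1 + e) z.2 := hlm.comp (g := fun z => lorentz z.1 z.2)
          (f := fun z : (Fin (k + 2) → ℝ) × (Fin (k + 2) → ℝ) => (z.1 + e, z.2)) (by fun_prop)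
    have h4 : Measurable fun z : (Fin (k + 2) → ℝ) × (Fin (k + 2) → ℝ) => stdForm 1 z.1 :=
      hQm.comp measurable_fst
    have h5 : Measurable fun z : (Fin (k + 2) → ℝ) × (Fin (k + 2) → ℝ) => stdForm 1 z.2 :=
      hQm.comp measurable_snd
    simp only [Function.uncurry_def]
    fun_prop

theorem lintegral_re_im {d : ℕ} {F : (Fin d → ℂ) → ENNReal} (hF : Measurable F) :
    ∫⁻ ζ, F ζ = ∫⁻ η : Fin d → ℝ, ∫⁻ ξ : Fin d → ℝ, F fun i => (ξ i : ℂ) + (η i : ℂ) * I := by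
  have h1 := (volume_measurePreserving_arrowProdEquivProdArrow ℝ ℝ (Fin d)).symm
  have h2 := volume_preserving_pi
    (fun _ : Fin d => Complex.volume_preserving_equiv_real_prod.symm)
  have h3 := (h2.comp h1).lintegral_comp hF
  rw [← h3]
  have e : ∀ z : (Fin d → ℝ) × (Fin d → ℝ),
      ((fun (a : Fin d → ℝ × ℝ) (i : Fin d) => Complex.measurableEquivRealProd.symm (a i)) ∘
        (MeasurableEquiv.arrowProdEquivProdArrow ℝ ℝ (Fin d)).symm) z =
      fun i => (z.1 i : ℂ) + (z.2 i : ℂ) * I := by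
    intro z; ext i
    apply Complex.ext <;> simp [Complex.measurableEquivRealProd, MeasurableEquiv.arrowProdEquivProdArrow,
      Equiv.arrowProdEquivProdArrow]
  simp only [e]
  refine lintegral_prod_symm _ (Measurable.aemeasurable ?_)
  exact hF.comp (g := F) (f := fun z : (Fin d → ℝ) × (Fin d → ℝ) =>
    fun i => (z.1 i : ℂ) + (z.2 i : ℂ) * I) (by fun_prop)

/-- The square norm of the kernel function at the base point. -/
def kernelNormSq (k : ℕ) (lam : ℝ) : ℝ :=
  1 / 2 * fibreConst k lam * (1 / 2 * coneGamma k (lam - ((k + 2 : ℕ) : ℝ)) *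
      coneGamma k (lam - 1 - (k : ℝ) / 2) / coneGamma k (2 * lam - ((k + 2 : ℕ) : ℝ)))

theorem kernelNormSq_pos {lam : ℝ} (hlam : (k : ℝ) + 1 < lam) : 0 < kernelNormSq k lam := by
  have hk0 : (0 : ℝ) ≤ k := Nat.cast_nonneg k
  have h0 := fibreConst_pos hlam
  have h1 := coneGamma_pos (k := k) (κ := 2 * lam - ((k + 2 : ℕ) : ℝ)) (by push_cast; linarith)
  have h2 := coneGamma_pos (k := k) (κ := lam - ((k + 2 : ℕ) : ℝ)) (by push_cast; linarith)
  have h3 := coneGamma_pos (k := k) (κ := lam - 1 - (k : ℝ) / 2) (by linarith)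
  rw [kernelNormSq]; positivity

theorem continuous_stdForm_complex {d : ℕ} (p : ℕ) :
    Continuous (stdForm p : (Fin d → ℂ) → ℂ) := by
  unfold stdForm
  refine continuous_finsetSum _ fun i _ => ?_
  split_ifs <;> fun_prop

theorem lintegral_norm_kernel_sq {lam : ℝ} (hlam : (k : ℝ) + 1 < lam) :
    ∫⁻ ζ, ENNReal.ofReal (‖stdForm 1 (ζ - conjVec (Bergman.basePoint (k + 1)))‖ ^ (-(2 * lam)))
      ∂(bergmanMeasure (k + 2) lam) = ENNReal.ofReal (kernelNormSq k lam) := by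
  set w := Bergman.basePoint (k + 1) with hw
  have hQm := measurable_stdForm 1 (d := k + 2)
  have hcm := (isOpen_cone (k + 2)).measurableSet
  have hF1 : Measurable fun ζ : Fin (k + 2) → ℂ =>
      ENNReal.ofReal (‖stdForm 1 (ζ - conjVec w)‖ ^ (-(2 * lam))) := by
    have : Continuous fun ζ : Fin (k + 2) → ℂ => ‖stdForm 1 (ζ - conjVec w)‖ :=
      ((continuous_stdForm_complex 1).comp (continuous_id.sub continuous_const)).norm
    have := this.measurable
    fun_prop
  rw [bergmanMeasure, lintegral_withDensity_eq_lintegral_mul _ Bergman.measurable_weight hF1,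
    ← lintegral_indicator (isOpen_tube _).measurableSet,
    lintegral_re_im ((Bergman.measurable_weight.mul hF1).indicator (isOpen_tube _).measurableSet)]
  have him : ∀ ξ η : Fin (k + 2) → ℝ, imPart (fun i => (ξ i : ℂ) + (η i : ℂ) * I) = η := by
    intro ξ η; ext i; simp [imPart]
  have hsub : ∀ ξ η : Fin (k + 2) → ℝ, (fun i => (ξ i : ℂ) + (η i : ℂ) * I) - conjVec w =
      fun i => (ξ i : ℂ) + (((η + Pi.single 0 1 : Fin (k + 2) → ℝ) i : ℝ) : ℂ) * I := by
    intro ξ η; ext i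
    have : conjVec w i = -(((Pi.single 0 1 : Fin (k + 2) → ℝ) i : ℝ) : ℂ) * I := by
      by_cases h : i = 0
      · subst h; simp [hw, conjVec, Bergman.basePoint]
      · simp [hw, conjVec, Bergman.basePoint, h]
    simp only [Pi.sub_apply, this, Pi.add_apply, ofReal_add]
    ring
  have h1 : ∀ η : Fin (k + 2) → ℝ, ∫⁻ ξ : Fin (k + 2) → ℝ, (tube (k + 2)).indicator
      ((fun ζ : Fin (k + 2) → ℂ => ENNReal.ofReal (stdForm 1 (imPart ζ) ^
        (lam - ((k + 2 : ℕ) : ℝ)))) * fun ζ => ENNReal.ofReal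
          (‖stdForm 1 (ζ - conjVec w)‖ ^ (-(2 * lam)))) (fun i => (ξ i : ℂ) + (η i : ℂ) * I) =
      (cone (k + 2)).indicator (fun η => ENNReal.ofReal (1 / 2 * fibreConst k lam) *
        (ENNReal.ofReal (stdForm 1 η ^ (lam - ((k + 2 : ℕ) : ℝ))) *
          ENNReal.ofReal (stdForm 1 (η + Pi.single 0 1) ^ (1 + (k : ℝ) / 2 - 2 * lam)))) η := by
    intro η
    have hf := fibreConst_pos hlam
    by_cases hη : η ∈ cone (k + 2)
    · rw [Set.indicator_of_mem hη]
      have e : ∀ ξ : Fin (k + 2) → ℝ, (tube (k + 2)).indicator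
          ((fun ζ : Fin (k + 2) → ℂ => ENNReal.ofReal (stdForm 1 (imPart ζ) ^
            (lam - ((k + 2 : ℕ) : ℝ)))) * fun ζ => ENNReal.ofReal
              (‖stdForm 1 (ζ - conjVec w)‖ ^ (-(2 * lam)))) (fun i => (ξ i : ℂ) + (η i : ℂ) * I) =
          ENNReal.ofReal (stdForm 1 η ^ (lam - ((k + 2 : ℕ) : ℝ))) * ENNReal.ofReal
            (‖stdForm 1 (fun i => (ξ i : ℂ) + (((η + Pi.single 0 1 : Fin (k + 2) → ℝ) i : ℝ) : ℂ)
              * I)‖ ^ (-(2 * lam))) := by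
        intro ξ
        rw [Set.indicator_of_mem (by rw [tube, Set.mem_ofPred_eq, him]; exact hη), Pi.mul_apply,
          him, hsub]
      simp only [e]
      rw [lintegral_const_mul' _ _ ENNReal.ofReal_ne_top,
        lintegral_norm_stdForm_rpow hlam (add_mem_cone hη single_mem_cone),
        ENNReal.ofReal_mul (by positivity)]
      ring
    · rw [Set.indicator_of_notMem hη]
      have e : ∀ ξ : Fin (k + 2) → ℝ, (fun i => (ξ i : ℂ) + (η i : ℂ) * I) ∉ tube (k + 2) := by
        intro ξ; rw [tube, Set.mem_ofPred_eq, him]; exact hη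
      simp [e]
  simp only [h1]
  have hf := fibreConst_pos hlam
  rw [lintegral_indicator hcm, lintegral_const_mul' _ _ ENNReal.ofReal_ne_top,
    setLIntegral_cone_beta hlam, ← ENNReal.ofReal_mul (by positivity), kernelNormSq]

end KernelNorm

namespace Bergman

variable {k : ℕ} {lam : ℝ}

theorem norm_cpow_neg_stdForm_sq {z : Fin (k + 1) → ℂ} (hz : z ∈ tube (k + 1)) (s : ℝ) :
    ‖(-stdForm 1 z) ^ (-(s : ℂ))‖ ^ 2 = ‖stdForm 1 z‖ ^ (-(2 * s)) := by
  have hne : -stdForm 1 z ≠ 0 := slitPlane_ne_zero (neg_stdForm_mem_slitPlane hz)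
  have h := Complex.norm_cpow_real (-stdForm 1 z) (-s)
  rw [ofReal_neg] at h
  rw [h, norm_neg, ← Real.rpow_natCast, ← Real.rpow_mul (norm_nonneg _)]
  congr 1; push_cast; ring

/-- The constant of the reproducing kernel is the inverse of the square norm of the kernel
function. -/
theorem norm_kernelVec_basePoint (hlam : (k : ℝ) + 1 < lam) :
    4 ^ lam * ‖kernelVec lam (basePoint (k + 1))‖ ^ 2 = 4 ^ (-lam) / kernelNormSq k lam := by
  set w := basePoint (k + 1) with hw
  have hwt : w ∈ tube (k + 2) := basePoint_mem_tube
  set κ : (Fin (k + 2) → ℂ) → ℂ :=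
    (tube (k + 2)).indicator fun ζ => (-stdForm 1 (ζ - conjVec w)) ^ (-(lam : ℂ)) with hκ
  have hdiff : DifferentiableOn ℂ (fun ζ : Fin (k + 2) → ℂ =>
      (-stdForm 1 (ζ - conjVec w)) ^ (-(lam : ℂ))) (tube (k + 2)) := by
    intro ζ hζ
    refine (DifferentiableAt.cpow_const ?_ ?_).differentiableWithinAt
    · simp only [stdForm_one_eq, Pi.sub_apply]
      fun_prop
    · exact neg_stdForm_mem_slitPlane (sub_conjVec_mem_tube hζ hwt)
  have hdiff' : DifferentiableOn ℂ κ (tube (k + 2)) :=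
    hdiff.congr fun ζ hζ => Set.indicator_of_mem hζ _
  have hmeas : Measurable κ := by
    have hc : Continuous fun ζ : Fin (k + 2) → ℂ => -stdForm 1 (ζ - conjVec w) :=
      ((continuous_stdForm_complex 1).comp (continuous_id.sub continuous_const)).neg
    exact (hc.measurable.pow_const _).indicator (isOpen_tube _).measurableSet
  have hae : ∀ᵐ ζ ∂(bergmanMeasure (k + 2) lam), ζ ∈ tube (k + 2) :=
    (withDensity_absolutelyContinuous _ _).ae_le (ae_restrict_mem (isOpen_tube _).measurableSet)
  have hlint : ∫⁻ ζ, ENNReal.ofReal (‖κ ζ‖ ^ 2) ∂(bergmanMeasure (k + 2) lam) =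
      ENNReal.ofReal (kernelNormSq k lam) := by
    rw [← lintegral_norm_kernel_sq hlam]
    refine lintegral_congr_ae ?_
    filter_upwards [hae] with ζ hζ
    rw [hκ, Set.indicator_of_mem hζ, norm_cpow_neg_stdForm_sq (sub_conjVec_mem_tube hζ hwt)]
  have hM := kernelNormSq_pos hlam
  have hint : Integrable (fun ζ => ‖κ ζ‖ ^ 2) (bergmanMeasure (k + 2) lam) := by
    refine ⟨(hmeas.norm.pow_const 2).aestronglyMeasurable, ?_⟩
    rw [hasFiniteIntegral_iff_ofReal (.of_forall fun ζ => by positivity), hlint]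
    exact ENNReal.ofReal_lt_top
  have hmem : MemLp κ 2 (bergmanMeasure (k + 2) lam) :=
    (memLp_two_iff_integrable_sq_norm hmeas.aestronglyMeasurable).2 hint
  have hzero : ∀ ζ, ζ ∉ tube (k + 2) → κ ζ = 0 := fun ζ hζ => by
    rw [hκ]; exact Set.indicator_of_notMem hζ _
  have hval : ∀ ζ ∈ tube (k + 2), κ ζ = (-stdForm 1 (ζ - conjVec w)) ^ (-(lam : ℂ)) :=
    fun ζ hζ => by rw [hκ]; exact Set.indicator_of_mem hζ _
  let K : Bergman (k + 2) lam := ⟨κ, hdiff', hzero, hmem⟩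
  have hKn : ‖K‖ ^ 2 = kernelNormSq k lam := by
    rw [norm_sq_eq]
    have h := ofReal_integral_eq_lintegral_ofReal hint (.of_forall fun ζ => by positivity)
    rw [hlint] at h
    have h2 := (ENNReal.ofReal_eq_ofReal_iff (integral_nonneg fun ζ => by positivity) hM.le).1 h
    exact h2
  set c : ℝ := 4 ^ lam * ‖kernelVec lam w‖ ^ 2 with hc
  have hvec : kernelVec lam w = (c : ℂ) • K := by
    refine ext_on fun ζ hζ => ?_
    rw [kernelVec_eq_cpow lam hζ hwt, smul_apply]
    congr 1
    exact (hval ζ hζ).symm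
  have hin : ⟪kernelVec lam w, K⟫_ℂ = K w := inner_kernelVec w K
  have hKw : K w = ((4 ^ (-lam) : ℝ) : ℂ) := by
    have h1 : K w = (-stdForm 1 (w - conjVec w)) ^ (-(lam : ℂ)) := hval w hwt
    have h2 : stdForm 1 (imPart w) = 1 := by
      rw [hw, imPart_basePoint]; simp [stdForm_one_eq]
    rw [h1, neg_stdForm_sub_conjVec_self, h2, mul_one, ← ofReal_neg,
      ← ofReal_cpow (by norm_num)]
  rw [hvec, inner_smul_left, conj_ofReal, hKw, inner_self_eq_norm_sq_to_K] at hin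
  have h3 : c * ‖K‖ ^ 2 = 4 ^ (-lam) := Complex.ofReal_injective (by rw [← hin]; simp)
  rw [eq_div_iff hM.ne', ← hKn, h3]

end Bergman

/-! ### Pochhammer symbols and the constants -/

theorem poch_succ (x : ℝ) (k : ℕ) : poch x (k + 1) = poch x k * (x + k) :=
  ascPochhammer_succ_eval k x

theorem poch_zero (x : ℝ) : poch x 0 = 1 := by simp [poch]

theorem poch_pos {x : ℝ} (hx : 0 < x) (k : ℕ) : 0 < poch x k := ascPochhammer_pos k x hx

theorem poch_add (x : ℝ) (j k : ℕ) : poch x (j + k) = poch x j * poch (x + j) k := by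
  induction k with
  | zero => simp [poch_zero]
  | succ k ih => rw [← add_assoc, poch_succ, ih, poch_succ]; push_cast; ring

theorem Gamma_add_nat {x : ℝ} (hx : 0 < x) (k : ℕ) :
    Real.Gamma (x + k) = poch x k * Real.Gamma x := by
  induction k with
  | zero => simp [poch_zero]
  | succ k ih =>
    rw [poch_succ, Nat.cast_succ, ← add_assoc, Real.Gamma_add_one (by positivity), ih]; ring

/-- The constant of the reproducing kernel of the weighted Bergman space on `T_{Ω(n)}`. -/
def bergmanConst (n : ℕ) (lam : ℝ) : ℝ :=
  2 ^ (2 * lam - n - 1) * poch (lam - n + 1) (n - 1) * (2 * lam - n) / Real.pi ^ n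

theorem bergmanConst_pos {k : ℕ} {lam : ℝ} (hlam : (k : ℝ) + 1 < lam) :
    0 < bergmanConst (k + 2) lam := by
  have hk0 : (0 : ℝ) ≤ k := Nat.cast_nonneg k
  have h1 := poch_pos (x := lam - ((k + 2 : ℕ) : ℝ) + 1) (by push_cast; linarith) (k + 2 - 1)
  have h2 : 0 < 2 * lam - ((k + 2 : ℕ) : ℝ) := by push_cast; linarith
  rw [bergmanConst]; positivity

theorem div_kernelNormSq {k : ℕ} {lam : ℝ} (hlam : (k : ℝ) + 1 < lam) :
    4 ^ (-lam) / kernelNormSq k lam = bergmanConst (k + 2) lam := by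
  have hk0 : (0 : ℝ) ≤ k := Nat.cast_nonneg k
  have hG : ∀ x : ℝ, 0 < x → 0 < Real.Gamma x := fun x hx => Real.Gamma_pos_of_pos hx
  have g1 := hG (lam - k - 1) (by linarith)
  have g2 := hG (lam - k / 2 - 1) (by linarith)
  have g3 := hG (lam - k / 2) (by linarith)
  have g4 := hG lam (by linarith)
  have g5 := hG (2 * lam - k - 2) (by linarith)
  have g6 := hG (2 * lam - 1 - k / 2) (by linarith)
  have g7 := hG (lam - 1 / 2) (by linarith)
  have g8 := hG (lam - k / 2 - 1 / 2) (by linarith)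
  have g9 := hG (2 * lam - 1) (by linarith)
  have h1 : Real.Gamma (lam - 1 / 2) * Real.Gamma lam =
      Real.Gamma (2 * lam - 1) * 2 ^ (2 - 2 * lam) * Real.sqrt Real.pi := by
    have := Real.Gamma_mul_Gamma_add_half (lam - 1 / 2)
    rw [show lam - 1 / 2 + 1 / 2 = lam by ring, show 2 * (lam - 1 / 2) = 2 * lam - 1 by ring,
      show 1 - (2 * lam - 1) = 2 - 2 * lam by ring] at this
    exact this
  have h2 : Real.Gamma (lam - k / 2 - 1) * Real.Gamma (lam - k / 2 - 1 / 2) =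
      Real.Gamma (2 * lam - k - 2) * 2 ^ (3 + k - 2 * lam) * Real.sqrt Real.pi := by
    have := Real.Gamma_mul_Gamma_add_half (lam - k / 2 - 1)
    rw [show lam - k / 2 - 1 + 1 / 2 = lam - k / 2 - 1 / 2 by ring,
      show 2 * (lam - k / 2 - 1) = 2 * lam - k - 2 by ring,
      show 1 - (2 * lam - k - 2) = 3 + k - 2 * lam by ring] at this
    exact this
  have h3 : Real.Gamma (2 * lam - k - 1) = (2 * lam - k - 2) * Real.Gamma (2 * lam - k - 2) := by
    rw [← Real.Gamma_add_one (by linarith)]; congr 1; ring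
  have h4 : Real.Gamma lam = poch (lam - k - 1) (k + 1) * Real.Gamma (lam - k - 1) := by
    rw [← Gamma_add_nat (by linarith)]; congr 1; push_cast; ring
  have hp := poch_pos (x := lam - k - 1) (by linarith) (k + 1)
  have hpi := Real.pi_pos
  have h5 : kernelNormSq k lam = Real.pi ^ (k + 2) * 2 ^ (3 + k - 4 * lam) /
      (poch (lam - k - 1) (k + 1) * (2 * lam - k - 2)) := by
    have e1 : (Real.pi : ℝ) ^ (1 + (k : ℝ) / 2) * Real.pi ^ ((k : ℝ) / 2) *
        (Real.sqrt Real.pi * Real.sqrt Real.pi) = Real.pi ^ (k + 2) := by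
      rw [Real.mul_self_sqrt hpi.le, ← Real.rpow_add hpi]
      nth_rewrite 2 [← Real.rpow_one Real.pi]
      rw [← Real.rpow_add hpi, ← Real.rpow_natCast]
      congr 1; push_cast; ring
    have e2 : (2 : ℝ) ^ (2 - 2 * lam) * 2 ^ (3 + k - 2 * lam) = 4 * 2 ^ (3 + k - 4 * lam) := by
      rw [← Real.rpow_add two_pos, show (4 : ℝ) = 2 ^ (2 : ℝ) by norm_num,
        ← Real.rpow_add two_pos]
      congr 1; ring
    have s1 : Real.Gamma (lam - 1 / 2) = Real.Gamma (2 * lam - 1) * 2 ^ (2 - 2 * lam) *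
        Real.sqrt Real.pi / Real.Gamma lam := by rw [eq_div_iff g4.ne', h1]
    have s2 : Real.Gamma (lam - k / 2 - 1 / 2) = Real.Gamma (2 * lam - k - 2) *
        2 ^ (3 + k - 2 * lam) * Real.sqrt Real.pi / Real.Gamma (lam - k / 2 - 1) := by
      rw [eq_div_iff g2.ne', mul_comm, h2]
    rw [kernelNormSq, fibreConst, coneGamma, coneGamma, coneGamma]
    have a1 : lam - ((k + 2 : ℕ) : ℝ) + 1 = lam - k - 1 := by push_cast; ring
    have a2 : lam - k - 1 + (k : ℝ) / 2 = lam - k / 2 - 1 := by ring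
    have a3 : lam - 1 - (k : ℝ) / 2 + 1 = lam - k / 2 := by ring
    have a4 : lam - (k : ℝ) / 2 + k / 2 = lam := by ring
    have a5 : 2 * lam - ((k + 2 : ℕ) : ℝ) + 1 = 2 * lam - k - 1 := by push_cast; ring
    have a6 : 2 * lam - k - 1 + (k : ℝ) / 2 = 2 * lam - 1 - k / 2 := by ring
    rw [a1, a2, a3, a4, a5, a6, s1, s2, h3, ← e1]
    have hX : (2 : ℝ) ^ (3 + k - 4 * lam) = (2 : ℝ) ^ (2 - 2 * lam) * 2 ^ (3 + k - 2 * lam) / 4 := by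
      rw [e2]; ring
    rw [hX]
    have hs : 0 < Real.sqrt Real.pi := Real.sqrt_pos.2 hpi
    have ht : 0 < Real.pi ^ ((k : ℝ) / 2) := Real.rpow_pos_of_pos hpi _
    have h6 : 0 < 2 * lam - k - 2 := by linarith
    set X := (2 : ℝ) ^ (2 - 2 * lam)
    set Y := (2 : ℝ) ^ (3 + k - 2 * lam)
    set T := Real.pi ^ ((k : ℝ) / 2)
    set U := Real.pi ^ (1 + (k : ℝ) / 2)
    set S := Real.sqrt Real.pi
    set Γ1 := Real.Gamma (lam - k - 1)
    set Γ2 := Real.Gamma (lam - k / 2 - 1)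
    set Γ3 := Real.Gamma (lam - k / 2)
    set Γ4 := Real.Gamma lam with hΓ4
    set Γ5 := Real.Gamma (2 * lam - k - 2)
    set Γ6 := Real.Gamma (2 * lam - 1 - k / 2)
    set Γ9 := Real.Gamma (2 * lam - 1)
    rw [h4]
    field_simp
    ring
  rw [h5, bergmanConst]
  have h6 : 0 < 2 * lam - k - 2 := by linarith
  have e3 : (4 : ℝ) ^ (-lam) = 2 ^ (2 * lam - ((k + 2 : ℕ) : ℝ) - 1) * 2 ^ (3 + k - 4 * lam) := by
    rw [show (4 : ℝ) = 2 ^ (2 : ℝ) by norm_num, ← Real.rpow_mul two_pos.le,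
      ← Real.rpow_add two_pos]
    congr 1; push_cast; ring
  have h7 : (0 : ℝ) < 2 ^ (3 + k - 4 * lam) := by positivity
  rw [e3, show lam - ((k + 2 : ℕ) : ℝ) + 1 = lam - k - 1 by push_cast; ring,
    show k + 2 - 1 = k + 1 by omega, show 2 * lam - ((k + 2 : ℕ) : ℝ) = 2 * lam - k - 2 by
      push_cast; ring]
  field_simp

/-- The constant by which the Juhl operator multiplies powers of the quadratic form. -/
def juhlConst (l : ℕ) (lam α : ℝ) : ℝ := 2 ^ l * poch lam l * poch (2 * α) l / l.factorial

theorem juhlConst_pos (l : ℕ) {lam α : ℝ} (hlam : 0 < lam) (hα : 0 < α) :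
    0 < juhlConst l lam α := by
  have := poch_pos hlam l
  have := poch_pos (x := 2 * α) (by linarith) l
  rw [juhlConst]; positivity

theorem holoConst_mul_exp (m l : ℕ) (lam : ℝ) :
    holoConst (m + 1) l lam * exp (I * Real.pi * ((lam + l : ℝ) : ℂ)) =
      ((bergmanConst (m + 1) lam * juhlConst l lam (lam - m / 2) : ℝ) : ℂ) := by
  have e1 : I ^ (2 * (lam : ℂ) + 2 * l) = exp (I * Real.pi * ((lam + l : ℝ) : ℂ)) := by
    rw [cpow_def_of_ne_zero I_ne_zero, log_I]; congr 1; push_cast; ring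
  have e2 : (2 : ℝ) ^ (2 * lam - ((m + 1 : ℕ) : ℝ) + l - 1) =
      2 ^ (2 * lam - ((m + 1 : ℕ) : ℝ) - 1) * 2 ^ l := by
    rw [← Real.rpow_natCast, ← Real.rpow_add two_pos]; congr 1; ring
  have e3 : poch (lam - ((m + 1 : ℕ) : ℝ) + 1) (m + 1 + l - 1) =
      poch (lam - ((m + 1 : ℕ) : ℝ) + 1) m * poch lam l := by
    rw [show m + 1 + l - 1 = m + l by omega, poch_add]
    congr 2; push_cast; ring
  have e4 : poch (2 * lam - ((m + 1 : ℕ) : ℝ)) (l + 1) =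
      (2 * lam - ((m + 1 : ℕ) : ℝ)) * poch (2 * (lam - m / 2)) l := by
    rw [add_comm l 1, poch_add, poch_succ, poch_zero]
    push_cast
    rw [show 2 * lam - (m + 1) + 1 = 2 * (lam - (m : ℝ) / 2) by ring]; ring
  have hpi : (Real.pi : ℂ) ≠ 0 := ofReal_ne_zero.2 Real.pi_ne_zero
  rw [holoConst, e1, e2, e3, e4, bergmanConst, juhlConst, show m + 1 - 1 = m by omega]
  have hE := exp_ne_zero (I * Real.pi * ((lam + l : ℝ) : ℂ))
  have hl : (l.factorial : ℂ) ≠ 0 := Nat.cast_ne_zero.2 l.factorial_ne_zero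
  generalize exp (I * Real.pi * ((lam + l : ℝ) : ℂ)) = E at hE
  push_cast
  field_simp

namespace Bergman

variable {k : ℕ} {lam : ℝ}

theorem kernelVec_apply (hlam : (k : ℝ) + 1 < lam) {ζ w : Fin (k + 2) → ℂ} (hζ : ζ ∈ tube (k + 2))
    (hw : w ∈ tube (k + 2)) : kernelVec lam w ζ =
      (bergmanConst (k + 2) lam : ℂ) * (-stdForm 1 (ζ - conjVec w)) ^ (-(lam : ℂ)) := by
  rw [kernelVec_eq_cpow lam hζ hw, norm_kernelVec_basePoint hlam, div_kernelNormSq hlam]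

end Bergman

/-! ### The Gegenbauer recursion for commuting operators -/

section Gegenbauer

/-- The Gegenbauer coefficients, extended by zero. -/
def gegenbauerCoeff' (k l : ℕ) (α : ℝ) : ℝ := if 2 * k ≤ l then gegenbauerCoeff k l α else 0

theorem gegenbauerCoeff'_rec_zero {α : ℝ} (hα : 0 < α) (l : ℕ) :
    (l + 1) * gegenbauerCoeff' 0 (l + 1) α = 2 * (l + α) * gegenbauerCoeff' 0 l α := by
  have hG := Real.Gamma_pos_of_pos hα
  have h : Real.Gamma (α + (l + 1 : ℕ) - (0 : ℕ)) = (α + l) * Real.Gamma (α + l - (0 : ℕ)) := by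
    push_cast
    rw [sub_zero, sub_zero, ← add_assoc, Real.Gamma_add_one (by positivity)]
  simp only [gegenbauerCoeff', gegenbauerCoeff, h, mul_zero, Nat.zero_le, if_true, Nat.sub_zero,
    Nat.factorial_succ, pow_succ]
  push_cast
  have : (l.factorial : ℝ) ≠ 0 := Nat.cast_ne_zero.2 l.factorial_ne_zero
  field_simp
  ring

theorem gegenbauerCoeff'_rec_succ {α : ℝ} (hα : 0 < α) (k l : ℕ) :
    (l + 2) * gegenbauerCoeff' (k + 1) (l + 2) α =
      2 * (l + 1 + α) * gegenbauerCoeff' (k + 1) (l + 1) α -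
        (l + 2 * α) * gegenbauerCoeff' k l α := by
  have hG := Real.Gamma_pos_of_pos hα
  by_cases h0 : 2 * k ≤ l
  · have hkl : (k : ℝ) ≤ l := by exact_mod_cast (by omega : k ≤ l)
    have hg0 : 0 < Real.Gamma (α + l - k) := Real.Gamma_pos_of_pos (by linarith)
    have h : Real.Gamma (α + (l + 2 : ℕ) - (k + 1 : ℕ)) = (α + l - k) * Real.Gamma (α + l - k) := by
      rw [← Real.Gamma_add_one (by linarith : α + l - k ≠ 0)]
      congr 1; push_cast; ring
    have h' : Real.Gamma (α + (l + 1 : ℕ) - (k + 1 : ℕ)) = Real.Gamma (α + l - k) := by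
      congr 1; push_cast; ring
    have hk : (k.factorial : ℝ) ≠ 0 := Nat.cast_ne_zero.2 k.factorial_ne_zero
    have e1 : l + 2 - 2 * (k + 1) = l - 2 * k := by omega
    rcases h0.eq_or_lt with h1 | h1
    · have e2 : l - 2 * k = 0 := by omega
      rw [gegenbauerCoeff', gegenbauerCoeff', gegenbauerCoeff', if_pos (by omega),
        if_neg (by omega), if_pos h0, gegenbauerCoeff, gegenbauerCoeff, h, e1, e2]
      have : (l : ℝ) = 2 * k := by exact_mod_cast h1.symm
      simp only [Nat.factorial_succ, pow_succ]
      push_cast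
      rw [this]
      field_simp
      ring
    · obtain ⟨r, hr⟩ : ∃ r, l - 2 * k = r + 1 := ⟨l - 2 * k - 1, by omega⟩
      have e2 : l + 1 - 2 * (k + 1) = r := by omega
      have hl : (l : ℝ) = 2 * k + r + 1 := by exact_mod_cast (by omega : l = 2 * k + r + 1)
      rw [gegenbauerCoeff', gegenbauerCoeff', gegenbauerCoeff', if_pos (by omega),
        if_pos (by omega), if_pos h0, gegenbauerCoeff, gegenbauerCoeff, gegenbauerCoeff, h, h', e1,
        e2, hr]
      have hr' : (r.factorial : ℝ) ≠ 0 := Nat.cast_ne_zero.2 r.factorial_ne_zero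
      simp only [Nat.factorial_succ, pow_succ]
      generalize Real.Gamma (α + l - k) = G
      push_cast
      rw [hl]
      field_simp
      ring
  · rw [gegenbauerCoeff', gegenbauerCoeff', gegenbauerCoeff', if_neg (by omega),
      if_neg (by omega), if_neg h0]
    ring

variable {A : Type*} [Ring A] [Algebra ℂ A]

/-- The homogeneous Gegenbauer polynomial at a pair of elements of an algebra. -/
def gegenbauerOp (l : ℕ) (α : ℝ) (x y : A) : A :=
  ∑ k ∈ Finset.range (l / 2 + 1), (gegenbauerCoeff k l α : ℂ) • (x ^ (l - 2 * k) * y ^ k)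

theorem gegenbauerOp_eq {l N : ℕ} (hN : l / 2 + 1 ≤ N) (α : ℝ) (x y : A) :
    gegenbauerOp l α x y =
      ∑ k ∈ Finset.range N, (gegenbauerCoeff' k l α : ℂ) • (x ^ (l - 2 * k) * y ^ k) := by
  rw [gegenbauerOp, ← Finset.sum_subset (Finset.range_subset_range.2 hN)]
  · refine Finset.sum_congr rfl fun k hk => ?_
    rw [gegenbauerCoeff', if_pos]
    have := Finset.mem_range.1 hk
    omega
  · intro k _ hk
    rw [gegenbauerCoeff', if_neg]
    · simp
    · have := Finset.mem_range.not.1 hk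
      omega

theorem gegenbauerOp_zero {α : ℝ} (hα : 0 < α) (x y : A) : gegenbauerOp 0 α x y = 1 := by
  simp [gegenbauerOp, gegenbauerCoeff, (Real.Gamma_pos_of_pos hα).ne']

theorem gegenbauerOp_one {α : ℝ} (hα : 0 < α) (x y : A) :
    gegenbauerOp 1 α x y = ((2 * α : ℝ) : ℂ) • x := by
  have hG := (Real.Gamma_pos_of_pos hα).ne'
  have hc : gegenbauerCoeff 0 1 α = 2 * α := by
    simp [gegenbauerCoeff, Real.Gamma_add_one hα.ne']
    field_simp
  rw [gegenbauerOp, show 1 / 2 + 1 = 1 from rfl, Finset.sum_range_one, hc]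
  simp only [mul_zero, Nat.sub_zero, pow_one, pow_zero, mul_one]

theorem gegenbauerOp_rec {α : ℝ} (hα : 0 < α) {x y : A} (hxy : Commute x y) (l : ℕ) :
    ((l + 2 : ℝ) : ℂ) • gegenbauerOp (l + 2) α x y =
      ((2 * (l + 1 + α) : ℝ) : ℂ) • (x * gegenbauerOp (l + 1) α x y) -
        ((l + 2 * α : ℝ) : ℂ) • (y * gegenbauerOp l α x y) := by
  rw [gegenbauerOp_eq (N := l + 2 + 1) (by omega), gegenbauerOp_eq (N := l + 2 + 1) (by omega),
    gegenbauerOp_eq (N := l + 2) (by omega), Finset.sum_range_succ' _ (l + 2),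
    Finset.sum_range_succ' _ (l + 2)]
  rw [mul_add x, smul_add, smul_add, Finset.mul_sum, Finset.mul_sum, Finset.smul_sum,
    Finset.smul_sum, Finset.smul_sum, add_sub_right_comm, ← Finset.sum_sub_distrib]
  congr 1
  · refine Finset.sum_congr rfl fun k _ => ?_
    have e1 : l + 2 - 2 * (k + 1) = l - 2 * k := by omega
    have hy : y * (x ^ (l - 2 * k) * y ^ k) = x ^ (l - 2 * k) * y ^ (k + 1) := by
      rw [← mul_assoc, ← (hxy.pow_left _).eq, mul_assoc, pow_succ']
    have hx : ((gegenbauerCoeff' (k + 1) (l + 1) α : ℝ) : ℂ) •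
        (x * (x ^ (l + 1 - 2 * (k + 1)) * y ^ (k + 1))) =
        ((gegenbauerCoeff' (k + 1) (l + 1) α : ℝ) : ℂ) • (x ^ (l - 2 * k) * y ^ (k + 1)) := by
      by_cases h : 2 * (k + 1) ≤ l + 1
      · rw [← mul_assoc, ← pow_succ', show l + 1 - 2 * (k + 1) + 1 = l - 2 * k by omega]
      · simp [gegenbauerCoeff', h]
    rw [mul_smul_comm, mul_smul_comm, hx, hy, e1, smul_smul, smul_smul, smul_smul, ← sub_smul,
      ← ofReal_mul, ← ofReal_mul, ← ofReal_mul, ← ofReal_sub, gegenbauerCoeff'_rec_succ hα]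
  · rw [mul_smul_comm, smul_smul, smul_smul, ← mul_assoc, ← ofReal_mul, ← ofReal_mul]
    have h := gegenbauerCoeff'_rec_zero hα (l + 1)
    have h2 : (l + 2 : ℝ) * gegenbauerCoeff' 0 (l + 2) α =
        2 * (l + 1 + α) * gegenbauerCoeff' 0 (l + 1) α := by
      push_cast at h
      rw [← h]; ring
    rw [h2]
    simp only [mul_zero, Nat.sub_zero, ← pow_succ']

end Gegenbauer

/-! ### The operators on monomials

The pair `(j, i)` stands for the function `y_n ^ j (-Q(y)) ^ (-(s + i))`. -/

section Monomial

/-- The operator `∂/∂ζ_n` on monomials. -/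
def monoDeriv (s : ℂ) : ((ℕ × ℕ) →₀ ℂ) →ₗ[ℂ] ((ℕ × ℕ) →₀ ℂ) :=
  Finsupp.linearCombination ℂ fun p => (p.1 : ℂ) • Finsupp.single (p.1 - 1, p.2) (1 : ℂ) -
    (2 * (s + p.2)) • Finsupp.single (p.1 + 1, p.2 + 1) (1 : ℂ)

/-- The operator `Δ` on monomials, where `m` is the number of variables of `Δ`. -/
def monoLap (m : ℕ) (s : ℂ) : ((ℕ × ℕ) →₀ ℂ) →ₗ[ℂ] ((ℕ × ℕ) →₀ ℂ) :=
  Finsupp.linearCombination ℂ fun p =>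
    (2 * (s + p.2) * m - 4 * (s + p.2) * (s + p.2 + 1)) • Finsupp.single (p.1, p.2 + 1) (1 : ℂ) +
    (4 * (s + p.2) * (s + p.2 + 1)) • Finsupp.single (p.1 + 2, p.2 + 2) (1 : ℂ)

theorem monoDeriv_single (s : ℂ) (j i : ℕ) : monoDeriv s (Finsupp.single (j, i) 1) =
    (j : ℂ) • Finsupp.single (j - 1, i) (1 : ℂ) -
      (2 * (s + i)) • Finsupp.single (j + 1, i + 1) (1 : ℂ) := by
  simp [monoDeriv]

theorem monoLap_single (m : ℕ) (s : ℂ) (j i : ℕ) : monoLap m s (Finsupp.single (j, i) 1) =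
    (2 * (s + i) * m - 4 * (s + i) * (s + i + 1)) • Finsupp.single (j, i + 1) (1 : ℂ) +
    (4 * (s + i) * (s + i + 1)) • Finsupp.single (j + 2, i + 2) (1 : ℂ) := by
  simp only [monoLap, Finsupp.linearCombination_single, one_smul]

theorem commute_monoDeriv_monoLap (m : ℕ) (s : ℂ) : Commute (monoDeriv s) (monoLap m s) := by
  refine Finsupp.lhom_ext' fun p => LinearMap.ext_ring ?_
  obtain ⟨j, i⟩ := p
  simp only [LinearMap.comp_apply, Module.End.mul_apply, Finsupp.lsingle_apply, monoLap_single,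
    monoDeriv_single, map_add, map_sub, map_smul]
  rcases j with _ | j
  · simp only [Nat.cast_zero, zero_smul, zero_sub, smul_sub, smul_add, smul_neg, smul_smul]
    push_cast
    ext p
    simp only [Finsupp.add_apply, Finsupp.sub_apply, Finsupp.smul_apply, Finsupp.neg_apply,
      smul_eq_mul, Nat.add_assoc, Nat.reduceAdd]
    ring_nf
  · simp only [smul_sub, smul_add, smul_smul]
    push_cast
    ext p
    simp only [Finsupp.add_apply, Finsupp.sub_apply, Finsupp.smul_apply,
      smul_eq_mul, Nat.add_assoc, Nat.reduceAdd]
    ring_nf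

theorem gegenbauerOp_mono_single {m : ℕ} {lam α : ℝ} (hα : 0 < α) (h : α = lam - m / 2) (l : ℕ) :
    gegenbauerOp l α (monoDeriv lam) (monoLap m lam) (Finsupp.single (0, 0) 1) =
      (((-1) ^ l * juhlConst l lam α : ℝ) : ℂ) • Finsupp.single (l, l) (1 : ℂ) := by
  induction l using Nat.strong_induction_on with
  | _ l ih =>
    rcases l with _ | _ | l
    · rw [gegenbauerOp_zero hα]; simp [juhlConst, poch_zero]
    · rw [gegenbauerOp_one hα]
      rw [LinearMap.smul_apply, monoDeriv_single]
      ext p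
      simp only [juhlConst, poch_succ, poch_zero, Finsupp.sub_apply, Finsupp.smul_apply,
        smul_eq_mul, zero_add]
      generalize (Finsupp.single (1, 1) (1 : ℂ)) p = X
      simp
      ring
    · have h1 := congrArg (fun T : Module.End ℂ ((ℕ × ℕ) →₀ ℂ) => T (Finsupp.single (0, 0) 1))
        (gegenbauerOp_rec hα (commute_monoDeriv_monoLap m lam) l)
      simp only [LinearMap.sub_apply, LinearMap.smul_apply, Module.End.mul_apply,
        ih l (by omega), ih (l + 1) (by omega), map_smul, monoDeriv_single, monoLap_single] at h1
      have hl : ((l + 2 : ℝ) : ℂ) ≠ 0 := ofReal_ne_zero.2 (by positivity)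
      rw [← (smul_right_injective _ hl).eq_iff, h1]
      have hm : (m : ℝ) = 2 * (lam - α) := by rw [h]; ring
      have hm' : (m : ℂ) = 2 * (lam - α) := by exact_mod_cast congrArg (fun x : ℝ => (x : ℂ)) hm
      have hf : (l.factorial : ℂ) ≠ 0 := Nat.cast_ne_zero.2 l.factorial_ne_zero
      have hl1 : (l + 1 : ℂ) ≠ 0 := by exact_mod_cast l.succ_ne_zero
      have hl2 : (l + 2 : ℂ) ≠ 0 := by exact_mod_cast (l + 1).succ_ne_zero
      ext p
      simp only [Finsupp.add_apply, Finsupp.sub_apply, Finsupp.smul_apply, smul_eq_mul,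
        Nat.add_assoc, Nat.reduceAdd, Nat.add_sub_cancel, juhlConst, poch_succ,
        Nat.factorial_succ, pow_succ, hm']
      push_cast
      generalize (Finsupp.single (l, l + 1) (1 : ℂ)) p = X
      generalize (Finsupp.single (l + 2, l + 2) (1 : ℂ)) p = Y
      field_simp
      ring

/-- Combinations of monomials with exponent of `y_n` at least `t`. -/
abbrev monoGE (t : ℕ) : Submodule ℂ ((ℕ × ℕ) →₀ ℂ) := Finsupp.supported ℂ ℂ {p | t ≤ p.1}

theorem single_mem_monoGE {t j : ℕ} (h : t ≤ j) (i : ℕ) :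
    Finsupp.single (j, i) (1 : ℂ) ∈ monoGE t := Finsupp.single_mem_supported ℂ 1 h

theorem map_mem_monoGE {t t' : ℕ} {T : ((ℕ × ℕ) →₀ ℂ) →ₗ[ℂ] ((ℕ × ℕ) →₀ ℂ)}
    (hT : ∀ j i, t ≤ j → T (Finsupp.single (j, i) 1) ∈ monoGE t') {v : (ℕ × ℕ) →₀ ℂ}
    (hv : v ∈ monoGE t) : T v ∈ monoGE t' := by
  rw [monoGE, Finsupp.supported_eq_span_single] at hv
  induction hv using Submodule.span_induction with
  | mem x hx => obtain ⟨⟨j, i⟩, hp, rfl⟩ := hx; exact hT j i hp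
  | zero => simp
  | add x y _ _ hx hy => rw [map_add]; exact add_mem hx hy
  | smul c x _ hx => rw [map_smul]; exact Submodule.smul_mem _ c hx

theorem monoLap_mem {m : ℕ} {s : ℂ} {t : ℕ} {v : (ℕ × ℕ) →₀ ℂ} (hv : v ∈ monoGE t) :
    monoLap m s v ∈ monoGE t := by
  refine map_mem_monoGE (fun j i h => ?_) hv
  rw [monoLap_single]
  exact add_mem (Submodule.smul_mem _ _ (single_mem_monoGE h _))
    (Submodule.smul_mem _ _ (single_mem_monoGE (by omega) _))

theorem monoDeriv_mem {s : ℂ} {t : ℕ} {v : (ℕ × ℕ) →₀ ℂ} (hv : v ∈ monoGE (t + 1)) :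
    monoDeriv s v ∈ monoGE t := by
  refine map_mem_monoGE (fun j i h => ?_) hv
  rw [monoDeriv_single]
  exact sub_mem (Submodule.smul_mem _ _ (single_mem_monoGE (by omega) _))
    (Submodule.smul_mem _ _ (single_mem_monoGE (by omega) _))

theorem monoLap_pow_mem {m : ℕ} {s : ℂ} {t : ℕ} {v : (ℕ × ℕ) →₀ ℂ} (hv : v ∈ monoGE t) (r : ℕ) :
    (monoLap m s ^ r) v ∈ monoGE t := by
  induction r with
  | zero => simpa using hv
  | succ r ih => rw [pow_succ', Module.End.mul_apply]; exact monoLap_mem ih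

theorem monoDeriv_pow_mem {s : ℂ} {t : ℕ} (r : ℕ) {v : (ℕ × ℕ) →₀ ℂ} (hv : v ∈ monoGE (t + r)) :
    (monoDeriv s ^ r) v ∈ monoGE t := by
  induction r generalizing v with
  | zero => simpa using hv
  | succ r ih => rw [pow_succ, Module.End.mul_apply]; exact ih (monoDeriv_mem hv)

theorem monoDeriv_pow_single (s : ℂ) (l r i : ℕ) :
    (monoDeriv s ^ r) (Finsupp.single (l + r, i) 1) -
      (((l + r).descFactorial r : ℕ) : ℂ) • Finsupp.single (l, i) (1 : ℂ) ∈ monoGE (l + 1) := by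
  induction r generalizing l with
  | zero => simp
  | succ r ih =>
    have h1 := monoDeriv_mem (s := s) (ih (l + 1))
    rw [map_sub, map_smul, monoDeriv_single] at h1
    rw [pow_succ', Module.End.mul_apply, show l + (r + 1) = l + 1 + r by omega,
      Nat.descFactorial_succ, show l + 1 + r - r = l + 1 by omega]
    have h2 : ((((l + 1 + r).descFactorial r : ℕ) : ℂ) * (2 * (s + i))) •
        Finsupp.single (l + 1 + 1, i + 1) (1 : ℂ) ∈ monoGE (l + 1) :=
      Submodule.smul_mem _ _ (single_mem_monoGE (by omega) _)
    convert sub_mem h1 h2 using 1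
    rw [Nat.add_sub_cancel]
    simp only [smul_sub, smul_smul]
    push_cast
    rw [mul_comm (l + 1 : ℂ)]
    abel

theorem gegenbauerOp_mono_single_sub_mem {m : ℕ} {α : ℝ} (hα : 0 < α) (s : ℂ) (l : ℕ) :
    gegenbauerOp l α (monoDeriv s) (monoLap m s) (Finsupp.single (l, 0) 1) -
      ((2 ^ l * poch α l : ℝ) : ℂ) • Finsupp.single (0, 0) (1 : ℂ) ∈ monoGE 1 := by
  have h0 := monoDeriv_pow_single s 0 l 0
  rw [Nat.zero_add, Nat.zero_add, Nat.descFactorial_self] at h0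
  have h1 := Submodule.smul_mem _ (gegenbauerCoeff 0 l α : ℂ) h0
  have hc : gegenbauerCoeff 0 l α * l.factorial = 2 ^ l * poch α l := by
    have hG := (Real.Gamma_pos_of_pos hα).ne'
    have hf : (l.factorial : ℝ) ≠ 0 := Nat.cast_ne_zero.2 l.factorial_ne_zero
    rw [gegenbauerCoeff, Nat.cast_zero, sub_zero, Gamma_add_nat hα]
    simp
    field_simp
  rw [gegenbauerOp, Finset.sum_range_succ', LinearMap.add_apply]
  simp only [LinearMap.sum_apply, LinearMap.smul_apply, Module.End.mul_apply]
  rw [smul_sub, smul_smul, ← ofReal_natCast, ← ofReal_mul, hc] at h1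
  rw [add_sub_assoc]
  refine add_mem (sum_mem fun k hk => Submodule.smul_mem _ _ ?_) (by simpa using h1)
  have hk := Finset.mem_range.1 hk
  refine monoDeriv_pow_mem _ (monoLap_pow_mem (single_mem_monoGE ?_ _) _)
  omega

end Monomial

/-! ### The Juhl operator on powers of the quadratic form -/

section JuhlPower

variable {k : ℕ}

theorem partialDeriv_congr {d : ℕ} {f g : (Fin d → ℂ) → ℂ} (h : Set.EqOn f g (tube d)) (i : Fin d) :
    Set.EqOn (partialDeriv i f) (partialDeriv i g) (tube d) := fun ζ hζ => by
  rw [partialDeriv, partialDeriv, (h.eventuallyEq_of_mem ((isOpen_tube d).mem_nhds hζ)).fderiv_eq]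

theorem lorentzLaplacian_congr {m : ℕ} {f g : (Fin (m + 1) → ℂ) → ℂ}
    (h : Set.EqOn f g (tube (m + 1))) :
    Set.EqOn (lorentzLaplacian f) (lorentzLaplacian g) (tube (m + 1)) := fun ζ hζ => by
  refine Finset.sum_congr rfl fun i _ => ?_
  rw [partialDeriv_congr (partialDeriv_congr h _) _ hζ]

theorem hasFDerivAt_stdForm {d : ℕ} (z : Fin d → ℂ) :
    HasFDerivAt (stdForm 1 : (Fin d → ℂ) → ℂ)
      (∑ i : Fin d, (2 * (if (i : ℕ) < 1 then 1 else -1) * z i) •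
        (ContinuousLinearMap.proj i : (Fin d → ℂ) →L[ℂ] ℂ)) z := by
  unfold stdForm
  refine HasFDerivAt.fun_sum fun i _ => ?_
  have h := (hasFDerivAt_apply (𝕜 := ℂ) i z).pow 2
  split_ifs
  · exact h.congr_fderiv (ContinuousLinearMap.ext fun v => by simp)
  · exact h.neg.congr_fderiv (ContinuousLinearMap.ext fun v => by simp)

/-- The power `(-Q(w - a)) ^ (-s)`. -/
def shiftPow {d : ℕ} (a : Fin d → ℂ) (s : ℂ) (w : Fin d → ℂ) : ℂ := (-stdForm 1 (w - a)) ^ (-s)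

theorem hasFDerivAt_shiftPow {a w : Fin (k + 1) → ℂ} (h : w - a ∈ tube (k + 1)) (s : ℂ) :
    HasFDerivAt (shiftPow a s) ((s * shiftPow a (s + 1) w) •
      ∑ i : Fin (k + 1), (2 * (if (i : ℕ) < 1 then 1 else -1) * (w i - a i)) •
        (ContinuousLinearMap.proj i : (Fin (k + 1) → ℂ) →L[ℂ] ℂ)) w := by
  have h1 : HasFDerivAt (fun w : Fin (k + 1) → ℂ => -stdForm 1 (w - a)) _ w :=
    ((hasFDerivAt_stdForm (w - a)).comp w ((hasFDerivAt_id w).sub_const a)).neg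
  have h2 := (hasStrictDerivAt_cpow_const (c := -s)
    (neg_stdForm_mem_slitPlane h)).hasDerivAt.comp_hasFDerivAt w h1
  refine h2.congr_fderiv (ContinuousLinearMap.ext fun v => ?_)
  simp [shiftPow, show -(s + 1) = -s - 1 by ring, Finset.mul_sum]

theorem partialDeriv_mul_shiftPow {a w : Fin (k + 1) → ℂ} (hw : w - a ∈ tube (k + 1)) (s : ℂ)
    {h : (Fin (k + 1) → ℂ) → ℂ} (hh : DifferentiableAt ℂ h w) (i : Fin (k + 1)) :
    partialDeriv i (fun w => h w * shiftPow a s w) w = partialDeriv i h w * shiftPow a s w +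
      h w * (2 * s * (if (i : ℕ) < 1 then 1 else -1) * (w i - a i)) * shiftPow a (s + 1) w := by
  have h1 := hh.hasFDerivAt.fun_mul (hasFDerivAt_shiftPow hw s)
  rw [partialDeriv, partialDeriv, HasFDerivAt.fderiv h1]
  have h2 : (∑ r : Fin (k + 1), (2 * (if (r : ℕ) < 1 then 1 else -1) * (w r - a r)) •
      (ContinuousLinearMap.proj r : (Fin (k + 1) → ℂ) →L[ℂ] ℂ)) (Pi.single i 1) =
      2 * (if (i : ℕ) < 1 then 1 else -1) * (w i - a i) := by
    rw [sum_apply, Finset.sum_eq_single i]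
    · rw [smul_apply, ContinuousLinearMap.proj_apply, Pi.single_eq_same, smul_eq_mul, mul_one]
    · intro r _ hr
      rw [smul_apply, ContinuousLinearMap.proj_apply, Pi.single_eq_of_ne hr, smul_zero]
    · simp
  rw [add_apply, smul_apply, smul_apply, smul_apply, h2]
  simp only [smul_eq_mul]
  ring

/-- The function which belongs to a monomial. -/
def monoFun (a : Fin (k + 1) → ℂ) (s : ℂ) (p : ℕ × ℕ) (w : Fin (k + 1) → ℂ) : ℂ :=
  (w (Fin.last k) - a (Fin.last k)) ^ p.1 * shiftPow a (s + p.2) w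

/-- The function which belongs to a combination of monomials. -/
def monoEval (a : Fin (k + 1) → ℂ) (s : ℂ) : ((ℕ × ℕ) →₀ ℂ) →ₗ[ℂ] (Fin (k + 1) → ℂ) → ℂ :=
  Finsupp.linearCombination ℂ (monoFun a s)

theorem monoEval_single (a : Fin (k + 1) → ℂ) (s : ℂ) (p : ℕ × ℕ) :
    monoEval a s (Finsupp.single p 1) = monoFun a s p := by
  simp [monoEval]

variable {a : Fin (k + 1) → ℂ}

theorem differentiableAt_monoFun {w : Fin (k + 1) → ℂ} (hw : w - a ∈ tube (k + 1)) (s : ℂ)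
    (p : ℕ × ℕ) : DifferentiableAt ℂ (monoFun a s p) w :=
  DifferentiableAt.fun_mul (by fun_prop) (hasFDerivAt_shiftPow hw _).differentiableAt

theorem differentiableAt_monoEval {w : Fin (k + 1) → ℂ} (hw : w - a ∈ tube (k + 1)) (s : ℂ)
    (v : (ℕ × ℕ) →₀ ℂ) : DifferentiableAt ℂ (monoEval a s v) w := by
  induction v using Finsupp.induction_linear with
  | zero => simp
  | add u v hu hv => rw [map_add]; exact hu.add hv
  | single p c =>
    rw [← mul_one c, ← smul_eq_mul, ← Finsupp.smul_single, map_smul, monoEval_single]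
    exact (differentiableAt_monoFun hw s p).const_smul c

theorem partialDeriv_add {d : ℕ} (i : Fin d) (w : Fin d → ℂ) {f g : (Fin d → ℂ) → ℂ}
    (hf : DifferentiableAt ℂ f w) (hg : DifferentiableAt ℂ g w) :
    partialDeriv i (f + g) w = partialDeriv i f w + partialDeriv i g w := by
  rw [partialDeriv, fderiv_add hf hg]; rfl

theorem partialDeriv_smul {d : ℕ} (i : Fin d) (w : Fin d → ℂ) (c : ℂ) {f : (Fin d → ℂ) → ℂ}
    (hf : DifferentiableAt ℂ f w) : partialDeriv i (c • f) w = c * partialDeriv i f w := by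
  rw [partialDeriv, fderiv_const_smul hf]; rfl

theorem partialDeriv_last_monoFun {w : Fin (k + 1 + 1) → ℂ} {a : Fin (k + 1 + 1) → ℂ}
    (hw : w - a ∈ tube (k + 1 + 1)) (s : ℂ) (p : ℕ × ℕ) :
    partialDeriv (Fin.last (k + 1)) (monoFun a s p) w =
      p.1 * monoFun a s (p.1 - 1, p.2) w - 2 * (s + p.2) * monoFun a s (p.1 + 1, p.2 + 1) w := by
  obtain ⟨j, i⟩ := p
  have h1 := partialDeriv_mul_shiftPow hw (s + i)
    (h := fun w => (w (Fin.last (k + 1)) - a (Fin.last (k + 1))) ^ j) (by fun_prop)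
    (Fin.last (k + 1))
  have h2 : HasFDerivAt (fun w : Fin (k + 1 + 1) → ℂ =>
      (w (Fin.last (k + 1)) - a (Fin.last (k + 1))) ^ j) _ w :=
    ((hasFDerivAt_apply (𝕜 := ℂ) (Fin.last (k + 1)) w).sub_const _).pow j
  have h3 : partialDeriv (Fin.last (k + 1)) (fun w : Fin (k + 1 + 1) → ℂ =>
      (w (Fin.last (k + 1)) - a (Fin.last (k + 1))) ^ j) w =
      j * (w (Fin.last (k + 1)) - a (Fin.last (k + 1))) ^ (j - 1) := by
    rw [partialDeriv, h2.fderiv]; simp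
  rw [h3] at h1
  refine h1.trans ?_
  simp [monoFun, pow_succ, add_assoc]
  ring

theorem lorentzLaplacian_monoFun {w a : Fin (k + 1 + 1) → ℂ} (hsub : ∀ w ∈ tube (k + 1 + 1),
    w - a ∈ tube (k + 1 + 1)) (hw : w ∈ tube (k + 1 + 1)) (s : ℂ) (p : ℕ × ℕ) :
    lorentzLaplacian (monoFun a s p) w =
      (2 * (s + p.2) * (k + 1 : ℕ) - 4 * (s + p.2) * (s + p.2 + 1)) * monoFun a s (p.1, p.2 + 1) w +
        4 * (s + p.2) * (s + p.2 + 1) * monoFun a s (p.1 + 2, p.2 + 2) w := by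
  obtain ⟨j, r⟩ := p
  set N := Fin.last (k + 1)
  have hN : ∀ i : Fin (k + 1), N ≠ i.castSucc := fun i => (Fin.castSucc_lt_last i).ne'
  set σ := s + r with hσ
  have hp : ∀ (i : Fin (k + 1)) (w : Fin (k + 1 + 1) → ℂ),
      partialDeriv i.castSucc (fun w => (w N - a N) ^ j) w = 0 := by
    intro i w
    have h2 : HasFDerivAt (fun w : Fin (k + 1 + 1) → ℂ => (w N - a N) ^ j) _ w :=
      ((hasFDerivAt_apply (𝕜 := ℂ) N w).sub_const _).pow j
    rw [partialDeriv, h2.fderiv]; simp [hN]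
  have hq : ∀ (i : Fin (k + 1)) (w : Fin (k + 1 + 1) → ℂ) (c : ℂ),
      partialDeriv i.castSucc (fun w => (w N - a N) ^ j * (c * (w i.castSucc - a i.castSucc))) w =
        (w N - a N) ^ j * c := by
    intro i w c
    have h2 : HasFDerivAt (fun w : Fin (k + 1 + 1) → ℂ => (w N - a N) ^ j) _ w :=
      ((hasFDerivAt_apply (𝕜 := ℂ) N w).sub_const _).pow j
    have h3 : HasFDerivAt (fun w : Fin (k + 1 + 1) → ℂ => c * (w i.castSucc - a i.castSucc)) _ w :=
      ((hasFDerivAt_apply (𝕜 := ℂ) i.castSucc w).sub_const _).const_mul c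
    rw [partialDeriv, (h2.fun_mul h3).fderiv]; simp [hN]
  have h1 : ∀ i : Fin (k + 1), Set.EqOn (partialDeriv i.castSucc (monoFun a s (j, r)))
      (fun w => (w N - a N) ^ j * (2 * σ * (if (i.castSucc : ℕ) < 1 then 1 else -1) *
        (w i.castSucc - a i.castSucc)) * shiftPow a (σ + 1) w) (tube (k + 1 + 1)) := by
    intro i w hw
    have := partialDeriv_mul_shiftPow (hsub w hw) σ (h := fun w => (w N - a N) ^ j) (by fun_prop)
      i.castSucc
    rw [hp, zero_mul, zero_add] at this
    exact this
  have h2 : ∀ i : Fin (k + 1),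
      partialDeriv i.castSucc (partialDeriv i.castSucc (monoFun a s (j, r))) w =
      (w N - a N) ^ j * (2 * σ * (if (i.castSucc : ℕ) < 1 then 1 else -1)) * shiftPow a (σ + 1) w +
      (w N - a N) ^ j * (4 * σ * (σ + 1) * (w i.castSucc - a i.castSucc) ^ 2) *
        shiftPow a (σ + 2) w := by
    intro i
    rw [partialDeriv_congr (h1 i) _ hw, partialDeriv_mul_shiftPow (hsub w hw) _ (by fun_prop), hq,
      show σ + 1 + 1 = σ + 2 by ring]
    split_ifs <;> ring
  have h3 : ∀ i : Fin (k + 1), (if (i : ℕ) = 0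
      then partialDeriv i.castSucc (partialDeriv i.castSucc (monoFun a s (j, r))) w
      else -partialDeriv i.castSucc (partialDeriv i.castSucc (monoFun a s (j, r))) w) =
      (w N - a N) ^ j * (2 * σ) * shiftPow a (σ + 1) w + (w N - a N) ^ j * (4 * σ * (σ + 1)) *
        shiftPow a (σ + 2) w * (if (i.castSucc : ℕ) < 1 then (w - a) i.castSucc ^ 2 else
          -(w - a) i.castSucc ^ 2) := by
    intro i
    rw [h2, Fin.val_castSucc]
    simp only [Nat.lt_one_iff, Pi.sub_apply]
    split_ifs <;> ring
  have h4 : (∑ i : Fin (k + 1), if (i.castSucc : ℕ) < 1 then (w - a) i.castSucc ^ 2 else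
      -(w - a) i.castSucc ^ 2) = (w N - a N) ^ 2 + stdForm 1 (w - a) := by
    rw [stdForm, Fin.sum_univ_castSucc (n := k + 1)]
    simp [N]
  have hne := slitPlane_ne_zero (neg_stdForm_mem_slitPlane (hsub w hw))
  have h5 : stdForm 1 (w - a) * shiftPow a (σ + 2) w = -shiftPow a (σ + 1) w := by
    rw [shiftPow, shiftPow, show -(σ + 1) = -(σ + 2) + 1 by ring, cpow_add _ _ hne, cpow_one]
    ring
  rw [lorentzLaplacian, Finset.sum_congr rfl fun i _ => h3 i, Finset.sum_add_distrib,
    Finset.sum_const, ← Finset.mul_sum, h4]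
  simp only [Finset.card_univ, Fintype.card_fin, nsmul_eq_mul, monoFun]
  push_cast
  rw [show s + (r + 1) = σ + 1 by rw [hσ]; ring, show s + (r + 2) = σ + 2 by rw [hσ]; ring,
    show (w (Fin.last (k + 1)) - a (Fin.last (k + 1))) = w N - a N from rfl, pow_add]
  linear_combination (w N - a N) ^ j * (4 * σ * (σ + 1)) * h5

theorem partialDeriv_last_monoEval {a : Fin (k + 1 + 1) → ℂ}
    (hsub : ∀ w ∈ tube (k + 1 + 1), w - a ∈ tube (k + 1 + 1)) (s : ℂ) (v : (ℕ × ℕ) →₀ ℂ) :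
    Set.EqOn (partialDeriv (Fin.last (k + 1)) (monoEval a s v)) (monoEval a s (monoDeriv s v))
      (tube (k + 1 + 1)) := by
  intro w hw
  induction v using Finsupp.induction_linear with
  | zero => simp [partialDeriv]
  | add u v hu hv =>
    rw [map_add, partialDeriv_add _ _ (differentiableAt_monoEval (hsub w hw) s u)
      (differentiableAt_monoEval (hsub w hw) s v), hu, hv, map_add, map_add]; rfl
  | single p c =>
    obtain ⟨j, i⟩ := p
    rw [← mul_one c, ← smul_eq_mul, ← Finsupp.smul_single, map_smul,
      partialDeriv_smul _ _ _ (differentiableAt_monoEval (hsub w hw) s _), map_smul, map_smul,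
      monoDeriv_single, monoEval_single, partialDeriv_last_monoFun (hsub w hw)]
    simp only [map_sub, map_smul, monoEval_single, Pi.smul_apply, Pi.sub_apply, smul_eq_mul]

theorem lorentzLaplacian_monoEval {a : Fin (k + 1 + 1) → ℂ}
    (hsub : ∀ w ∈ tube (k + 1 + 1), w - a ∈ tube (k + 1 + 1)) (s : ℂ) (v : (ℕ × ℕ) →₀ ℂ) :
    Set.EqOn (lorentzLaplacian (monoEval a s v)) (monoEval a s (monoLap (k + 1) s v))
      (tube (k + 1 + 1)) := by
  intro w hw
  have hd := fun w hw v => differentiableAt_monoEval (hsub w hw) s v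
  have hdd : ∀ (i : Fin (k + 1 + 1)) v, DifferentiableAt ℂ (partialDeriv i (monoEval a s v)) w :=
    fun i v => (DifferentiableOn.fderiv_apply_of_isOpen (isOpen_tube _) (fun w hw =>
      (hd w hw v).differentiableWithinAt) _).differentiableAt
        ((isOpen_tube _).mem_nhds hw)
  induction v using Finsupp.induction_linear with
  | zero =>
    have h0 : ∀ i, partialDeriv (d := k + 1 + 1) i (0 : (Fin (k + 1 + 1) → ℂ) → ℂ) = 0 :=
      fun i => by funext w; simp [partialDeriv]
    simp [lorentzLaplacian, h0]
  | add u v hu hv =>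
    have e : ∀ i : Fin (k + 1), partialDeriv i.castSucc (partialDeriv i.castSucc
        (monoEval a s (u + v))) w =
        partialDeriv i.castSucc (partialDeriv i.castSucc (monoEval a s u)) w +
        partialDeriv i.castSucc (partialDeriv i.castSucc (monoEval a s v)) w := by
      intro i
      rw [← partialDeriv_add _ _ (hdd _ u) (hdd _ v)]
      refine partialDeriv_congr (fun w hw => ?_) _ hw
      rw [map_add, partialDeriv_add _ _ (hd w hw u) (hd w hw v)]; rfl
    rw [map_add (monoLap _ _), map_add (monoEval a s) (monoLap _ _ _), Pi.add_apply, ← hu, ← hv]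
    simp only [lorentzLaplacian, e]
    rw [← Finset.sum_add_distrib]
    refine Finset.sum_congr rfl fun i _ => ?_
    split_ifs <;> ring
  | single p c =>
    obtain ⟨j, i⟩ := p
    rw [← mul_one c, ← smul_eq_mul, ← Finsupp.smul_single, map_smul, map_smul, monoLap_single]
    have e : ∀ r : Fin (k + 1), partialDeriv r.castSucc (partialDeriv r.castSucc
        (c • monoEval a s (Finsupp.single (j, i) 1))) w =
        c * partialDeriv r.castSucc (partialDeriv r.castSucc
          (monoEval a s (Finsupp.single (j, i) 1))) w := by
      intro r
      rw [← partialDeriv_smul _ _ _ (hdd _ _)]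
      refine partialDeriv_congr (fun w hw => ?_) _ hw
      rw [partialDeriv_smul _ _ _ (hd w hw _)]; rfl
    have h := lorentzLaplacian_monoFun hsub hw s (j, i)
    simp only [map_add, map_smul, monoEval_single, Pi.smul_apply, Pi.add_apply, smul_eq_mul] at e ⊢
    rw [← h]
    simp only [lorentzLaplacian, e, Finset.mul_sum]
    refine Finset.sum_congr rfl fun r _ => ?_
    split_ifs <;> ring

theorem juhlDiffOp_monoEval {a : Fin (k + 1 + 1) → ℂ}
    (hsub : ∀ w ∈ tube (k + 1 + 1), w - a ∈ tube (k + 1 + 1)) (l : ℕ) (α : ℝ) (s : ℂ) {f : (Fin (k + 1 + 1) → ℂ) → ℂ}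
    {v : (ℕ × ℕ) →₀ ℂ} (hf : Set.EqOn f (monoEval a s v) (tube (k + 1 + 1))) :
    Set.EqOn (juhlDiffOp l α f)
      (monoEval a s (gegenbauerOp l α (monoDeriv s) (monoLap (k + 1) s) v)) (tube (k + 1 + 1)) := by
  have hlap : ∀ r, Set.EqOn (lorentzLaplacian^[r] f)
      (monoEval a s ((monoLap (k + 1) s ^ r) v)) (tube (k + 1 + 1)) := by
    intro r
    induction r with
    | zero => simpa using hf
    | succ r ih =>
      rw [Function.iterate_succ_apply', pow_succ', Module.End.mul_apply]
      exact (lorentzLaplacian_congr ih).trans (lorentzLaplacian_monoEval hsub s _)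
  have hder : ∀ r (g : (Fin (k + 1 + 1) → ℂ) → ℂ) (u : (ℕ × ℕ) →₀ ℂ),
      Set.EqOn g (monoEval a s u) (tube (k + 1 + 1)) →
      Set.EqOn ((partialDeriv (Fin.last (k + 1)))^[r] g) (monoEval a s ((monoDeriv s ^ r) u))
        (tube (k + 1 + 1)) := by
    intro r g u hg
    induction r with
    | zero => simpa using hg
    | succ r ih =>
      rw [Function.iterate_succ_apply', pow_succ', Module.End.mul_apply]
      exact (partialDeriv_congr ih _).trans (partialDeriv_last_monoEval hsub s _)
  intro w hw
  rw [juhlDiffOp, gegenbauerOp, LinearMap.sum_apply, map_sum, Finset.sum_apply]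
  refine Finset.sum_congr rfl fun r _ => ?_
  rw [hder _ _ _ (hlap r) hw, LinearMap.smul_apply, map_smul, Pi.smul_apply, smul_eq_mul,
    Module.End.mul_apply]

/-- The Juhl operator on the power `-lam` of the quadratic form. -/
theorem juhlDiffOp_shiftPow {a : Fin (k + 1 + 1) → ℂ}
    (hsub : ∀ w ∈ tube (k + 1 + 1), w - a ∈ tube (k + 1 + 1)) (l : ℕ) {lam α : ℝ} (hα : 0 < α) (h : α = lam - (k + 1 : ℕ) / 2) (c : ℂ)
    {f : (Fin (k + 1 + 1) → ℂ) → ℂ}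
    (hf : Set.EqOn f (fun w => c * shiftPow a lam w) (tube (k + 1 + 1)))
    {w : Fin (k + 1 + 1) → ℂ} (hw : w ∈ tube (k + 1 + 1)) :
    juhlDiffOp l α f w = c * (((-1) ^ l * juhlConst l lam α : ℝ) : ℂ) *
      (w (Fin.last (k + 1)) - a (Fin.last (k + 1))) ^ l * shiftPow a (lam + l : ℝ) w := by
  have hf' : Set.EqOn f (monoEval a lam (c • Finsupp.single (0, 0) (1 : ℂ))) (tube (k + 1 + 1)) := by
    refine hf.trans fun w _ => ?_
    rw [map_smul, monoEval_single]; simp [monoFun]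
  rw [juhlDiffOp_monoEval hsub l α lam hf' hw, map_smul, gegenbauerOp_mono_single hα h, map_smul,
    map_smul, monoEval_single]
  simp only [Pi.smul_apply, smul_eq_mul, monoFun]
  push_cast
  ring

/-- The Juhl operator on the product of the power `-nu` of the quadratic form with a power of the
last coordinate. -/
theorem juhlDiffOp_pow_mul_shiftPow {a : Fin (k + 1 + 1) → ℂ}
    (hsub : ∀ w ∈ tube (k + 1 + 1), w - a ∈ tube (k + 1 + 1)) (l : ℕ) {α : ℝ} (hα : 0 < α) (nu : ℂ) (c : ℂ)
    {f : (Fin (k + 1 + 1) → ℂ) → ℂ}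
    (hf : Set.EqOn f (fun w => c * ((w (Fin.last (k + 1)) - a (Fin.last (k + 1))) ^ l *
      shiftPow a nu w)) (tube (k + 1 + 1)))
    {w : Fin (k + 1 + 1) → ℂ} (hw : w ∈ tube (k + 1 + 1))
    (hwa : w (Fin.last (k + 1)) = a (Fin.last (k + 1))) :
    juhlDiffOp l α f w = c * ((2 ^ l * poch α l : ℝ) : ℂ) * shiftPow a nu w := by
  have hf' : Set.EqOn f (monoEval a nu (c • Finsupp.single (l, 0) (1 : ℂ))) (tube (k + 1 + 1)) := by
    refine hf.trans fun w _ => ?_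
    rw [map_smul, monoEval_single]; simp [monoFun]
  have h0 : ∀ v ∈ monoGE 1, monoEval a nu v w = 0 := by
    intro v hv
    rw [monoGE, Finsupp.supported_eq_span_single] at hv
    induction hv using Submodule.span_induction with
    | mem x hx =>
      obtain ⟨⟨j, i⟩, hp, rfl⟩ := hx
      have : j ≠ 0 := Nat.one_le_iff_ne_zero.1 hp
      rw [monoEval_single, monoFun, hwa]; simp [this]
    | zero => simp
    | add x y _ _ hx hy => rw [map_add, Pi.add_apply, hx, hy, add_zero]
    | smul c x _ hx => rw [map_smul, Pi.smul_apply, hx, smul_zero]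
  have h1 := h0 _ (gegenbauerOp_mono_single_sub_mem (m := k + 1) hα nu l)
  rw [map_sub, map_smul, monoEval_single, Pi.sub_apply, Pi.smul_apply, sub_eq_zero] at h1
  rw [juhlDiffOp_monoEval hsub l α nu hf' hw, map_smul, map_smul, Pi.smul_apply, h1]
  simp [monoFun]
  ring

end JuhlPower

/-! ### The adjoint of the Juhl operator -/

section Adjoint

variable {k : ℕ}

theorem stdForm_snoc {R : Type*} [CommRing R] (x : Fin (k + 1) → R) (t : R) :
    stdForm 1 (Fin.snoc x t : Fin (k + 1 + 1) → R) = stdForm 1 x - t ^ 2 := by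
  rw [stdForm, Fin.sum_univ_castSucc, stdForm, sub_eq_add_neg]
  congr 1
  · simp
  · simp

theorem imPart_snoc {d : ℕ} (τ : Fin d → ℂ) :
    imPart (Fin.snoc τ 0 : Fin (d + 1) → ℂ) = (Fin.snoc (imPart τ) 0 : Fin (d + 1) → ℝ) := by
  ext i
  refine Fin.lastCases ?_ (fun i => ?_) i <;> simp [imPart]

theorem conjVec_snoc {d : ℕ} (τ : Fin d → ℂ) :
    conjVec (Fin.snoc τ 0 : Fin (d + 1) → ℂ) = (Fin.snoc (conjVec τ) 0 : Fin (d + 1) → ℂ) := by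
  ext i
  refine Fin.lastCases ?_ (fun i => ?_) i <;> simp [conjVec]

theorem conjVec_conjVec {d : ℕ} (τ : Fin d → ℂ) : conjVec (conjVec τ) = τ := by
  ext i; simp [conjVec]

theorem conjVec_sub {d : ℕ} (z w : Fin d → ℂ) : conjVec (z - w) = conjVec z - conjVec w := by
  ext i; simp [conjVec]

theorem snoc_sub_snoc {d : ℕ} (z w : Fin d → ℂ) :
    (Fin.snoc z 0 : Fin (d + 1) → ℂ) - Fin.snoc w 0 = Fin.snoc (z - w) 0 := by
  ext i
  refine Fin.lastCases ?_ (fun i => ?_) i <;> simp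

theorem snoc_mem_tube {τ : Fin (k + 1) → ℂ} (hτ : τ ∈ tube (k + 1)) :
    (Fin.snoc τ 0 : Fin (k + 1 + 1) → ℂ) ∈ tube (k + 1 + 1) := by
  rw [tube, Set.mem_ofPred_eq, mem_cone_iff] at *
  rw [imPart_snoc, stdForm_snoc]
  refine ⟨by simpa using hτ.1, ?_⟩
  exact hτ.2

theorem stdForm_conjVec {d : ℕ} (p : ℕ) (z : Fin d → ℂ) :
    stdForm p (conjVec z) = conj (stdForm p z) := by
  simp only [stdForm, map_sum, conjVec]
  refine Finset.sum_congr rfl fun i _ => ?_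
  split_ifs <;> simp

theorem conj_cpow_of_mem_slitPlane {z : ℂ} (hz : z ∈ slitPlane) (s : ℝ) :
    conj (z ^ (s : ℂ)) = conj z ^ (s : ℂ) := by
  rw [conj_cpow _ _ (mem_slitPlane_iff_arg.1 hz).1, conj_ofReal]

/-- The hermitian symmetry of the powers of the quadratic form. -/
theorem conj_shiftPow {z w : Fin (k + 1) → ℂ} (hz : z ∈ tube (k + 1)) (hw : w ∈ tube (k + 1))
    (s : ℝ) : conj (shiftPow (conjVec w) s z) = shiftPow (conjVec z) s w := by
  rw [shiftPow, shiftPow, ← ofReal_neg, conj_cpow_of_mem_slitPlane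
    (neg_stdForm_mem_slitPlane (sub_conjVec_mem_tube hz hw)), map_neg, ← stdForm_conjVec,
    conjVec_sub, conjVec_conjVec]
  congr 2
  rw [← neg_sub, show -(w - conjVec z) = (-1 : ℂ) • (w - conjVec z) by simp, stdForm_smul]
  simp

theorem shiftPow_snoc {z w : Fin (k + 1) → ℂ} (s : ℂ) :
    shiftPow (Fin.snoc w 0 : Fin (k + 1 + 1) → ℂ) s (Fin.snoc z 0 : Fin (k + 1 + 1) → ℂ) =
      shiftPow w s z := by
  rw [shiftPow, shiftPow, snoc_sub_snoc, stdForm_snoc]; simp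

theorem Bergman.kernelVec_eq_shiftPow {lam : ℝ} (hlam : (k : ℝ) + 1 < lam) {w : Fin (k + 2) → ℂ}
    (hw : w ∈ tube (k + 2)) : Set.EqOn (kernelVec lam w)
      (fun ζ => (bergmanConst (k + 2) lam : ℂ) * shiftPow (conjVec w) lam ζ) (tube (k + 2)) :=
  fun _ hζ => kernelVec_apply hlam hζ hw

/-- The holomorphic Juhl operator has an adjoint which maps the kernel functions to the relative
kernel functions and which is a multiple of an isometry. -/
theorem exists_juhlOp_adjoint {lam nu : ℝ} (l : ℕ) (hlam : (k : ℝ) + 2 < lam) (hnu : nu = lam + l) :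
    ∃ (T : Bergman (k + 2) nu →L[ℂ] Bergman (k + 2 + 1) lam) (c : ℝ), 0 < c ∧
      (∀ f, ∀ τ ∈ tube (k + 2), T.adjoint f τ = juhlOp lam l f τ) ∧
      (∀ f, T.adjoint (T f) = (c : ℂ) • f) ∧
      ∀ τ ∈ tube (k + 2), ∀ ζ ∈ tube (k + 2 + 1), T (Bergman.kernelVec nu τ) ζ =
        ((bergmanConst (k + 2 + 1) lam * juhlConst l lam (lam - ((k + 2 : ℕ) : ℝ) / 2) : ℝ) : ℂ) *
          (ζ (Fin.last (k + 2)) ^ l *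
            shiftPow (Fin.snoc (conjVec τ) 0 : Fin (k + 2 + 1) → ℂ) nu ζ) := by
  have hk0 : (0 : ℝ) ≤ k := Nat.cast_nonneg k
  set α : ℝ := lam - ((k + 2 : ℕ) : ℝ) / 2 with hα
  have hα0 : 0 < α := by rw [hα]; push_cast; linarith
  set C : ℝ := bergmanConst (k + 2 + 1) lam * juhlConst l lam α with hC
  have hlam1 : ((k + 1 : ℕ) : ℝ) + 1 < lam := by push_cast; linarith
  have hC0 : 0 < C := mul_pos (bergmanConst_pos (k := k + 1) hlam1)
    (juhlConst_pos l (by linarith) hα0)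
  have hφ : ∀ τ : tube (k + 2), ∃ φ : Bergman (k + 2 + 1) lam →L[ℂ] ℂ,
      ∀ f, φ f = juhlOp lam l f τ := fun τ =>
    (isTubeOp_juhlDiffOp (lam := lam) l α).exists_clm (snoc_mem_tube τ.2)
  choose φ hφ using hφ
  set e : tube (k + 2) → Bergman (k + 2 + 1) lam := fun τ => Bergman.rieszVec (φ τ) with he
  have hein : ∀ τ f, ⟪e τ, f⟫_ℂ = juhlOp lam l f τ := fun τ f => by
    rw [he, Bergman.inner_rieszVec, hφ]
  have hval : ∀ τ : tube (k + 2), ∀ ζ ∈ tube (k + 2 + 1), e τ ζ = (C : ℂ) *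
      (ζ (Fin.last (k + 2)) ^ l *
        shiftPow (Fin.snoc (conjVec τ) 0 : Fin (k + 2 + 1) → ℂ) nu ζ) := by
    intro τ ζ hζ
    have hs := snoc_mem_tube τ.2
    have h1 := juhlDiffOp_shiftPow (k := k + 1) (a := conjVec ζ)
      (fun w hw => sub_conjVec_mem_tube hw hζ) l hα0 hα _
      (Bergman.kernelVec_eq_shiftPow (k := k + 1) hlam1 hζ) hs
    rw [← Bergman.inner_kernelVec, ← inner_conj_symm, hein]
    refine (congrArg conj h1).trans ?_
    have h2 := conj_shiftPow (k := k + 2) hs hζ nu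
    rw [conjVec_snoc] at h2
    rw [← h2, map_mul, map_mul, map_mul, map_pow, map_sub, conj_ofReal, conj_ofReal, hnu, hC]
    have h3 : (Fin.snoc (τ : Fin (k + 2) → ℂ) 0 : Fin (k + 2 + 1) → ℂ) (Fin.last (k + 2)) = 0 :=
      Fin.snoc_last _ _
    have h4 : conj (conjVec ζ (Fin.last (k + 2))) = ζ (Fin.last (k + 2)) := by simp [conjVec]
    erw [h3, h4]
    rw [map_zero, zero_sub, neg_pow]
    push_cast
    have h5 : ((-1 : ℂ) ^ l) * (-1) ^ l = 1 := by rw [← mul_pow]; simp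
    linear_combination (bergmanConst (k + 2 + 1) lam : ℂ) * (juhlConst l lam α : ℂ) *
      ζ (Fin.last (k + 2)) ^ l *
      conj (shiftPow (conjVec ζ) ((lam : ℂ) + l) (Fin.snoc τ 0 : Fin (k + 2 + 1) → ℂ)) * h5
  set c : ℝ := C * (2 ^ l * poch α l) / bergmanConst (k + 2) nu with hc
  have hnu1 : (k : ℝ) + 1 < nu := by
    have : (0 : ℝ) ≤ l := Nat.cast_nonneg l
    rw [hnu]; linarith
  have hb := bergmanConst_pos hnu1
  have hc0 : 0 < c := div_pos (mul_pos hC0 (mul_pos (by positivity) (poch_pos hα0 l))) hb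
  have hgram : ∀ τ τ' : tube (k + 2), ⟪e τ, e τ'⟫_ℂ =
      c * ⟪Bergman.kernelVec nu (τ : Fin (k + 2) → ℂ), Bergman.kernelVec nu τ'⟫_ℂ := by
    intro τ τ'
    set a : Fin (k + 2 + 1) → ℂ := Fin.snoc (conjVec τ') 0 with ha
    have ha' : a = conjVec (Fin.snoc τ' 0 : Fin (k + 2 + 1) → ℂ) := by rw [ha, conjVec_snoc]
    have h0 : a (Fin.last (k + 2)) = 0 := Fin.snoc_last _ _
    have hf : Set.EqOn (e τ') (fun w => (C : ℂ) * ((w (Fin.last (k + 2)) - a (Fin.last (k + 2))) ^ l *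
        shiftPow a nu w)) (tube (k + 2 + 1)) := by
      intro ζ hζ
      simp only [h0, sub_zero]
      exact hval τ' ζ hζ
    have h1 := juhlDiffOp_pow_mul_shiftPow (k := k + 1) (a := a)
      (fun w hw => by rw [ha']; exact sub_conjVec_mem_tube hw (snoc_mem_tube τ'.2)) l hα0 nu C hf
      (snoc_mem_tube τ.2) (by rw [h0]; exact Fin.snoc_last _ _)
    rw [hein, Bergman.inner_kernelVec, Bergman.kernelVec_eq_shiftPow hnu1 τ'.2 τ.2]
    refine h1.trans ?_
    have h2 : shiftPow a nu (Fin.snoc (τ : Fin (k + 2) → ℂ) 0 : Fin (k + 2 + 1) → ℂ) =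
      shiftPow (conjVec (τ' : Fin (k + 2) → ℂ)) nu τ := shiftPow_snoc _
    erw [h2]
    rw [← mul_assoc, ← ofReal_mul, ← ofReal_mul, hc]
    congr 2
    field_simp
  obtain ⟨T, hT, hTT⟩ := Bergman.isTotalFamily_kernelVec.exists_clm e hc0.le hgram
  refine ⟨T, c, hc0, ?_, hTT, ?_⟩
  · intro f τ hτ
    rw [← Bergman.inner_kernelVec τ, ContinuousLinearMap.adjoint_inner_right, hT ⟨τ, hτ⟩, hein]
  · intro τ hτ ζ hζ
    rw [hT ⟨τ, hτ⟩, hval ⟨τ, hτ⟩ ζ hζ]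

theorem holoConst_mul_relKernel {lam nu : ℝ} {m l : ℕ} (hnu : nu = lam + l) (ζ : Fin (m + 1) → ℂ)
    (τ : Fin m → ℂ) : holoConst (m + 1) l lam * relKernel nu l ζ τ =
      ((bergmanConst (m + 1) lam * juhlConst l lam (lam - (m : ℝ) / 2) : ℝ) : ℂ) *
        (ζ (Fin.last m) ^ l * shiftPow (Fin.snoc (conjVec τ) 0 : Fin (m + 1) → ℂ) nu ζ) := by
  rw [← holoConst_mul_exp, relKernel, formPow, shiftPow, hnu]
  ring

theorem ae_mem_tube (d : ℕ) (lam : ℝ) : ∀ᵐ ζ ∂(bergmanMeasure d lam), ζ ∈ tube d :=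
  (withDensity_absolutelyContinuous _ _).ae_le (ae_restrict_mem (isOpen_tube _).measurableSet)

/-- A continuous operator between Bergman spaces is an integral operator. -/
theorem Bergman.clm_apply_eq_integral {d d' : ℕ} {lam nu : ℝ} (T : Bergman d nu →L[ℂ] Bergman d' lam)
    (ζ : Fin d' → ℂ) (g : Bergman d nu) :
    Integrable (fun τ => T (kernelVec nu τ) ζ * g τ) (bergmanMeasure d nu) ∧
      T g ζ = ∫ τ, T (kernelVec nu τ) ζ * g τ ∂(bergmanMeasure d nu) := by
  have h : ∀ τ, T (kernelVec nu τ) ζ = conj (T.adjoint (kernelVec lam ζ) τ) := by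
    intro τ
    rw [← inner_kernelVec ζ, ← inner_kernelVec τ, ContinuousLinearMap.adjoint_inner_right,
      inner_conj_symm]
  simp only [h]
  refine ⟨integrable_inner _ g, ?_⟩
  rw [← inner_def, ContinuousLinearMap.adjoint_inner_left, inner_kernelVec]

end Adjoint

/-! ### The conformal action on the tube domain -/

section Conformal

variable {k : ℕ}

theorem stdForm_two_eq {R : Type*} [CommRing R] (x : Fin (k + 1 + 2) → R) :
    stdForm 2 x = x 0 ^ 2 + x 1 ^ 2 - x 2 ^ 2 - ∑ i : Fin k, x i.succ.succ.succ ^ 2 := by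
  have h1 : (Fin.succ 0 : Fin (k + 1 + 2)) = 1 := rfl
  have h2 : (Fin.succ (Fin.succ 0) : Fin (k + 1 + 2)) = 2 := rfl
  rw [stdForm, Fin.sum_univ_succ, Fin.sum_univ_succ, Fin.sum_univ_succ, if_pos (by simp),
    if_pos (by simp), if_neg (by simp only [Fin.val_succ, Fin.val_zero]; omega), h1, h2]
  simp
  ring

theorem stdForm_complex_eq (p : ℕ) {d : ℕ} (z : Fin d → ℂ) :
    stdForm p z = ((stdForm p (rePart z) - stdForm p (imPart z) : ℝ) : ℂ) +
      ((stdForm p (rePart z + imPart z) - stdForm p (rePart z) - stdForm p (imPart z) : ℝ) : ℂ)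
        * I := by
  simp only [stdForm, ← Finset.sum_sub_distrib, ofReal_sum, Finset.sum_mul,
    ← Finset.sum_add_distrib]
  refine Finset.sum_congr rfl fun i _ => ?_
  have h : z i = ((rePart z i : ℝ) : ℂ) + ((imPart z i : ℝ) : ℂ) * I := (re_add_im _).symm
  split_ifs
  · rw [h, Pi.add_apply]
    push_cast
    linear_combination ((imPart z i : ℝ) : ℂ) ^ 2 * I_sq
  · rw [h, Pi.add_apply]
    push_cast
    linear_combination -((imPart z i : ℝ) : ℂ) ^ 2 * I_sq

theorem nullVec_zero (ζ : Fin (k + 1) → ℂ) : nullVec ζ 0 = (1 - stdForm 1 ζ) / 2 := by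
  simp [nullVec]

theorem nullVec_one (ζ : Fin (k + 1) → ℂ) : nullVec ζ 1 = ζ 0 := by
  simp [nullVec]

theorem nullVec_two (ζ : Fin (k + 1) → ℂ) : nullVec ζ 2 = (1 + stdForm 1 ζ) / 2 := by
  have : ((2 : Fin (k + 1 + 2)) : ℕ) = 2 := rfl
  simp only [nullVec, this]
  simp

theorem nullVec_succ (ζ : Fin (k + 1) → ℂ) (i : Fin k) :
    nullVec ζ i.succ.succ.succ = ζ i.succ := by
  simp [nullVec]
  rfl

theorem stdForm_two_smul_nullVec_sub (a b : ℂ) (ζ w : Fin (k + 1) → ℂ) :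
    stdForm 2 (a • nullVec ζ - b • nullVec w) = a * b * stdForm 1 (ζ - w) := by
  simp only [stdForm_two_eq, Pi.sub_apply, Pi.smul_apply, nullVec_zero, nullVec_one, nullVec_two,
    nullVec_succ, smul_eq_mul, stdForm_one_eq, sub_sq, Finset.sum_sub_distrib,
    Finset.sum_add_distrib, mul_pow, ← Finset.mul_sum]
  have e : ∑ i : Fin k, 2 * (a * ζ i.succ) * (b * w i.succ) =
      2 * a * b * ∑ i : Fin k, ζ i.succ * w i.succ := by
    rw [Finset.mul_sum]; exact Finset.sum_congr rfl fun i _ => by ring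
  have e' : ∑ i : Fin k, 2 * ζ i.succ * w i.succ = 2 * ∑ i : Fin k, ζ i.succ * w i.succ := by
    rw [Finset.mul_sum]; exact Finset.sum_congr rfl fun i _ => by ring
  rw [e, e']
  ring

/-- The hermitian form of signature `(2, d)`. -/
def hermForm {d : ℕ} (z : Fin (d + 2) → ℂ) : ℝ := stdForm 2 (rePart z) + stdForm 2 (imPart z)

theorem hermForm_eq (z : Fin (k + 1 + 2) → ℂ) :
    hermForm z = ‖z 0‖ ^ 2 + ‖z 1‖ ^ 2 - ‖z 2‖ ^ 2 - ∑ i : Fin k, ‖z i.succ.succ.succ‖ ^ 2 := by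
  have h : ∀ w : ℂ, ‖w‖ ^ 2 = w.re ^ 2 + w.im ^ 2 := fun w => by
    rw [← normSq_eq_norm_sq, normSq_apply]; ring
  simp only [hermForm, stdForm_two_eq, h, rePart, imPart, Finset.sum_add_distrib]
  ring

theorem hermForm_smul (c : ℂ) (z : Fin (k + 1 + 2) → ℂ) :
    hermForm (c • z) = ‖c‖ ^ 2 * hermForm z := by
  simp only [hermForm_eq, Pi.smul_apply, smul_eq_mul, norm_mul, mul_pow, ← Finset.mul_sum]
  ring

theorem hermForm_nullVec (ζ : Fin (k + 1) → ℂ) :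
    hermForm (nullVec ζ) = 2 * stdForm 1 (imPart ζ) := by
  have h := stdForm_re_im ζ
  have hre : (stdForm 1 ζ).re = stdForm 1 (rePart ζ) - stdForm 1 (imPart ζ) := by
    rw [h]; simp
  simp only [hermForm, stdForm_two_eq, rePart, imPart, nullVec_zero, nullVec_one, nullVec_two,
    nullVec_succ]
  have e1 := stdForm_one_eq (rePart ζ)
  have e2 := stdForm_one_eq (imPart ζ)
  simp only [rePart, imPart] at e1 e2
  have a1 : ((1 - stdForm 1 ζ) / 2).re = (1 - (stdForm 1 ζ).re) / 2 := by simp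
  have a2 : ((1 + stdForm 1 ζ) / 2).re = (1 + (stdForm 1 ζ).re) / 2 := by simp
  have a3 : ((1 - stdForm 1 ζ) / 2).im = -(stdForm 1 ζ).im / 2 := by simp
  have a4 : ((1 + stdForm 1 ζ) / 2).im = (stdForm 1 ζ).im / 2 := by simp
  rw [a1, a2, a3, a4, hre]
  linear_combination -e1 - e2

/-- A null vector with positive hermitian form does not lie in the hyperplane `x_0 + x_2 = 0`. -/
theorem add_ne_zero_of_hermForm_pos {x : Fin (k + 1 + 2) → ℂ} (h0 : stdForm 2 x = 0)
    (h : 0 < hermForm x) : x 0 + x 2 ≠ 0 := by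
  intro hx
  have e : x 2 = -x 0 := by linear_combination hx
  rw [stdForm_two_eq, e] at h0
  rw [hermForm_eq, e, norm_neg] at h
  have h1 : x 1 ^ 2 = ∑ i : Fin k, x i.succ.succ.succ ^ 2 := by linear_combination h0
  have h2 : ‖x 1‖ ^ 2 ≤ ∑ i : Fin k, ‖x i.succ.succ.succ‖ ^ 2 := by
    rw [← norm_pow, h1]
    refine (norm_sum_le _ _).trans (le_of_eq ?_)
    simp only [norm_pow]
  linarith

/-- A matrix which preserves the form of signature `(2, d)`. -/
def PreservesForm {d : ℕ} (g : GL (Fin (d + 2)) ℝ) : Prop :=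
  ∀ x, stdForm 2 ((g : Matrix (Fin (d + 2)) (Fin (d + 2)) ℝ).mulVec x) = stdForm 2 x

theorem rePart_mulVec {d : ℕ} (A : Matrix (Fin d) (Fin d) ℝ) (z : Fin d → ℂ) :
    rePart ((A.map fun x : ℝ => (x : ℂ)).mulVec z) = A.mulVec (rePart z) := by
  ext i; simp [rePart, Matrix.mulVec, dotProduct]

theorem imPart_mulVec {d : ℕ} (A : Matrix (Fin d) (Fin d) ℝ) (z : Fin d → ℂ) :
    imPart ((A.map fun x : ℝ => (x : ℂ)).mulVec z) = A.mulVec (imPart z) := by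
  ext i; simp [imPart, Matrix.mulVec, dotProduct]

theorem conjVec_mulVec {d : ℕ} (A : Matrix (Fin d) (Fin d) ℝ) (z : Fin d → ℂ) :
    conjVec ((A.map fun x : ℝ => (x : ℂ)).mulVec z) =
      (A.map fun x : ℝ => (x : ℂ)).mulVec (conjVec z) := by
  ext i; simp [conjVec, Matrix.mulVec, dotProduct]

theorem PreservesForm.stdForm_mulVec {d : ℕ} {g : GL (Fin (d + 2)) ℝ} (hg : PreservesForm g)
    (z : Fin (d + 2) → ℂ) : stdForm 2 (((g : Matrix (Fin (d + 2)) (Fin (d + 2)) ℝ).map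
      fun x : ℝ => (x : ℂ)).mulVec z) = stdForm 2 z := by
  rw [stdForm_complex_eq, stdForm_complex_eq 2 z, rePart_mulVec, imPart_mulVec,
    ← Matrix.mulVec_add, hg, hg, hg]

theorem PreservesForm.hermForm_mulVec {d : ℕ} {g : GL (Fin (d + 2)) ℝ} (hg : PreservesForm g)
    (z : Fin (d + 2) → ℂ) : hermForm (((g : Matrix (Fin (d + 2)) (Fin (d + 2)) ℝ).map
      fun x : ℝ => (x : ℂ)).mulVec z) = hermForm z := by
  rw [hermForm, hermForm, rePart_mulVec, imPart_mulVec, hg, hg]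

variable {g : GL (Fin (k + 1 + 2)) ℝ}

theorem stdForm_two_nullVec (ζ : Fin (k + 1) → ℂ) : stdForm 2 (nullVec ζ) = 0 := by
  have h := stdForm_two_smul_nullVec_sub 1 0 ζ ζ
  simpa using h

theorem PreservesForm.autFactor_ne_zero (hg : PreservesForm g) {ζ : Fin (k + 1) → ℂ}
    (hζ : ζ ∈ tube (k + 1)) : autFactor g ζ ≠ 0 := by
  refine add_ne_zero_of_hermForm_pos ?_ ?_
  · exact (hg.stdForm_mulVec _).trans (stdForm_two_nullVec ζ)
  · have h := (hg.hermForm_mulVec (nullVec ζ)).trans (hermForm_nullVec ζ)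
    rw [actNull, h]
    have : 0 < stdForm 1 (imPart ζ) := hζ.1
    positivity

theorem confAct_zero (g : GL (Fin (k + 1 + 2)) ℝ) (ζ : Fin (k + 1) → ℂ) :
    confAct g ζ 0 = actNull g ζ 1 / autFactor g ζ := by simp [confAct]

theorem confAct_succ (g : GL (Fin (k + 1 + 2)) ℝ) (ζ : Fin (k + 1) → ℂ) (i : Fin k) :
    confAct g ζ i.succ = actNull g ζ i.succ.succ.succ / autFactor g ζ := by
  simp [confAct]
  rfl

/-- The defining property of the automorphy factor and of the conformal action. -/
theorem PreservesForm.actNull_eq (hg : PreservesForm g) {ζ : Fin (k + 1) → ℂ}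
    (hζ : autFactor g ζ ≠ 0) : actNull g ζ = autFactor g ζ • nullVec (confAct g ζ) := by
  have h0 : stdForm 2 (actNull g ζ) = 0 :=
    (hg.stdForm_mulVec _).trans (stdForm_two_nullVec ζ)
  have hj : autFactor g ζ = actNull g ζ 0 + actNull g ζ 2 := rfl
  rw [stdForm_two_eq] at h0
  have hQ : stdForm 1 (confAct g ζ) = (actNull g ζ 2 - actNull g ζ 0) / autFactor g ζ := by
    rw [stdForm_one_eq, confAct_zero]
    simp only [confAct_succ, div_pow, ← Finset.sum_div]
    rw [← sub_div, div_eq_div_iff (pow_ne_zero 2 hζ) hζ]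
    linear_combination (autFactor g ζ) * (h0 - (actNull g ζ 2 - actNull g ζ 0) * hj)
  ext i
  rw [Pi.smul_apply, smul_eq_mul]
  refine Fin.cases ?_ (fun i => Fin.cases ?_ (fun i => Fin.cases ?_ (fun i => ?_) i) i) i
  · rw [nullVec_zero, hQ]
    field_simp
    linear_combination -hj
  · show actNull g ζ 1 = _ * nullVec _ 1
    rw [nullVec_one, confAct_zero]
    field_simp
  · show actNull g ζ 2 = _ * nullVec _ 2
    rw [nullVec_two, hQ]
    field_simp
    linear_combination -hj
  · rw [nullVec_succ, confAct_succ]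
    field_simp

theorem PreservesForm.stdForm_confAct_sub (hg : PreservesForm g) {ζ w : Fin (k + 1) → ℂ}
    (hζ : autFactor g ζ ≠ 0) (hw : autFactor g w ≠ 0) :
    autFactor g ζ * autFactor g w * stdForm 1 (confAct g ζ - confAct g w) =
      stdForm 1 (ζ - w) := by
  rw [← stdForm_two_smul_nullVec_sub, ← hg.actNull_eq hζ, ← hg.actNull_eq hw, actNull, actNull,
    ← Matrix.mulVec_sub, hg.stdForm_mulVec]
  simpa using stdForm_two_smul_nullVec_sub 1 1 ζ w

theorem nullVec_conjVec (ζ : Fin (k + 1) → ℂ) : nullVec (conjVec ζ) = conjVec (nullVec ζ) := by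
  ext i
  refine Fin.cases ?_ (fun i => Fin.cases ?_ (fun i => Fin.cases ?_ (fun i => ?_) i) i) i
  · rw [nullVec_zero, conjVec, nullVec_zero, stdForm_conjVec]; simp [map_ofNat]
  · show nullVec _ 1 = conj (nullVec ζ 1)
    rw [nullVec_one, nullVec_one]; rfl
  · show nullVec _ 2 = conj (nullVec ζ 2)
    rw [nullVec_two, nullVec_two, stdForm_conjVec]; simp [map_ofNat]
  · rw [nullVec_succ, conjVec, conjVec, nullVec_succ]

theorem actNull_conjVec (g : GL (Fin (k + 1 + 2)) ℝ) (ζ : Fin (k + 1) → ℂ) :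
    actNull g (conjVec ζ) = conjVec (actNull g ζ) := by
  rw [actNull, actNull, nullVec_conjVec, conjVec_mulVec]

theorem autFactor_conjVec (g : GL (Fin (k + 1 + 2)) ℝ) (ζ : Fin (k + 1) → ℂ) :
    autFactor g (conjVec ζ) = conj (autFactor g ζ) := by
  rw [autFactor, autFactor, actNull_conjVec, map_add]; rfl

theorem confAct_conjVec (g : GL (Fin (k + 1 + 2)) ℝ) (ζ : Fin (k + 1) → ℂ) :
    confAct g (conjVec ζ) = conjVec (confAct g ζ) := by
  ext i
  simp only [confAct, conjVec, autFactor_conjVec, actNull_conjVec, map_div₀]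
  split_ifs <;> rfl

theorem PreservesForm.stdForm_confAct_sub_conjVec (hg : PreservesForm g) {ζ w : Fin (k + 1) → ℂ}
    (hζ : autFactor g ζ ≠ 0) (hw : autFactor g w ≠ 0) :
    autFactor g ζ * conj (autFactor g w) * stdForm 1 (confAct g ζ - conjVec (confAct g w)) =
      stdForm 1 (ζ - conjVec w) := by
  rw [← confAct_conjVec, ← autFactor_conjVec]
  refine hg.stdForm_confAct_sub hζ ?_
  rw [autFactor_conjVec]
  simpa using hw

theorem PreservesForm.stdForm_imPart_confAct_pos (hg : PreservesForm g) {ζ : Fin (k + 1) → ℂ}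
    (hζ : ζ ∈ tube (k + 1)) : 0 < stdForm 1 (imPart (confAct g ζ)) := by
  have hj := hg.autFactor_ne_zero hζ
  have h : hermForm (actNull g ζ) = hermForm (nullVec ζ) := hg.hermForm_mulVec _
  rw [hg.actNull_eq hj, hermForm_smul, hermForm_nullVec, hermForm_nullVec] at h
  have h1 : 0 < stdForm 1 (imPart ζ) := hζ.1
  have h2 : 0 < ‖autFactor g ζ‖ ^ 2 := by positivity
  by_contra hneg
  nlinarith

theorem actNull_one (ζ : Fin (k + 1) → ℂ) : actNull 1 ζ = nullVec ζ := by
  rw [actNull, Units.val_one, Matrix.map_one _ ofReal_zero ofReal_one, Matrix.one_mulVec]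

theorem nullVec_zero_add_two (ζ : Fin (k + 1) → ℂ) : nullVec ζ 0 + nullVec ζ 2 = 1 := by
  rw [nullVec_zero, nullVec_two]; ring

theorem autFactor_one (ζ : Fin (k + 1) → ℂ) : autFactor 1 ζ = 1 := by
  rw [autFactor, actNull_one, nullVec_zero_add_two]

theorem confAct_eq_of_actNull {c : ℂ} (hc : c ≠ 0) {ζ w : Fin (k + 1) → ℂ}
    (h : actNull g ζ = c • nullVec w) : confAct g ζ = w := by
  have hj : autFactor g ζ = c := by
    rw [autFactor, h, Pi.smul_apply, Pi.smul_apply, ← smul_add, nullVec_zero_add_two]; simp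
  ext i
  refine Fin.cases ?_ (fun i => ?_) i
  · rw [confAct_zero, hj, h, Pi.smul_apply, nullVec_one, smul_eq_mul]; field_simp
  · rw [confAct_succ, hj, h, Pi.smul_apply, nullVec_succ, smul_eq_mul]; field_simp

theorem confAct_one (ζ : Fin (k + 1) → ℂ) : confAct 1 ζ = ζ :=
  confAct_eq_of_actNull one_ne_zero (by rw [actNull_one, one_smul])

theorem PreservesForm.confAct_inv_confAct (hg : PreservesForm g) {ζ : Fin (k + 1) → ℂ}
    (hζ : autFactor g ζ ≠ 0) : confAct g⁻¹ (confAct g ζ) = ζ := by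
  refine confAct_eq_of_actNull (inv_ne_zero hζ) ?_
  have h := hg.actNull_eq hζ
  have h1 : nullVec (confAct g ζ) = (autFactor g ζ)⁻¹ • actNull g ζ := by
    rw [h, smul_smul, inv_mul_cancel₀ hζ, one_smul]
  rw [actNull, h1, Matrix.mulVec_smul, actNull, Matrix.mulVec_mulVec]
  congr 1
  have h2 : ((g⁻¹ : GL (Fin (k + 1 + 2)) ℝ) : Matrix (Fin (k + 1 + 2)) (Fin (k + 1 + 2)) ℝ).map
      (fun x : ℝ => (x : ℂ)) * (g : Matrix (Fin (k + 1 + 2)) (Fin (k + 1 + 2)) ℝ).map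
      (fun x : ℝ => (x : ℂ)) = 1 := by
    have := (Matrix.map_mul (f := ofRealHom)
      (L := ((g⁻¹ : GL (Fin (k + 1 + 2)) ℝ) : Matrix (Fin (k + 1 + 2)) (Fin (k + 1 + 2)) ℝ))
      (M := (g : Matrix (Fin (k + 1 + 2)) (Fin (k + 1 + 2)) ℝ))).symm
    refine this.trans ?_
    rw [← Units.val_mul, inv_mul_cancel, Units.val_one, Matrix.map_one _ (map_zero _) (map_one _)]
  rw [h2, Matrix.one_mulVec]

/-! ### Paths of conformal transformations -/

/-- A path of matrices which preserve the form and which starts at the identity. -/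
structure IsOrthPath {d : ℕ} (g : unitInterval → GL (Fin (d + 2)) ℝ) : Prop where
  zero : g 0 = 1
  preservesForm : ∀ t, PreservesForm (g t)
  continuous : Continuous fun t => (g t : Matrix (Fin (d + 2)) (Fin (d + 2)) ℝ)

variable {p : unitInterval → GL (Fin (k + 1 + 2)) ℝ}

theorem IsOrthPath.continuous_actNull (hp : IsOrthPath p) (ζ : Fin (k + 1) → ℂ) :
    Continuous fun t => actNull (p t) ζ := by
  have := hp.continuous
  unfold actNull
  fun_prop

theorem IsOrthPath.continuous_autFactor (hp : IsOrthPath p) (ζ : Fin (k + 1) → ℂ) :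
    Continuous fun t => autFactor (p t) ζ := by
  have := hp.continuous_actNull ζ
  unfold autFactor
  fun_prop

theorem IsOrthPath.continuous_confAct (hp : IsOrthPath p) {ζ : Fin (k + 1) → ℂ}
    (hζ : ζ ∈ tube (k + 1)) : Continuous fun t => confAct (p t) ζ := by
  have h1 := hp.continuous_actNull ζ
  refine continuous_pi fun i => Continuous.div ?_ (hp.continuous_autFactor ζ)
    fun t => (hp.preservesForm t).autFactor_ne_zero hζ
  split_ifs <;> fun_prop

theorem IsOrthPath.confAct_mem_tube (hp : IsOrthPath p) {ζ : Fin (k + 1) → ℂ}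
    (hζ : ζ ∈ tube (k + 1)) (t : unitInterval) : confAct (p t) ζ ∈ tube (k + 1) := by
  have hpos := fun t => (hp.preservesForm t).stdForm_imPart_confAct_pos hζ
  rw [tube, Set.mem_ofPred_eq, mem_cone_iff]
  refine ⟨hpos t, ?_⟩
  have hc : Continuous fun t => (confAct (p t) ζ 0).im :=
    Complex.continuous_im.comp ((continuous_apply 0).comp (hp.continuous_confAct hζ))
  have h0 : 0 < (confAct (p 0) ζ 0).im := by
    rw [hp.zero, confAct_one]; exact (mem_cone_iff.1 hζ).2
  by_contra hneg
  obtain ⟨s, hs⟩ := intermediate_value_univ t 0 hc ⟨not_lt.1 hneg, h0.le⟩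
  have h1 := hpos s
  have hs' : imPart (confAct (p s) ζ) 0 = 0 := hs
  rw [stdForm_one_eq, hs'] at h1
  have : (0 : ℝ) ≤ ∑ i : Fin k, imPart (confAct (p s) ζ) i.succ ^ 2 :=
    Finset.sum_nonneg fun i _ => sq_nonneg _
  linarith

theorem eq_zero_of_exp_eq_one {F : unitInterval → ℂ} (hF : Continuous F) (h0 : F 0 = 0)
    (h : ∀ t, exp (F t) = 1) (t : unitInterval) : F t = 0 := by
  have e : F = fun _ => 0 := isCoveringMap_exp.eq_of_comp_eq hF continuous_const
    (funext fun t => Subtype.ext (by simp [h t])) 0 h0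
  rw [e]

/-- The logarithm of the automorphy factor of the end point of a path, continued along the path. -/
abbrev autLog (p : unitInterval → GL (Fin (k + 1 + 2)) ℝ) (ζ : Fin (k + 1) → ℂ) : ℂ :=
  pathLog fun t => autFactor (p t) ζ

theorem IsOrthPath.exists_log (hp : IsOrthPath p) {ζ : Fin (k + 1) → ℂ} (hζ : ζ ∈ tube (k + 1)) :
    ∃ L : C(unitInterval, ℂ), L 0 = 0 ∧ (∀ t, exp (L t) = autFactor (p t) ζ) ∧
      autLog p ζ = L 1 :=
  exists_lift_and_pathLog_eq ⟨_, hp.continuous_autFactor ζ⟩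
    (by simp [hp.zero, autFactor_one]) fun t => (hp.preservesForm t).autFactor_ne_zero hζ

theorem IsOrthPath.exp_autLog (hp : IsOrthPath p) {ζ : Fin (k + 1) → ℂ} (hζ : ζ ∈ tube (k + 1)) :
    exp (autLog p ζ) = autFactor (p 1) ζ := by
  obtain ⟨L, -, h, e⟩ := hp.exists_log hζ
  rw [e, h]

/-- The transformation law of the powers of the quadratic form. -/
theorem IsOrthPath.shiftPow_confAct (hp : IsOrthPath p) {ζ w : Fin (k + 1) → ℂ}
    (hζ : ζ ∈ tube (k + 1)) (hw : w ∈ tube (k + 1)) (s : ℂ) :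
    shiftPow (conjVec (confAct (p 1) w)) s (confAct (p 1) ζ) =
      exp (s * (autLog p ζ + conj (autLog p w))) * shiftPow (conjVec w) s ζ := by
  obtain ⟨L, hL0, hL, eL⟩ := hp.exists_log hζ
  obtain ⟨M, hM0, hM, eM⟩ := hp.exists_log hw
  have hmem : ∀ t, -stdForm 1 (confAct (p t) ζ - conjVec (confAct (p t) w)) ∈ slitPlane :=
    fun t => neg_stdForm_mem_slitPlane
      (sub_conjVec_mem_tube (hp.confAct_mem_tube hζ t) (hp.confAct_mem_tube hw t))
  have hmem0 : -stdForm 1 (ζ - conjVec w) ∈ slitPlane :=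
    neg_stdForm_mem_slitPlane (sub_conjVec_mem_tube hζ hw)
  have hcont : Continuous fun t =>
      log (-stdForm 1 (confAct (p t) ζ - conjVec (confAct (p t) w))) := by
    refine Continuous.clog ?_ hmem
    have hconj : Continuous fun t => conjVec (confAct (p t) w) := by
      have := hp.continuous_confAct hw
      unfold conjVec
      fun_prop
    exact ((continuous_stdForm_complex 1).comp ((hp.continuous_confAct hζ).sub hconj)).neg
  have key := eq_zero_of_exp_eq_one
    (F := fun t => log (-stdForm 1 (confAct (p t) ζ - conjVec (confAct (p t) w))) + L t +
      conj (M t) - log (-stdForm 1 (ζ - conjVec w)))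
    (by have := continuous_conj; fun_prop)
    (by simp [hp.zero, confAct_one, hL0, hM0])
    (fun t => by
      have h := (hp.preservesForm t).stdForm_confAct_sub_conjVec
        ((hp.preservesForm t).autFactor_ne_zero hζ) ((hp.preservesForm t).autFactor_ne_zero hw)
      rw [exp_sub, exp_add, exp_add, exp_log (slitPlane_ne_zero (hmem t)),
        exp_log (slitPlane_ne_zero hmem0), exp_conj, hL, hM, div_eq_one_iff_eq
        (slitPlane_ne_zero hmem0), ← h]
      ring) 1
  rw [shiftPow, shiftPow, cpow_def_of_ne_zero (slitPlane_ne_zero (hmem 1)),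
    cpow_def_of_ne_zero (slitPlane_ne_zero hmem0), ← exp_add, eL, eM]
  congr 1
  linear_combination -s * key

end Conformal

/-! ### The subgroup which fixes the last coordinate -/

section Block

theorem blockEmb_mulVec {m : ℕ} {R : Type*} [CommRing R] (f : ℝ →+* R) (g : GL (Fin (m + 2)) ℝ)
    (x : Fin (m + 1 + 2) → R) :
    ((blockEmb m g : Matrix (Fin (m + 1 + 2)) (Fin (m + 1 + 2)) ℝ).map f).mulVec x =
      (Fin.snoc (((g : Matrix (Fin (m + 2)) (Fin (m + 2)) ℝ).map f).mulVec
        (Fin.init (n := m + 2) (α := fun _ => R) x)) (x (Fin.last (m + 2))) :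
          Fin (m + 2 + 1) → R) := by
  have hcast : ∀ i : Fin (m + 2), finSumFinEquiv.symm (Fin.castSucc i : Fin (m + 2 + 1)) =
      (Sum.inl i : Fin (m + 2) ⊕ Fin 1) := fun i => by
    rw [Equiv.symm_apply_eq]; rfl
  have hlast : finSumFinEquiv.symm (Fin.last (m + 2)) = (Sum.inr 0 : Fin (m + 2) ⊕ Fin 1) := by
    rw [Equiv.symm_apply_eq]; rfl
  have h : ∀ i j, (blockEmb m g : Matrix (Fin (m + 1 + 2)) (Fin (m + 1 + 2)) ℝ) i j =
      Matrix.fromBlocks (g : Matrix (Fin (m + 2)) (Fin (m + 2)) ℝ) 0 0 (1 : Matrix (Fin 1) (Fin 1) ℝ)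
        (finSumFinEquiv.symm i) (finSumFinEquiv.symm j) := fun i j => rfl
  funext i
  refine Fin.lastCases (n := m + 2) ?_ (fun i => ?_) i
  · erw [Fin.snoc_last]
    rw [Matrix.mulVec, dotProduct]
    refine (Fin.sum_univ_castSucc (n := m + 2) _).trans ?_
    simp [h, hcast, hlast]
  · erw [Fin.snoc_castSucc]
    rw [Matrix.mulVec, dotProduct]
    refine (Fin.sum_univ_castSucc (n := m + 2) _).trans ?_
    simp [h, hcast, hlast, Matrix.mulVec, dotProduct, Fin.init]

theorem actNull_blockEmb {k : ℕ} (g : GL (Fin (k + 1 + 2)) ℝ) (ζ : Fin (k + 1 + 1) → ℂ) :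
    actNull (blockEmb (k + 1) g) ζ = (Fin.snoc (((g : Matrix (Fin (k + 1 + 2)) (Fin (k + 1 + 2)) ℝ).map
      fun x : ℝ => (x : ℂ)).mulVec (Fin.init (n := k + 1 + 2) (α := fun _ => ℂ) (nullVec ζ)))
        (ζ (Fin.last (k + 1))) : Fin (k + 1 + 2 + 1) → ℂ) :=
  blockEmb_mulVec ofRealHom g (nullVec ζ)

theorem init_nullVec_snoc {k : ℕ} (τ : Fin (k + 1) → ℂ) :
    Fin.init (n := k + 1 + 2) (α := fun _ => ℂ) (nullVec (Fin.snoc τ 0 : Fin (k + 1 + 1) → ℂ)) =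
      nullVec τ := by
  have h : ∀ (j : ℕ) (hj : j < k + 1), (Fin.snoc τ 0 : Fin (k + 1 + 1) → ℂ) ⟨j, hj.trans (by omega)⟩ =
      τ ⟨j, hj⟩ := fun j hj => Fin.snoc_castSucc (α := fun _ => ℂ) 0 τ ⟨j, hj⟩
  funext i
  have hi := i.2
  simp only [Fin.init, nullVec, Fin.val_castSucc, stdForm_snoc]
  split_ifs <;> first | (exfalso; omega) | exact h _ (by omega) | simp

theorem actNull_blockEmb_snoc {k : ℕ} (g : GL (Fin (k + 1 + 2)) ℝ) (τ : Fin (k + 1) → ℂ) :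
    actNull (blockEmb (k + 1) g) (Fin.snoc τ 0 : Fin (k + 1 + 1) → ℂ) =
      (Fin.snoc (actNull g τ) 0 : Fin (k + 1 + 2 + 1) → ℂ) := by
  rw [actNull_blockEmb, init_nullVec_snoc, Fin.snoc_last]; rfl

theorem autFactor_blockEmb_snoc {k : ℕ} (g : GL (Fin (k + 1 + 2)) ℝ) (τ : Fin (k + 1) → ℂ) :
    autFactor (blockEmb (k + 1) g) (Fin.snoc τ 0 : Fin (k + 1 + 1) → ℂ) = autFactor g τ := by
  rw [autFactor, actNull_blockEmb_snoc]
  have h0 : (Fin.snoc (actNull g τ) 0 : Fin (k + 1 + 2 + 1) → ℂ) 0 = actNull g τ 0 :=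
    Fin.snoc_castSucc (α := fun _ => ℂ) 0 (actNull g τ) 0
  have h2 : (Fin.snoc (actNull g τ) 0 : Fin (k + 1 + 2 + 1) → ℂ) 2 = actNull g τ 2 :=
    Fin.snoc_castSucc (α := fun _ => ℂ) 0 (actNull g τ) 2
  exact congrArg₂ (· + ·) h0 h2

theorem confAct_blockEmb_last {k : ℕ} (g : GL (Fin (k + 1 + 2)) ℝ) (ζ : Fin (k + 1 + 1) → ℂ) :
    confAct (blockEmb (k + 1) g) ζ (Fin.last (k + 1)) =
      ζ (Fin.last (k + 1)) / autFactor (blockEmb (k + 1) g) ζ := by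
  have h : actNull (blockEmb (k + 1) g) ζ ((Fin.last (k + 1)).addNat 2) = ζ (Fin.last (k + 1)) := by
    rw [actNull_blockEmb]
    exact Fin.snoc_last (α := fun _ => ℂ) _ _
  rw [confAct, h, if_neg (by simp)]

theorem confAct_blockEmb_snoc {k : ℕ} (g : GL (Fin (k + 1 + 2)) ℝ) (τ : Fin (k + 1) → ℂ) :
    confAct (blockEmb (k + 1) g) (Fin.snoc τ 0 : Fin (k + 1 + 1) → ℂ) =
      (Fin.snoc (confAct g τ) 0 : Fin (k + 1 + 1) → ℂ) := by
  funext i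
  refine Fin.lastCases ?_ (fun i => ?_) i
  · rw [confAct_blockEmb_last, Fin.snoc_last, Fin.snoc_last, zero_div]
  · rw [Fin.snoc_castSucc, confAct, autFactor_blockEmb_snoc, actNull_blockEmb_snoc, confAct]
    have h1 : (Fin.snoc (actNull g τ) 0 : Fin (k + 1 + 2 + 1) → ℂ) 1 = actNull g τ 1 :=
      Fin.snoc_castSucc (α := fun _ => ℂ) 0 (actNull g τ) 1
    have h2 : (Fin.snoc (actNull g τ) 0 : Fin (k + 1 + 2 + 1) → ℂ) (i.castSucc.addNat 2) =
        actNull g τ (i.addNat 2) := Fin.snoc_castSucc (α := fun _ => ℂ) 0 (actNull g τ) (i.addNat 2)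
    simp only [Fin.val_castSucc]
    split_ifs
    · exact congrArg (· / autFactor g τ) h1
    · exact congrArg (· / autFactor g τ) h2

theorem stdForm_snoc_of_le {R : Type*} [CommRing R] {p n : ℕ} (hpn : p ≤ n) (x : Fin n → R) (t : R) :
    stdForm p (Fin.snoc x t : Fin (n + 1) → R) = stdForm p x - t ^ 2 := by
  rw [stdForm, Fin.sum_univ_castSucc, stdForm, sub_eq_add_neg]
  congr 1
  · simp
  · simp [hpn]

theorem PreservesForm.blockEmb {m : ℕ} {g : GL (Fin (m + 2)) ℝ} (hg : PreservesForm g) :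
    PreservesForm (blockEmb m g) := by
  intro x
  have h := blockEmb_mulVec (RingHom.id ℝ) g x
  have e : ∀ {n : ℕ} (A : Matrix (Fin n) (Fin n) ℝ), A.map (RingHom.id ℝ) = A := fun A => rfl
  rw [e, e] at h
  have hx : x = (Fin.snoc (Fin.init (n := m + 2) (α := fun _ => ℝ) x) (x (Fin.last (m + 2))) :
      Fin (m + 2 + 1) → ℝ) := (Fin.snoc_init_self (n := m + 2) (α := fun _ => ℝ) x).symm
  rw [h]
  refine (stdForm_snoc_of_le (n := m + 2) (by omega) _ _).trans ?_
  rw [hg]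
  refine Eq.trans ?_ (congrArg (stdForm 2) hx).symm
  exact (stdForm_snoc_of_le (n := m + 2) (by omega) _ _).symm

theorem IsOrthPath.blockEmb {m : ℕ} {p : unitInterval → GL (Fin (m + 2)) ℝ} (hp : IsOrthPath p) :
    IsOrthPath fun t => blockEmb m (p t) where
  zero := by rw [hp.zero, map_one]
  preservesForm t := (hp.preservesForm t).blockEmb
  continuous := by
    have h := hp.continuous
    exact (h.matrix_fromBlocks continuous_const continuous_const continuous_const).matrix_reindex _ _

theorem isOrthPath_toGL {d : ℕ} {x : SOo d} (γ : Path (1 : SOo d) x) :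
    IsOrthPath fun t => toGL (γ t) where
  zero := by simp [toGL]
  preservesForm t := (γ t : indefOrth d).2
  continuous := Units.continuous_val.comp
    (continuous_subtype_val.comp (continuous_subtype_val.comp γ.continuous))

theorem isOrthPath_toGL_inv {d : ℕ} {x : SOo d} (γ : Path (1 : SOo d) x) :
    IsOrthPath fun t => (toGL (γ t))⁻¹ where
  zero := by simp [toGL]
  preservesForm t := ((γ t : indefOrth d)⁻¹).2
  continuous := Units.continuous_val.comp (continuous_inv.comp
    (continuous_subtype_val.comp (continuous_subtype_val.comp γ.continuous)))

end Block

/-! ### The representations on the Bergman spaces -/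

section Representation

variable {k : ℕ}

theorem isTotalFamily_kernelVec_confAct {p : unitInterval → GL (Fin (k + 1 + 2)) ℝ}
    (hp' : IsOrthPath fun t => (p t)⁻¹) (nu : ℝ) :
    IsTotalFamily fun τ : tube (k + 1) =>
      Bergman.kernelVec nu (confAct (p 1) (τ : Fin (k + 1) → ℂ)) := by
  intro f hf
  refine Bergman.ext_on fun w hw => ?_
  have h := (hp'.preservesForm 1).confAct_inv_confAct ((hp'.preservesForm 1).autFactor_ne_zero hw)
  rw [inv_inv] at h
  have h1 := hf ⟨_, hp'.confAct_mem_tube hw 1⟩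
  rw [Bergman.inner_kernelVec] at h1
  simp only [h] at h1
  exact h1

/-- The representation on the Bergman space, as a continuous operator. -/
theorem exists_tubeRep_clm {p : unitInterval → GL (Fin (k + 2 + 2)) ℝ} (hp : IsOrthPath p)
    (hp' : IsOrthPath fun t => (p t)⁻¹) {nu : ℝ} (hnu : (k : ℝ) + 1 < nu) :
    ∃ U : Bergman (k + 2) nu →L[ℂ] Bergman (k + 2) nu,
      (∀ f, ∀ w ∈ tube (k + 2), U f w = exp (-nu * autLog (k := k + 1) p w) * f (confAct (p 1) w)) ∧
      ∀ τ ∈ tube (k + 2), U (Bergman.kernelVec nu (confAct (p 1) τ)) =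
        exp (nu * conj (autLog (k := k + 1) p τ)) • Bergman.kernelVec nu τ := by
  have htot := isTotalFamily_kernelVec_confAct (k := k + 1) hp' nu
  have hK : ∀ τ ∈ tube (k + 2), ∀ w ∈ tube (k + 2),
      Bergman.kernelVec nu (confAct (p 1) τ) (confAct (p 1) w) =
        exp (nu * (autLog (k := k + 1) p w + conj (autLog (k := k + 1) p τ))) *
          Bergman.kernelVec nu τ w := by
    intro τ hτ w hw
    rw [Bergman.kernelVec_eq_shiftPow hnu (hp.confAct_mem_tube (k := k + 1) hτ 1)
      (hp.confAct_mem_tube (k := k + 1) hw 1), Bergman.kernelVec_eq_shiftPow hnu hτ hw]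
    simp only
    rw [hp.shiftPow_confAct (k := k + 1) hw hτ]
    ring
  obtain ⟨U, hU, -⟩ := htot.exists_clm (fun τ : tube (k + 2) =>
    exp (nu * conj (autLog (k := k + 1) p τ)) • Bergman.kernelVec nu (τ : Fin (k + 2) → ℂ))
    zero_le_one (fun τ σ => by
      rw [inner_smul_left, inner_smul_right, Bergman.inner_kernelVec, Bergman.inner_kernelVec,
        hK σ σ.2 τ τ.2, ← exp_conj, map_mul, conj_ofReal, conj_conj, mul_add, exp_add]
      push_cast
      ring)
  refine ⟨U, fun f w hw => ?_, fun τ hτ => hU ⟨τ, hτ⟩⟩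
  have h := htot.ext (S := (Bergman.evalCLM nu w).comp U)
    (T := exp (-nu * autLog (k := k + 1) p w) • Bergman.evalCLM nu (confAct (p 1) w)) (fun τ => by
      rw [ContinuousLinearMap.comp_apply, hU, smul_apply, Bergman.evalCLM_apply,
        Bergman.evalCLM_apply, hK τ τ.2 w hw, Bergman.smul_apply, smul_eq_mul, ← mul_assoc,
        ← exp_add]
      congr 2
      ring)
  exact congrArg (fun S : Bergman (k + 2) nu →L[ℂ] ℂ => S f) h

end Representation

end

theorem mainTheorem4 (m : ℕ) (hn : 3 ≤ m + 1) (l : ℕ) (lam nu : ℝ)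
    (hlam : ((m + 1 : ℕ) : ℝ) - 1 < lam) (hnu : nu = lam + l) :
    -- the integral converges
    (∀ g : Bergman m nu, ∀ ζ ∈ tube (m + 1),
      MeasureTheory.Integrable (fun τ => relKernel nu l ζ τ * g τ) (bergmanMeasure m nu)) ∧
    -- the Juhl operator is continuous, with an adjoint
    ∃ (D : Bergman (m + 1) lam →L[ℂ] Bergman m nu) (Dstar : Bergman m nu →L[ℂ] Bergman (m + 1) lam),
      (∀ f : Bergman (m + 1) lam, ∀ τ ∈ tube m, D f τ = juhlOp lam l f τ) ∧
      (∀ (g : Bergman m nu) (f : Bergman (m + 1) lam), ⟪Dstar g, f⟫_ℂ = ⟪g, D f⟫_ℂ) ∧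
      -- the adjoint is the integral operator
      (∀ g : Bergman m nu, ∀ ζ ∈ tube (m + 1),
        Dstar g ζ = holoConst (m + 1) l lam * ∫ τ, relKernel nu l ζ τ * g τ ∂(bergmanMeasure m nu)) ∧
      -- it is injective
      Function.Injective Dstar ∧
      -- it intertwines the actions of the connected covering group of the smaller group
      ∀ (x : SOo m) (γ : Path (1 : SOo m) x) (g : Bergman m nu),
        ∃ h : Bergman m nu,
          (∀ τ ∈ tube m, h τ = tubeRep nu (fun t => toGL (γ t)) g τ) ∧
          ∀ ζ ∈ tube (m + 1),
            Dstar h ζ = tubeRep lam (fun t => blockEmb m (toGL (γ t))) (Dstar g) ζ := by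
  obtain ⟨k, rfl⟩ : ∃ k, m = k + 2 := ⟨m - 2, by omega⟩
  have hlam' : (k : ℝ) + 2 < lam := by push_cast at hlam; linarith
  have hnu' : (k : ℝ) + 1 < nu := by
    have : (0 : ℝ) ≤ l := Nat.cast_nonneg l
    rw [hnu]; linarith
  obtain ⟨T, c, hc, hadj, hTT, hT⟩ := exists_juhlOp_adjoint l hlam' hnu
  have hint : ∀ (g : Bergman (k + 2) nu), ∀ ζ ∈ tube (k + 2 + 1),
      (fun τ => T (Bergman.kernelVec nu τ) ζ * g τ) =ᵐ[bergmanMeasure (k + 2) nu]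
        fun τ => holoConst (k + 2 + 1) l lam * (relKernel nu l ζ τ * g τ) := by
    intro g ζ hζ
    filter_upwards [ae_mem_tube (k + 2) nu] with τ hτ
    rw [hT τ hτ ζ hζ, ← holoConst_mul_relKernel hnu, mul_assoc]
  have hC : holoConst (k + 2 + 1) l lam ≠ 0 := by
    intro h
    have h1 := holoConst_mul_exp (k + 2) l lam
    rw [h, zero_mul] at h1
    have h2 := bergmanConst_pos (k := k + 1) (lam := lam) (by push_cast; linarith)
    have h3 := juhlConst_pos (lam := lam) (α := lam - ((k + 2 : ℕ) : ℝ) / 2) l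
      (by have := (Nat.cast_nonneg k : (0 : ℝ) ≤ k); linarith)
      (by have := (Nat.cast_nonneg k : (0 : ℝ) ≤ k); push_cast; linarith)
    exact (mul_pos h2 h3).ne (ofReal_injective (by simpa using h1))
  refine ⟨fun g ζ hζ => ?_, T.adjoint, T, hadj, fun g f => ?_, fun g ζ hζ => ?_, fun f g hfg => ?_,
    fun x γ g => ?_⟩
  · have h := ((Bergman.clm_apply_eq_integral T ζ g).1.congr (hint g ζ hζ)).const_mul
      (holoConst (k + 2 + 1) l lam)⁻¹
    simpa [← mul_assoc, inv_mul_cancel₀ hC] using h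
  · rw [ContinuousLinearMap.adjoint_inner_right]
  · rw [(Bergman.clm_apply_eq_integral T ζ g).2, integral_congr_ae (hint g ζ hζ),
      integral_const_mul]
  · have h := congrArg T.adjoint hfg
    rw [hTT, hTT] at h
    exact smul_right_injective _ (ofReal_ne_zero.2 hc.ne') h
  · have hp := isOrthPath_toGL_inv γ
    have hp' : IsOrthPath fun t => ((toGL (γ t))⁻¹)⁻¹ := by simpa using isOrthPath_toGL γ
    obtain ⟨U, hU, hUK⟩ := exists_tubeRep_clm hp hp' hnu'
    refine ⟨U g, fun τ hτ => hU g τ hτ, fun ζ hζ => ?_⟩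
    set p : unitInterval → GL (Fin (k + 2 + 2)) ℝ := fun t => (toGL (γ t))⁻¹ with hpdef
    set P : unitInterval → GL (Fin (k + 2 + 1 + 2)) ℝ := fun t => blockEmb (k + 2) (p t) with hPdef
    have hP : IsOrthPath P := hp.blockEmb
    have hrep : tubeRep lam (fun t => blockEmb (k + 2) (toGL (γ t))) (T g) ζ =
        exp (-(lam : ℂ) * autLog (k := k + 2) P ζ) * T g (confAct (P 1) ζ) := by
      simp only [tubeRep, ← map_inv]; rfl
    rw [hrep]
    have hGζ := hP.confAct_mem_tube (k := k + 2) hζ 1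
    have hkey : ∀ τ ∈ tube (k + 2), T (Bergman.kernelVec nu (confAct (p 1) τ)) (confAct (P 1) ζ) =
        exp (lam * autLog (k := k + 2) P ζ + nu * conj (autLog (k := k + 1) p τ)) *
          T (Bergman.kernelVec nu τ) ζ := by
      intro τ hτ
      have hs : (Fin.snoc τ 0 : Fin (k + 2 + 1) → ℂ) ∈ tube (k + 2 + 1) := snoc_mem_tube hτ
      have hlog : autLog (k := k + 2) P (Fin.snoc τ 0 : Fin (k + 2 + 1) → ℂ) =
          autLog (k := k + 1) p τ :=
        congrArg pathLog (funext fun t => autFactor_blockEmb_snoc (k := k + 1) (p t) τ)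
      have h1 := hP.shiftPow_confAct (k := k + 2) hζ hs nu
      rw [hlog, show confAct (P 1) (Fin.snoc τ 0 : Fin (k + 2 + 1) → ℂ) =
        (Fin.snoc (confAct (p 1) τ) 0 : Fin (k + 2 + 1) → ℂ) from
          confAct_blockEmb_snoc (k := k + 1) (p 1) τ, conjVec_snoc, conjVec_snoc] at h1
      have h2 : confAct (P 1) ζ (Fin.last (k + 2)) =
          ζ (Fin.last (k + 2)) * exp (-autLog (k := k + 2) P ζ) := by
        rw [exp_neg, hP.exp_autLog (k := k + 2) hζ, ← div_eq_mul_inv]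
        exact confAct_blockEmb_last (k := k + 1) (p 1) ζ
      rw [hT _ (hp.confAct_mem_tube (k := k + 1) hτ 1) _ hGζ, hT τ hτ ζ hζ, h1, h2, mul_pow,
        ← exp_nat_mul]
      have h3 : exp (lam * autLog (k := k + 2) P ζ + nu * conj (autLog (k := k + 1) p τ)) =
          exp (l * -autLog (k := k + 2) P ζ) *
            exp (nu * (autLog (k := k + 2) P ζ + conj (autLog (k := k + 1) p τ))) := by
        rw [← exp_add, hnu]; congr 1; push_cast; ring
      rw [h3]
      ring
    have h := (isTotalFamily_kernelVec_confAct (k := k + 1) hp' nu).ext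
      (S := (Bergman.evalCLM lam ζ).comp (T.comp U))
      (T := exp (-(lam : ℂ) * autLog (k := k + 2) P ζ) •
        (Bergman.evalCLM lam (confAct (P 1) ζ)).comp T) (fun τ => by
        rw [ContinuousLinearMap.comp_apply, ContinuousLinearMap.comp_apply, smul_apply,
          ContinuousLinearMap.comp_apply, Bergman.evalCLM_apply, Bergman.evalCLM_apply]
        rw [hUK τ τ.2, map_smul, Bergman.smul_apply, hkey τ τ.2, smul_eq_mul, ← mul_assoc,
          ← exp_add]
        congr 2
        ring)
    exact congrArg (fun S : Bergman (k + 2) nu →L[ℂ] ℂ => S g) h
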